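/- **Lemma 3.4 (Convergence to Gaussian measures).** Let $\mathfrak H$ be a separable complex Hilbert space, let $1\le p<\infty$, and let $h\ge 0$ be a self-adjoint operator on $\mathfrak H$ with $\mathrm{tr}_{\mathfrak H}(h^{-p})<\infty$ (in particular $h$ has a bounded inverse). Let $\mathcal F(\mathfrak H)=\bigoplus_{n\ge0}\bigotimes_s^n\mathfrak H$ be the bosonic Fock space, $\mathcal N=\bigoplus_n n\,\mathbf 1$ the number operator, $\mathbb H_0=0\oplus\bigoplus_{n\ge1}\big(\sum_{j=1}^n h_j\big)$ and, for $T>0$, $$\Gamma_{0,T}=Z_0(T)^{-1}e^{-\mathbb H_0/T},\qquad Z_0(T)=\mathrm{tr}_{\mathcal F(\mathfrak H)}\,e^{-\mathbb H_0/T}.$$ For a state $\Gamma=G_0\oplus G_1\oplus\cdots$ on $\mathcal F(\mathfrak H)$ let $\Gamma^{(k)}=\sum_{n\ge k}\binom nk \mathrm{tr}_{k+1\to n}(G_n)$ be its $k$-particle density matrix, and let $A^{\otimes k}$ denote the restriction to $\bigotimes_s^k\mathfrak H$ of the $k$-th tensor power of a bounded operator $A$. Let $(u_i)$ be any orthonormal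 basis of $\mathfrak H$ with $hu_i=\lambda_iu_i$. For $s\in\mathbb R$ let $\mathfrak H^{s}$ be the space of (formal) series $u=\sum_i\alpha_iu_i$ with $\|u\|_{\mathfrak H^s}^2=\sum_i\lambda_i^s|\alpha_i|^2<\infty$, and let $$d\mu_0(u)=\bigotimes_i\Big(\frac{\lambda_i}{\pi}e^{-\lambda_i|\alpha_i|^2}\,d\alpha_i\Big),$$ a probability measure on families $(\alpha_i)$ of complex numbers. Then the following holds. 1. For every integer $k\ge1$ and every $T>0$, the density matrix $\Gamma_{0,T}^{(k)}$ exists, belongs to the Schatten space $\mathfrak S^p(\bigotimes_s^k\mathfrak H)$, and is given by $$\Gamma_{0,T}^{(k)}=\Big(\frac1{e^{h/T}-1}\Big)^{\otimes k}.$$ 2. $\mu_0(\mathfrak H^{1-p})=1$ and, for every $k\ge1$, $$\gamma_0^{(k)}:=\int_{\mathfrak H^{1-p}}|u^{\otimes k}\rangle\langle u^{\otimes k}|\,d\mu_0(u)=k!\,(h^{-1})^{\otimes k}.$$ Here $|u^{\otimes k}\rangle\langle u^{\otimes k}|$ is a bounded operator from $\bigotimes_s^k\mathfrak H^{p-1}$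 to its dual $\bigotimes_s^k\mathfrak H^{1-p}$, of norm $\|u\|_{\mathfrak H^{1-p}}^{2k}$. The equality means that this norm is $\mu_0$-integrable over $\mathfrak H^{1-p}$ and that $$\int_{\mathfrak H^{1-p}}\langle\Phi,u^{\otimes k}\rangle\langle u^{\otimes k},\Psi\rangle\,d\mu_0(u)=\langle\Phi,k!\,(h^{-1})^{\otimes k}\Psi\rangle$$ for all $\Phi,\Psi\in\bigotimes_s^k\mathfrak H^{p-1}$, with an absolutely convergent integral. 3. For every $k\ge1$, $\gamma_0^{(k)}=k!\,(h^{-1})^{\otimes k}$ belongs to $\mathfrak S^p(\bigotimes_s^k\mathfrak H)$ and $$\Big\|\frac{k!}{T^k}\,\Gamma_{0,T}^{(k)}-k!\,(h^{-1})^{\otimes k}\Big\|_{\mathfrak S^p(\bigotimes_s^k\mathfrak H)}\longrightarrow0\qquad\text{as }T\to\infty.$$ 4. The number of particles satisfies $$\lim_{T\to\infty}\frac{\mathrm{tr}_{\mathcal F(\mathfrak H)}(\mathcal N\,\Gamma_{0,T})}{T}=\mathrm{tr}_{\mathfrak H}(h^{-1})\in[0,\infty].$$ -/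

import Mathlib

open scoped InnerProductSpace ENNReal ComplexOrder

noncomputable section

namespace FreeGibbs

universe v

/-! ### Traces and Schatten norms of bounded operators -/

section Trace

variable (K : Type*) [NormedAddCommGroup K] [InnerProductSpace ℂ K] [CompleteSpace K]

/-- Index set of a fixed orthonormal (Hilbert) basis of `K`. -/
def stdIndex : Set K := (exists_hilbertBasis ℂ K).choose

/-- A fixed orthonormal (Hilbert) basis of `K`. -/
def stdBasis : HilbertBasis (stdIndex K) ℂ K := (exists_hilbertBasis ℂ K).choose_spec.choose

variable {K}

/-- The trace, in `[0, ∞]`, of a nonnegative bounded operator: the sum of its diagonal matrix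
elements in an orthonormal basis (which does not depend on the basis). -/
def opTrace (A : K →L[ℂ] K) : ℝ≥0∞ :=
  ∑' i, ENNReal.ofReal (⟪stdBasis K i, A (stdBasis K i)⟫_ℂ).re

/-- The Schatten norm `(tr (A* A)^(p/2))^(1/p)`, in `[0, ∞]`. It is finite exactly when `A`
belongs to the Schatten space `𝔖^p`. The power of the nonnegative operator `A* A` is that of the
continuous functional calculus. -/
def schattenNorm (p : ℝ) (A : K →L[ℂ] K) : ℝ≥0∞ :=
  (opTrace ((ContinuousLinearMap.adjoint A * A) ^ (p / 2))) ^ (1 / p)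

end Trace

/-! ### Unbounded operators -/

section Unbounded

variable {K : Type*} [NormedAddCommGroup K] [InnerProductSpace ℂ K]

/-- `x` is in the domain of `A` and `A x = a x` (`x = 0` is allowed). -/
def IsEigen (A : K →ₗ.[ℂ] K) (a : ℝ) (x : K) : Prop :=
  ∃ hx : x ∈ A.domain, A ⟨x, hx⟩ = (a : ℂ) • x

/-- `B` is the bounded operator `f(A)` given by the functional calculus of the self-adjoint operator
`A` with pure point spectrum: the eigenvectors of `A` span a dense subspace, and `B` multiplies by
`f a` each eigenvector with eigenvalue `a`. This determines `B`. -/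
def IsFunctionOf (A : K →ₗ.[ℂ] K) (f : ℝ → ℝ) (B : K →L[ℂ] K) : Prop :=
  Dense (Submodule.span ℂ {x : K | ∃ a : ℝ, IsEigen A a x} : Set K) ∧
    ∀ (a : ℝ) (x : K), IsEigen A a x → B x = (f a : ℂ) • x

open Classical in
/-- The bounded operator `f(A)`, for `A` self-adjoint with pure point spectrum and `f` bounded on
the set of eigenvalues. -/
def opFun (A : K →ₗ.[ℂ] K) (f : ℝ → ℝ) : K →L[ℂ] K :=
  if h : ∃ B, IsFunctionOf A f B then h.choose else 0

theorem IsFunctionOf.unique {A : K →ₗ.[ℂ] K} {f : ℝ → ℝ} {B C : K →L[ℂ] K}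
    (hB : IsFunctionOf A f B) (hC : IsFunctionOf A f C) : B = C := by
  refine ContinuousLinearMap.ext_on hB.1 ?_
  rintro x ⟨a, hx⟩
  rw [hB.2 a x hx, hC.2 a x hx]

/-- `B` is the bounded inverse of `A`. -/
def IsBoundedInverse (A : K →ₗ.[ℂ] K) (B : K →L[ℂ] K) : Prop :=
  (∀ x : A.domain, B (A x) = x) ∧ ∀ y : K, ∃ hy : B y ∈ A.domain, A ⟨B y, hy⟩ = y

/-- `tr (A^(-p))`, in `[0, ∞]`, for a nonnegative self-adjoint operator `A`: the trace of the
`p`-th power of `A⁻¹` if `A` has a bounded inverse, and `∞` otherwise. -/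
def traceInvPow [CompleteSpace K] (A : K →ₗ.[ℂ] K) (p : ℝ) : ℝ≥0∞ :=
  ⨅ (B : K →L[ℂ] K) (_ : IsBoundedInverse A B), opTrace (B ^ p)

end Unbounded

variable (H : Type v) [NormedAddCommGroup H] [InnerProductSpace ℂ H]

/-! ### Hilbert tensor powers

The Hilbert space tensor power `⊗ⁿ H` is the completion of the span of formal symbols
`f₁ ⊗ ⋯ ⊗ fₙ` for the inner product `⟨f₁ ⊗ ⋯ ⊗ fₙ, g₁ ⊗ ⋯ ⊗ gₙ⟩ = ∏ᵢ ⟨fᵢ, gᵢ⟩`, that is, the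
reproducing kernel Hilbert space of this kernel. -/

section Tensor

/-- The kernel `(f, g) ↦ ∏ᵢ ⟨fᵢ, gᵢ⟩`, as a matrix of operators on `ℂ`. -/
def tensorKernel (n : ℕ) : Matrix (Fin n → H) (Fin n → H) (ℂ →L[ℂ] ℂ) :=
  fun f g => (∏ i, ⟪f i, g i⟫_ℂ) • ContinuousLinearMap.id ℂ ℂ

theorem posSemidef_prod_inner (n : ℕ) :
    (Matrix.of fun f g : Fin n → H => ∏ i, ⟪f i, g i⟫_ℂ).PosSemidef := by
  have key : ∀ s : Finset (Fin n),
      (Matrix.of fun f g : Fin n → H => ∏ i ∈ s, ⟪f i, g i⟫_ℂ).PosSemidef := by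
    intro s
    induction s using Finset.induction_on with
    | empty =>
      refine ⟨by ext f g; simp, fun x => ?_⟩
      have : (x.sum fun i xi => x.sum fun j xj => star xi *
          (Matrix.of fun f g : Fin n → H => ∏ i ∈ (∅ : Finset (Fin n)), ⟪f i, g i⟫_ℂ) i j * xj)
          = star (x.sum fun _ xi => xi) * (x.sum fun _ xj => xj) := by
        simp [Finsupp.sum, Finset.sum_mul_sum]
      rw [this]
      exact star_mul_self_nonneg _
    | insert a s ha ih =>
      have hgram : (Matrix.of fun f g : Fin n → H => ⟪f a, g a⟫_ℂ).PosSemidef := by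
        refine ⟨by ext f g; simp [Matrix.conjTranspose_apply], fun x => ?_⟩
        have : (x.sum fun i xi => x.sum fun j xj => star xi *
            (Matrix.of fun f g : Fin n → H => ⟪f a, g a⟫_ℂ) i j * xj)
            = ⟪x.sum fun i xi => xi • i a, x.sum fun i xi => xi • i a⟫_ℂ := by
          simp only [Finsupp.sum, sum_inner, inner_sum, inner_smul_left, inner_smul_right,
            Matrix.of_apply]
          simp only [Finset.mul_sum]
          rw [Finset.sum_comm]
          refine Finset.sum_congr rfl fun i _ => Finset.sum_congr rfl fun j _ => ?_
          simp only [RCLike.star_def]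
          ring
        rw [this, inner_self_eq_norm_sq_to_K, ← RCLike.ofReal_pow]
        exact RCLike.ofReal_nonneg.2 (sq_nonneg _)
      have e : (Matrix.of fun f g : Fin n → H => ∏ i ∈ insert a s, ⟪f i, g i⟫_ℂ) =
          Matrix.hadamard (Matrix.of fun f g : Fin n → H => ⟪f a, g a⟫_ℂ)
            (Matrix.of fun f g : Fin n → H => ∏ i ∈ s, ⟪f i, g i⟫_ℂ) := by
        ext f g
        simp [Finset.prod_insert ha]
      rw [e]
      exact hgram.hadamard ih
  exact key Finset.univ

instance tensorKernel_posSemidef (n : ℕ) : Fact (tensorKernel H n).PosSemidef := by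
  have e := (RKHS.posSemidef_tfae (K := tensorKernel H n)).out 0 2
  refine ⟨e.2 ⟨?_, fun x => ?_⟩⟩
  · ext f g
    simp [tensorKernel, Matrix.conjTranspose_apply, ContinuousLinearMap.star_eq_adjoint,
      ContinuousLinearMap.adjoint_id]
  · have h := (posSemidef_prod_inner H n).2 x
    refine le_of_le_of_eq (Complex.le_def.1 h).1 ?_
    congr 1
    simp only [Finsupp.sum, tensorKernel, Matrix.of_apply]
    refine Finset.sum_congr rfl fun i _ => Finset.sum_congr rfl fun j _ => ?_
    simp
    ring

/-- The Hilbert space `⊗ⁿ H`. -/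
abbrev TensorPow (n : ℕ) : Type v := RKHS.OfKernel (tensorKernel H n)

variable {H}

/-- The simple tensor `f₁ ⊗ ⋯ ⊗ fₙ`. -/
def tprod {n : ℕ} (f : Fin n → H) : TensorPow H n :=
  RKHS.kerFun (TensorPow H n) f (1 : ℂ)

theorem inner_tprod {n : ℕ} (f g : Fin n → H) :
    ⟪tprod f, tprod g⟫_ℂ = ∏ i, ⟪f i, g i⟫_ℂ := by
  rw [tprod, tprod, ← RKHS.kernel_inner, RKHS.OfKernel.kernel_ofKernel]
  simp [tensorKernel]

theorem dense_span_tprod (n : ℕ) :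
    Dense (Submodule.span ℂ (Set.range (tprod : (Fin n → H) → TensorPow H n)) :
      Set (TensorPow H n)) := by
  have h := RKHS.kerFun_dense (H := TensorPow H n)
  rw [← Submodule.dense_iff_topologicalClosure_eq_top] at h
  refine h.mono (Submodule.span_le.2 ?_)
  rintro _ ⟨f, c, rfl⟩
  have : RKHS.kerFun (TensorPow H n) f c = c • tprod f := by
    rw [tprod, ← map_smul, smul_eq_mul, mul_one]
  rw [this]
  exact Submodule.smul_mem _ _ (Submodule.subset_span ⟨f, rfl⟩)

/-- The symmetric tensor product
`f₁ ⊗ₛ ⋯ ⊗ₛ fₙ = (n!)^(-1/2) ∑_σ f_{σ(1)} ⊗ ⋯ ⊗ f_{σ(n)}`, as a vector of `⊗ⁿ H`. -/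
def symTensor {n : ℕ} (f : Fin n → H) : TensorPow H n :=
  ((Real.sqrt (n.factorial : ℝ) : ℂ))⁻¹ • ∑ σ : Equiv.Perm (Fin n), tprod (f ∘ σ)

variable (H) in
/-- The bosonic subspace `⊗ₛⁿ H` of `⊗ⁿ H`, the closed span of the symmetric tensor products. -/
def SymPow (n : ℕ) : Submodule ℂ (TensorPow H n) :=
  (Submodule.span ℂ (Set.range (symTensor : (Fin n → H) → TensorPow H n))).topologicalClosure

instance (n : ℕ) : CompleteSpace (SymPow H n) :=
  (Submodule.isClosed_topologicalClosure _).completeSpace_coe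

/-- The symmetric tensor product `f₁ ⊗ₛ ⋯ ⊗ₛ fₙ`, as a vector of `⊗ₛⁿ H`. -/
def symProd {n : ℕ} (f : Fin n → H) : SymPow H n :=
  ⟨symTensor f, Submodule.le_topologicalClosure _ (Submodule.subset_span ⟨f, rfl⟩)⟩

variable (H) in
/-- The orthogonal projection of `⊗ⁿ H` onto `⊗ₛⁿ H`. -/
def symProj (n : ℕ) : TensorPow H n →L[ℂ] SymPow H n :=
  (SymPow H n).orthogonalProjectionOnto

open Classical in
/-- The operator `A^{⊗n}` on `⊗ₛⁿ H`, for `A` bounded: the bounded operator with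
`A^{⊗n} (f₁ ⊗ₛ ⋯ ⊗ₛ fₙ) = A f₁ ⊗ₛ ⋯ ⊗ₛ A fₙ`. -/
def opTensorPow (A : H →L[ℂ] H) (n : ℕ) : SymPow H n →L[ℂ] SymPow H n :=
  if h : ∃ B : SymPow H n →L[ℂ] SymPow H n, ∀ f : Fin n → H, B (symProd f) = symProd (A ∘ f) then
    h.choose
  else 0

end Tensor

/-! ### Fock space, second quantization and Gibbs states -/

section Fock

/-- The bosonic Fock space `⊕ₙ ⊗ₛⁿ H` (Hilbert space direct sum). -/
abbrev Fock : Type v := lp (fun n : ℕ => SymPow H n) 2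

/-- The inclusion of the `n`-particle sector. -/
def sector (n : ℕ) : SymPow H n →L[ℂ] Fock H :=
  lp.singleContinuousLinearMap ℂ (fun n : ℕ => SymPow H n) 2 n

variable {H}

/-- The second quantization `ℍ₀ = 0 ⊕ ⨁ₙ (∑ⱼ hⱼ)` of an operator `h` on `H`: the closure of the
operator defined on finite sums of the vectors `f₁ ⊗ₛ ⋯ ⊗ₛ fₙ`, with `fⱼ` in the domain of `h`, by
`f₁ ⊗ₛ ⋯ ⊗ₛ fₙ ↦ ∑ⱼ f₁ ⊗ₛ ⋯ ⊗ₛ h fⱼ ⊗ₛ ⋯ ⊗ₛ fₙ`. -/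
def secondQuant (h : H →ₗ.[ℂ] H) : Fock H →ₗ.[ℂ] Fock H :=
  (Submodule.span ℂ {x : Fock H × Fock H | ∃ (n : ℕ) (f : Fin n → h.domain),
    x = (sector H n (symProd fun i => (f i : H)),
      ∑ j, sector H n (symProd (Function.update (fun i => (f i : H)) j (h (f j)))))}
    ).topologicalClosure.toLinearPMap

/-- The partition function `tr exp (-ℍ₀ / T)`, in `[0, ∞]`. -/
def partitionFunction (h : H →ₗ.[ℂ] H) (T : ℝ) : ℝ≥0∞ :=
  opTrace (opFun (secondQuant h) fun a => Real.exp (-a / T))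

/-- The Gibbs state `Γ_{0,T} = Z₀(T)⁻¹ exp (-ℍ₀ / T)`. -/
def gibbs (h : H →ₗ.[ℂ] H) (T : ℝ) : Fock H →L[ℂ] Fock H :=
  (((partitionFunction h T).toReal⁻¹ : ℝ) : ℂ) •
    opFun (secondQuant h) fun a => Real.exp (-a / T)

/-- The diagonal block `Gₙ` of an operator on Fock space, acting on `⊗ₛⁿ H`. -/
def block (Γ : Fock H →L[ℂ] Fock H) (n : ℕ) : SymPow H n →L[ℂ] SymPow H n :=
  ContinuousLinearMap.adjoint (sector H n) ∘L Γ ∘L sector H n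

/-- `tr (𝒩 Γ) = ∑ₙ n tr Gₙ`, in `[0, ∞]`, for a state `Γ` with diagonal blocks `Gₙ`. -/
def numberExpectation (Γ : Fock H →L[ℂ] Fock H) : ℝ≥0∞ :=
  ∑' n : ℕ, (n : ℝ≥0∞) * opTrace (block Γ n)

variable [CompleteSpace H]

/-- `D` is the `k`-particle density matrix `Γ^{(k)} = ∑_{n ≥ k} (n choose k) tr_{k+1 → n} Gₙ`
of `Γ`. Here `Gₙ` is extended by zero from `⊗ₛⁿ H` to `⊗ⁿ H`, as `D` is from `⊗ₛᵏ H` to `⊗ᵏ H`, and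
the partial trace over the last `m = n - k` variables is
`⟨f, (tr_{k+1 → n} G) g⟩ = ∑ⱼ ⟨f ⊗ e_{j₁} ⊗ ⋯ ⊗ e_{jₘ}, G (g ⊗ e_{j₁} ⊗ ⋯ ⊗ e_{jₘ})⟩`, where `(eⱼ)` is
an orthonormal basis of `H`. -/
def IsDensityMatrix (Γ : Fock H →L[ℂ] Fock H) (k : ℕ) (D : SymPow H k →L[ℂ] SymPow H k) : Prop :=
  ∀ f g : Fin k → H,
    HasSum (fun x : Σ m : ℕ, (Fin m → stdIndex H) =>
      ((k + x.1).choose k : ℂ) *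
        ⟪symProj H (k + x.1) (tprod (Fin.append f fun l => stdBasis H (x.2 l))),
          block Γ (k + x.1)
            (symProj H (k + x.1) (tprod (Fin.append g fun l => stdBasis H (x.2 l))))⟫_ℂ)
      ⟪symProj H k (tprod f), D (symProj H k (tprod g))⟫_ℂ

open Classical in
/-- The `k`-particle density matrix `Γ^{(k)}`. -/
def densityMatrix (Γ : Fock H →L[ℂ] Fock H) (k : ℕ) : SymPow H k →L[ℂ] SymPow H k :=
  if h : ∃ D, IsDensityMatrix Γ k D then h.choose else 0

end Fock

/-! ### The Gaussian measure

A vector `u = ∑ αᵢ uᵢ`, in the scale of spaces attached to an operator with an orthonormal basis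
`(uᵢ)` of eigenvectors and eigenvalues `lam i`, is identified with the family of its coordinates. -/

section Gaussian

open MeasureTheory

variable {ι : Type*} (lam : ι → ℝ)

/-- `‖u‖²` in the space `ℌ^s`, that is, `∑ᵢ λᵢ^s |αᵢ|²`. -/
def sobolevNormSq (s : ℝ) (α : ι → ℂ) : ℝ := ∑' i, lam i ^ s * ‖α i‖ ^ 2

/-- The space `ℌ^s`. -/
def sobolevSpace (s : ℝ) : Set (ι → ℂ) := {α | Summable fun i => lam i ^ s * ‖α i‖ ^ 2}

/-- The Gaussian measure `(a / π) exp (-a |z|²) dz` on `ℂ`. -/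
def complexGaussian (a : ℝ) : Measure ℂ :=
  volume.withDensity fun z => ENNReal.ofReal (a / Real.pi * Real.exp (-a * ‖z‖ ^ 2))

/-- The Gaussian measure `μ₀ = ⨂ᵢ (λᵢ / π) exp (-λᵢ |αᵢ|²) dαᵢ`. -/
def mu0 : Measure (ι → ℂ) := Measure.infinitePi fun i => complexGaussian (lam i)

variable {H} (u : ι → H)

/-- The coordinates `⟨u_{i₁} ⊗ ⋯ ⊗ u_{iₖ}, Ψ⟩` of `Ψ ∈ ⊗ₛᵏ H`. -/
def coord {k : ℕ} (Ψ : SymPow H k) (i : Fin k → ι) : ℂ := ⟪tprod (u ∘ i), (Ψ : TensorPow H k)⟫_ℂ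

/-- The space `⊗ₛᵏ ℌ^s`, for `s ≥ 0`, as a set of vectors of `⊗ₛᵏ H`. -/
def symSobolevSpace (k : ℕ) (s : ℝ) : Set (SymPow H k) :=
  {Ψ | Summable fun i : Fin k → ι => (∏ l, lam (i l) ^ s) * ‖coord u Ψ i‖ ^ 2}

/-- The duality pairing `⟨v^{⊗k}, Ψ⟩` of `v = ∑ αᵢ uᵢ` in `ℌ^{-s}` and `Ψ` in `⊗ₛᵏ ℌ^s`. -/
def tensorPairing {k : ℕ} (α : ι → ℂ) (Ψ : SymPow H k) : ℂ :=
  ∑' i : Fin k → ι, (∏ l, starRingEnd ℂ (α (i l))) * coord u Ψ i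

/-- `G` is the operator `γ₀^{(k)} = ∫_{ℌ^{1-p}} |v^{⊗k}⟩⟨v^{⊗k}| dμ₀(v)`. The integrand is a bounded
operator from `⊗ₛᵏ ℌ^{p-1}` to its dual `⊗ₛᵏ ℌ^{1-p}`, of norm `‖v‖^{2k}` in `ℌ^{1-p}`; the measure
`μ₀` lives on `ℌ^{1-p}`, the integral converges absolutely, and it is given by `G`. -/
structure IsGaussianDensityMatrix (p : ℝ) (k : ℕ) (G : SymPow H k →L[ℂ] SymPow H k) : Prop where
  measure_eq_one : mu0 lam (sobolevSpace lam (1 - p)) = 1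
  integrable_norm :
    IntegrableOn (fun α => sobolevNormSq lam (1 - p) α ^ k) (sobolevSpace lam (1 - p)) (mu0 lam)
  integrable_form : ∀ Φ ∈ symSobolevSpace lam u k (p - 1), ∀ Ψ ∈ symSobolevSpace lam u k (p - 1),
    IntegrableOn (fun α => starRingEnd ℂ (tensorPairing u α Φ) * tensorPairing u α Ψ)
      (sobolevSpace lam (1 - p)) (mu0 lam)
  integral_form : ∀ Φ ∈ symSobolevSpace lam u k (p - 1), ∀ Ψ ∈ symSobolevSpace lam u k (p - 1),
    ∫ α in sobolevSpace lam (1 - p),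
      starRingEnd ℂ (tensorPairing u α Φ) * tensorPairing u α Ψ ∂mu0 lam = ⟪Φ, G Ψ⟫_ℂ

end Gaussian

end FreeGibbs

end

set_option linter.unusedSectionVars false

open scoped InnerProductSpace ENNReal ComplexOrder

noncomputable section

namespace FreeGibbs

universe v

/-! ### Parseval families, traces and diagonal operators -/

section Parseval

variable {K : Type*} [NormedAddCommGroup K] [InnerProductSpace ℂ K]

/-! Everything is reduced to the eigenvalues of `h`. If `B` is its bounded inverse, finiteness of
the trace of `B ^ p` says that `B ^ (p / 2)` is Hilbert-Schmidt, hence compact, so the spectral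
theorem gives an orthonormal basis of eigenvectors of `h` (`exists_eigenbasis`), with eigenvalues
bounded below by a positive constant and `∑ lam j ^ (-p) < ∞`. In bosonic sectors, traces are
computed with the symmetrised product vectors. They form a Parseval family rather than a basis, and
this suffices (`opTrace_eq_of_isParseval`).

The operator `exp (-ℍ₀ / T)` is the direct sum of the powers `q^{⊗n}` with `q = exp (-h / T)`, trace
class and of norm less than one. Its matrix elements between symmetrised products are permanents
over `n!`, so a density matrix is a sum of permanents in which some rows and columns carry the same
basis vectors. Expand such a permanent along the row of a given vector `φ`. Either `φ` is paired
with one of the given vectors, or with a traced basis vector; summing over the latter removes one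
traced particle and replaces `φ` by `q φ`. Iteration produces the Neumann series `q + q² + ⋯ = q /
(1 - q) = r`, and induction on the number of given vectors yields `Z` times the permanent of `r`
(`wickTerm_optCons`, `hasSum_wickTerm`).

The same recursion, closed up by a sum over the eigenbasis, is Newton's identity for the traces `Zₙ`
of `q^{⊗n}` (`IsThermal.newton`). It bounds `∑ n Zₙ` by a constant times `∑ Zₙ` on partial sums,
which forces `∑ Zₙ < ∞` (`tsum_opTrace_ne_top`), and summed over all `n` it gives the mean particle
number `tr r`. No product formula for the partition function is needed.

On the Gaussian side, rotation invariance kills the unbalanced moments of one mode and the balanced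
ones are `m! / lam ^ m`. Independence and a count of permutations give Wick's formula
(`integral_prod_mul_prod_conj`). Moments of the `ℌ^{1-p}` norm are then at most `k! (∑ lam ^ (-p)) ^
k`, and weighted arithmetic-geometric inequalities justify integrating the pairings term by term
(`integral_conj_tensorPairing_mul`).

Finally `1 / (T (exp (lam / T) - 1))` is at most `1 / lam` and converges to it. Dominated
convergence gives the Schatten limit (`tendsto_schattenNorm_sub`), and a comparison with finite
partial sums gives the particle number limit even when it is infinite (`tendsto_tsum_ofReal_div`).
-/

/-- A family of vectors for which Parseval's identity holds. -/
def IsParseval {J : Type*} (v : J → K) : Prop :=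
  ∀ x : K, ∑' i, ‖⟪v i, x⟫_ℂ‖ₑ ^ 2 = ‖x‖ₑ ^ 2

theorem enorm_sq_eq_ofReal {E : Type*} [SeminormedAddCommGroup E] (x : E) :
    ‖x‖ₑ ^ 2 = ENNReal.ofReal (‖x‖ ^ 2) := by
  rw [← ofReal_norm, ENNReal.ofReal_pow (norm_nonneg _)]

theorem hasSum_norm_inner_sq {J : Type*} (b : HilbertBasis J ℂ K) (x : K) :
    HasSum (fun i => ‖⟪b i, x⟫_ℂ‖ ^ 2) (‖x‖ ^ 2) := by
  have h := b.hasSum_inner_mul_inner x x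
  have h2 := Complex.hasSum_re h
  rw [inner_self_eq_norm_sq_to_K] at h2
  convert h2 using 1
  · ext i
    rw [← inner_conj_symm x (b i), mul_comm, RCLike.mul_conj]
    norm_cast
  · norm_cast

theorem HilbertBasis.isParseval {J : Type*} (b : HilbertBasis J ℂ K) : IsParseval b := by
  intro x
  have h := hasSum_norm_inner_sq b x
  simp_rw [enorm_sq_eq_ofReal]
  rw [← h.tsum_eq, ENNReal.ofReal_tsum_of_nonneg (fun _ => by positivity) h.summable]

variable [CompleteSpace K]

/-- Both sides are the double sum of `|⟨w j, S (v i)⟩|²`, summed in either order. Only Parseval's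
identity is used, so neither family has to be orthonormal. -/
theorem tsum_enorm_sq_adjoint {J L : Type*} {v : J → K} {w : L → K} (hv : IsParseval v)
    (hw : IsParseval w) (S : K →L[ℂ] K) :
    ∑' i, ‖S (v i)‖ₑ ^ 2 = ∑' j, ‖ContinuousLinearMap.adjoint S (w j)‖ₑ ^ 2 := by
  calc ∑' i, ‖S (v i)‖ₑ ^ 2 = ∑' i, ∑' j, ‖⟪w j, S (v i)⟫_ℂ‖ₑ ^ 2 := by
        simp_rw [hw _]
    _ = ∑' j, ∑' i, ‖⟪w j, S (v i)⟫_ℂ‖ₑ ^ 2 := ENNReal.tsum_comm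
    _ = ∑' j, ∑' i, ‖⟪v i, ContinuousLinearMap.adjoint S (w j)⟫_ℂ‖ₑ ^ 2 := by
        refine tsum_congr fun j => tsum_congr fun i => ?_
        rw [ContinuousLinearMap.adjoint_inner_right, ← inner_conj_symm, RCLike.enorm_conj]
    _ = _ := by simp_rw [hv _]

theorem ofReal_re_inner_eq_enorm_sq {A S : K →L[ℂ] K} (hA : A = star S * S) (x : K) :
    ENNReal.ofReal (⟪x, A x⟫_ℂ).re = ‖S x‖ₑ ^ 2 := by
  rw [hA, ContinuousLinearMap.star_eq_adjoint, mul_apply_eq_comp,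
    ContinuousLinearMap.adjoint_inner_right, inner_self_eq_norm_sq_to_K, enorm_sq_eq_ofReal]
  norm_cast

theorem exists_eq_star_mul_self {A : K →L[ℂ] K} (hA : 0 ≤ A) :
    ∃ S : K →L[ℂ] K, IsSelfAdjoint S ∧ A = star S * S := by
  obtain ⟨S, hS, h⟩ := CStarAlgebra.nonneg_iff_exists_isSelfAdjoint_and_eq_mul_self.1 hA
  exact ⟨S, hS, by rw [hS.star_eq, h]⟩

theorem tsum_inner_eq_of_isParseval {J L : Type*} {v : J → K} {w : L → K} (hv : IsParseval v)
    (hw : IsParseval w) {A : K →L[ℂ] K} (hA : 0 ≤ A) :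
    ∑' i, ENNReal.ofReal (⟪v i, A (v i)⟫_ℂ).re = ∑' i, ENNReal.ofReal (⟪w i, A (w i)⟫_ℂ).re := by
  obtain ⟨S, hS, h⟩ := exists_eq_star_mul_self hA
  simp_rw [ofReal_re_inner_eq_enorm_sq h]
  rw [tsum_enorm_sq_adjoint hv hw, ← ContinuousLinearMap.star_eq_adjoint, hS.star_eq]

/-- This allows traces over bosonic spaces to be taken along projected product vectors, which are
redundant and not normalised, instead of an occupation number basis. -/
theorem opTrace_eq_of_isParseval {J : Type*} {v : J → K} (hv : IsParseval v)
    {A : K →L[ℂ] K} (hA : 0 ≤ A) :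
    opTrace A = ∑' i, ENNReal.ofReal (⟪v i, A (v i)⟫_ℂ).re :=
  tsum_inner_eq_of_isParseval (HilbertBasis.isParseval _) hv hA

end Parseval

/-! ### Eigenvectors under the functional calculus, and diagonal operators -/

section Eigen

variable {K : Type*} [NormedAddCommGroup K] [InnerProductSpace ℂ K] [CompleteSpace K]

/-- The functions with this property form a closed subalgebra that contains the identity, so
Stone-Weierstrass applies. -/
theorem cfcHom_apply_eigenvector {A : K →L[ℂ] K} (hA : IsSelfAdjoint A) {a : ℝ} {x : K}
    (hx : A x = (a : ℂ) • x) (ha : a ∈ spectrum ℝ A) (f : C(spectrum ℝ A, ℝ)) :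
    cfcHom (R := ℝ) hA f x = ((f ⟨a, ha⟩ : ℝ) : ℂ) • x := by
  induction f using ContinuousMap.induction_on_of_compact with
  | const r =>
    have : ContinuousMap.const (spectrum ℝ A) r = algebraMap ℝ C(spectrum ℝ A, ℝ) r := rfl
    rw [this, AlgHomClass.commutes]
    simp [Algebra.algebraMap_eq_smul_one]
  | id =>
    rw [cfcHom_id]
    simpa using hx
  | star_id =>
    rw [map_star, cfcHom_id, hA.star_eq]
    simpa using hx
  | add f g hf hg =>
    rw [map_add, add_apply, hf, hg, ContinuousMap.add_apply, Complex.ofReal_add,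
      add_smul]
  | mul f g hf hg =>
    rw [map_mul, mul_apply_eq_comp, hg, map_smul, hf, ContinuousMap.mul_apply, Complex.ofReal_mul,
      mul_comm, mul_smul]
  | frequently f hf =>
    refine hf.mem_of_closed (s := {g | cfcHom hA g x = ((g ⟨a, ha⟩ : ℝ) : ℂ) • x}) ?_
    refine isClosed_eq ?_ ?_
    · exact (ContinuousLinearMap.apply ℂ K x).continuous.comp (cfcHom_continuous hA)
    · exact (Complex.continuous_ofReal.comp (continuous_eval_const _)).smul continuous_const

theorem mem_spectrum_of_eigenvector {A : K →L[ℂ] K} {a : ℝ} {x : K}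
    (hx : A x = (a : ℂ) • x) (h0 : x ≠ 0) : a ∈ spectrum ℝ A := by
  intro hu
  obtain ⟨u, hu⟩ := hu
  have h1 : (algebraMap ℝ (K →L[ℂ] K) a - A) x = 0 := by
    simp [Algebra.algebraMap_eq_smul_one, hx]
  have h2 : ((↑u⁻¹ : K →L[ℂ] K) * (u : K →L[ℂ] K)) x = 0 := by
    rw [mul_apply_eq_comp, hu, h1, map_zero]
  rw [Units.inv_mul] at h2
  exact h0 h2

theorem cfc_apply_eigenvector {A : K →L[ℂ] K} (hA : IsSelfAdjoint A) {a : ℝ} {x : K}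
    (hx : A x = (a : ℂ) • x) {f : ℝ → ℝ} (hf : ContinuousOn f (spectrum ℝ A)) :
    cfc f A x = (f a : ℂ) • x := by
  by_cases h0 : x = 0
  · simp [h0]
  · rw [cfc_apply f A hA hf, cfcHom_apply_eigenvector hA hx (mem_spectrum_of_eigenvector hx h0)]
    rfl

theorem rpow_apply_eigenvector {A : K →L[ℂ] K} (hA : 0 ≤ A) {a : ℝ} {x : K}
    (hx : A x = (a : ℂ) • x) {s : ℝ} (hs : 0 ≤ s) :
    (A ^ s) x = ((a ^ s : ℝ) : ℂ) • x := by
  rw [CFC.rpow_eq_cfc_real hA]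
  refine cfc_apply_eigenvector (IsSelfAdjoint.of_nonneg hA) hx (Continuous.continuousOn ?_)
  exact Real.continuous_rpow_const hs

variable {J : Type*} (b : HilbertBasis J ℂ K)

theorem exists_diagonal (c : J → ℝ) (M : ℝ) (hc : ∀ j, |c j| ≤ M) :
    ∃ D : K →L[ℂ] K, (∀ j x, ⟪b j, D x⟫_ℂ = c j * ⟪b j, x⟫_ℂ) := by
  have key (i : J) : ‖((c i : ℂ) • ContinuousLinearMap.id ℂ ℂ)‖ ≤ max M 0 := by
    refine ContinuousLinearMap.opNorm_le_bound _ (le_max_right _ _) fun x => ?_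
    simpa using mul_le_mul_of_nonneg_right (le_max_of_le_left (hc i)) (norm_nonneg x)
  let D0 := lp.mapCLM (𝕜 := ℂ) (E := fun _ : J => ℂ) (F := fun _ : J => ℂ) 2
    (fun i => (c i : ℂ) • ContinuousLinearMap.id ℂ ℂ) (le_max_right M 0) key
  refine ⟨(b.repr.symm.toContinuousLinearEquiv : _ →L[ℂ] K) ∘L D0 ∘L
    (b.repr.toContinuousLinearEquiv : K →L[ℂ] _), fun j x => ?_⟩
  rw [← b.repr_apply_apply, ← b.repr_apply_apply]
  simp [D0]

theorem ext_inner_hilbertBasis {x y : K} (h : ∀ j, ⟪b j, x⟫_ℂ = ⟪b j, y⟫_ℂ) : x = y := by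
  apply b.repr.injective
  ext j
  rw [b.repr_apply_apply, b.repr_apply_apply, h]

theorem apply_basis_of_inner {D : K →L[ℂ] K} {c : J → ℝ}
    (hD : ∀ j x, ⟪b j, D x⟫_ℂ = c j * ⟪b j, x⟫_ℂ) (j : J) : D (b j) = (c j : ℂ) • b j := by
  classical
  refine ext_inner_hilbertBasis b fun i => ?_
  rw [hD, inner_smul_right, orthonormal_iff_ite.1 b.orthonormal]
  split_ifs with h
  · rw [h]
  · simp

theorem inner_of_apply_basis {D : K →L[ℂ] K} {c : J → ℝ}
    (hD : ∀ j, D (b j) = (c j : ℂ) • b j) (j : J) (x : K) :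
    ⟪b j, D x⟫_ℂ = c j * ⟪b j, x⟫_ℂ := by
  classical
  have h : ∀ x ∈ Submodule.span ℂ (Set.range b), ⟪b j, D x⟫_ℂ = c j * ⟪b j, x⟫_ℂ := by
    intro x hx
    induction hx using Submodule.span_induction with
    | mem x h =>
      obtain ⟨i, rfl⟩ := h
      rw [hD, inner_smul_right, orthonormal_iff_ite.1 b.orthonormal]
      split_ifs with h
      · rw [h]
      · simp
    | zero => simp
    | add x y _ _ h1 h2 => simp [h1, h2, mul_add]
    | smul r x _ h1 => simp [h1]; ring
  have hd : Dense (Submodule.span ℂ (Set.range b) : Set K) := by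
    rw [Submodule.dense_iff_topologicalClosure_eq_top]; exact b.dense_span
  refine congrFun (Continuous.ext_on hd (f := fun x => ⟪b j, D x⟫_ℂ)
    (g := fun x => c j * ⟪b j, x⟫_ℂ) (by fun_prop) (by fun_prop) h) x

theorem inner_diagonal_eq_tsum {D : K →L[ℂ] K} {c : J → ℝ}
    (hD : ∀ j, D (b j) = (c j : ℂ) • b j) (x y : K) :
    HasSum (fun j => (c j : ℂ) * (⟪x, b j⟫_ℂ * ⟪b j, y⟫_ℂ)) ⟪x, D y⟫_ℂ := by
  have h := b.hasSum_inner_mul_inner x (D y)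
  simp_rw [inner_of_apply_basis b hD] at h
  exact h.congr_fun fun j => by ring

theorem diagonal_inner_left {D : K →L[ℂ] K} {c : J → ℝ}
    (hD : ∀ j, D (b j) = (c j : ℂ) • b j) (x y : K) : ⟪D x, y⟫_ℂ = ⟪x, D y⟫_ℂ := by
  refine HasSum.unique ?_ (inner_diagonal_eq_tsum b hD x y)
  refine (b.hasSum_inner_mul_inner (D x) y).congr_fun fun j => ?_
  rw [← inner_conj_symm (D x), inner_of_apply_basis b hD, map_mul, inner_conj_symm,
    Complex.conj_ofReal]
  ring

theorem diagonal_isSelfAdjoint {D : K →L[ℂ] K} {c : J → ℝ}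
    (hD : ∀ j, D (b j) = (c j : ℂ) • b j) : IsSelfAdjoint D := by
  rw [ContinuousLinearMap.isSelfAdjoint_iff_isSymmetric]
  exact fun x y => diagonal_inner_left b hD x y

theorem diagonal_nonneg {D : K →L[ℂ] K} {c : J → ℝ} (hc : ∀ j, 0 ≤ c j)
    (hD : ∀ j, D (b j) = (c j : ℂ) • b j) : 0 ≤ D := by
  rw [ContinuousLinearMap.nonneg_iff_isPositive, ContinuousLinearMap.isPositive_def]
  refine ⟨fun x y => diagonal_inner_left b hD x y, fun x => ?_⟩
  rw [ContinuousLinearMap.reApplyInnerSelf_apply, diagonal_inner_left b hD]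
  have h := Complex.hasSum_re (inner_diagonal_eq_tsum b hD x x)
  refine h.nonneg fun j => ?_
  rw [← inner_conj_symm x (b j), RCLike.conj_mul]
  rw [← RCLike.ofReal_pow]
  exact (Complex.re_ofReal_mul _ _).symm ▸ mul_nonneg (hc j) (sq_nonneg _)

theorem opTrace_diagonal {D : K →L[ℂ] K} {c : J → ℝ} (hc : ∀ j, 0 ≤ c j)
    (hD : ∀ j, D (b j) = (c j : ℂ) • b j) : opTrace D = ∑' j, ENNReal.ofReal (c j) := by
  rw [opTrace_eq_of_isParseval (HilbertBasis.isParseval b) (diagonal_nonneg b hc hD)]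
  refine tsum_congr fun j => ?_
  rw [hD, inner_smul_right, inner_self_eq_norm_sq_to_K, b.orthonormal.1 j]
  simp

end Eigen

/-! ### Orthonormal bases of eigenvectors -/

section Compact

variable {K : Type*} [NormedAddCommGroup K] [InnerProductSpace ℂ K] [CompleteSpace K]

theorem isCompactOperator_rankOne (x y : K) :
    IsCompactOperator (InnerProductSpace.rankOne ℂ x y) := by
  have h : IsCompactOperator (innerSL ℂ y : K →L[ℂ] ℂ) :=
    isCompactOperator_of_locallyCompactSpace_dom (innerSL ℂ y)
  exact h.clm_comp (ContinuousLinearMap.toSpanSingleton ℂ x)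

/-- A self-adjoint Hilbert-Schmidt operator is compact. -/
theorem isCompactOperator_of_summable {J : Type*} (b : HilbertBasis J ℂ K) {S : K →L[ℂ] K}
    (hS : IsSelfAdjoint S) (hsum : Summable fun j => ‖S (b j)‖ ^ 2) : IsCompactOperator S := by
  classical
  -- By symmetry of `S` this is the finite rank operator `P S`, where `P` projects onto the span of
  -- the `b j` with `j ∈ s`. The error is controlled by the tail of the Hilbert-Schmidt sum.
  let F : Finset J → K →L[ℂ] K := fun s => ∑ j ∈ s, InnerProductSpace.rankOne ℂ (b j) (S (b j))
  have hsymm := ContinuousLinearMap.isSelfAdjoint_iff_isSymmetric.1 hS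
  have hbound : ∀ s : Finset J,
      ‖F s - S‖ ≤ Real.sqrt (∑' j : {j // j ∉ s}, ‖S (b j)‖ ^ 2) := by
    intro s
    refine ContinuousLinearMap.opNorm_le_bound _ (Real.sqrt_nonneg _) fun x => ?_
    have hcoef : ∀ j, ⟪b j, (F s - S) x⟫_ℂ = if j ∈ s then 0 else -⟪S (b j), x⟫_ℂ := by
      intro j
      have h1 : ⟪b j, F s x⟫_ℂ = if j ∈ s then ⟪S (b j), x⟫_ℂ else 0 := by
        simp [F, orthonormal_iff_ite.1 b.orthonormal]
      have h2 : ⟪b j, S x⟫_ℂ = ⟪S (b j), x⟫_ℂ := (hsymm (b j) x).symm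
      rw [sub_apply, inner_sub_right, h1, h2]
      split_ifs <;> simp
    have h3 := hasSum_norm_inner_sq b ((F s - S) x)
    have h4 : Summable fun j : {j // j ∉ s} => ‖S (b j)‖ ^ 2 := hsum.subtype _
    have h5 : HasSum (fun j : {j // j ∉ s} => ‖⟪b j, (F s - S) x⟫_ℂ‖ ^ 2) (‖(F s - S) x‖ ^ 2) := by
      refine (hasSum_subtype_iff_of_support_subset (s := {j | j ∉ s}) ?_).2 h3
      intro j hj
      by_contra hjs
      rw [Set.mem_ofPred_eq, not_not] at hjs
      rw [Function.mem_support, hcoef, if_pos hjs] at hj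
      simp at hj
    have h6 : ‖(F s - S) x‖ ^ 2 ≤ (∑' j : {j // j ∉ s}, ‖S (b j)‖ ^ 2) * ‖x‖ ^ 2 := by
      refine hasSum_le (fun j => ?_) h5 (h4.hasSum.mul_right (‖x‖ ^ 2))
      rw [hcoef, if_neg j.2, norm_neg, ← mul_pow]
      exact pow_le_pow_left₀ (norm_nonneg _) (norm_inner_le_norm _ _) 2
    refine le_of_sq_le_sq ?_ (by positivity)
    rw [mul_pow, Real.sq_sqrt (tsum_nonneg fun _ => by positivity)]
    exact h6
  have htend : Filter.Tendsto F Filter.atTop (nhds S) := by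
    rw [tendsto_iff_norm_sub_tendsto_zero]
    refine squeeze_zero (fun _ => norm_nonneg _) hbound ?_
    have := tendsto_tsum_compl_atTop_zero fun j => ‖S (b j)‖ ^ 2
    simpa [Function.comp_def] using (Real.continuous_sqrt.tendsto 0).comp this
  refine isCompactOperator_of_tendsto htend (Filter.Eventually.of_forall fun s => ?_)
  refine Submodule.sum_mem (compactOperator (RingHom.id ℂ) K K) fun j _ => ?_
  exact isCompactOperator_rankOne _ _

end Compact

variable {H : Type v} [NormedAddCommGroup H] [InnerProductSpace ℂ H] [CompleteSpace H]

/-- Bases of the eigenspaces with real eigenvalue are glued together. The family is complete because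
the eigenspaces of a compact self-adjoint operator span a dense subspace and a nonzero eigenvector
has a real eigenvalue. -/
theorem exists_hilbertBasis_eigenvectors {S : H →L[ℂ] H} (hS : IsSelfAdjoint S)
    (hc : IsCompactOperator S) :
    ∃ (J : Type v) (b : HilbertBasis J ℂ H) (s : J → ℝ), ∀ j, S (b j) = (s j : ℂ) • b j := by
  have hsymm := ContinuousLinearMap.isSelfAdjoint_iff_isSymmetric.1 hS
  let E : ℝ → Submodule ℂ H := fun r => Module.End.eigenspace (S : Module.End ℂ H) (r : ℂ)
  have hE : ∀ r, CompleteSpace (E r) := fun r => by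
    have : IsClosed (E r : Set H) := by
      have : (E r : Set H) = {x | S x = (r : ℂ) • x} := by
        ext x
        exact Module.End.mem_eigenspace_iff
      rw [this]
      exact isClosed_eq S.continuous (continuous_const_smul _)
    exact this.completeSpace_coe
  let w : ∀ r, HilbertBasis (stdIndex (E r)) ℂ (E r) := fun r => stdBasis (E r)
  let v : (Σ r : ℝ, stdIndex (E r)) → H := fun a => (w a.1 a.2 : H)
  have hort : Orthonormal ℂ v := by
    have h1 := hsymm.orthogonalFamily_eigenspaces.comp (γ := ℝ) Complex.ofReal_injective
    exact h1.orthonormal_sigma_orthonormal (fun r => (w r).orthonormal)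
  have hsp : (Submodule.span ℂ (Set.range v))ᗮ = ⊥ := by
    rw [eq_bot_iff, ← ContinuousLinearMap.orthogonalComplement_iSup_eigenspaces_eq_bot hc hsymm]
    intro x hx
    rw [Submodule.mem_orthogonal'] at hx
    rw [← Submodule.iInf_orthogonal, Submodule.mem_iInf]
    intro μ
    rw [Submodule.mem_orthogonal']
    intro y hy
    by_cases hy0 : y = 0
    · simp [hy0]
    have hμ : (starRingEnd ℂ) μ = μ := hsymm.conj_eigenvalue_eq_self
      (Module.End.hasEigenvalue_of_hasEigenvector ⟨hy, hy0⟩)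
    obtain ⟨r, rfl⟩ := Complex.conj_eq_iff_real.1 hμ
    have hd : Dense (Submodule.span ℂ (Set.range (w r)) : Set (E r)) := by
      rw [Submodule.dense_iff_topologicalClosure_eq_top]; exact (w r).dense_span
    have key : (fun z : E r => ⟪x, (z : H)⟫_ℂ) = fun _ => 0 := by
      refine Continuous.ext_on hd (by fun_prop) (by fun_prop) ?_
      intro z hz
      induction hz using Submodule.span_induction with
      | mem z hz =>
        obtain ⟨i, rfl⟩ := hz
        exact hx _ (Submodule.subset_span ⟨⟨r, i⟩, rfl⟩)
      | zero => simp
      | add y z _ _ h1 h2 => simp only at h1 h2; simp [h1, h2]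
      | smul c z _ h1 => simp only at h1; simp [h1]
    exact congrFun key ⟨y, hy⟩
  refine ⟨_, HilbertBasis.mkOfOrthogonalEqBot hort hsp, fun a => a.1, fun a => ?_⟩
  rw [HilbertBasis.coe_mkOfOrthogonalEqBot]
  exact Module.End.mem_eigenspace_iff.1 (w a.1 a.2).2

/-! ### Eigenvalues of `h` obtained from its bounded inverse -/

section Inverse

variable {h : H →ₗ.[ℂ] H} {B : H →L[ℂ] H}

theorem inner_symm_of_isSelfAdjoint (hsa : IsSelfAdjoint h) (x y : h.domain) :
    ⟪h x, (y : H)⟫_ℂ = ⟪(x : H), h y⟫_ℂ := by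
  have h1 := LinearPMap.adjoint_isFormalAdjoint hsa.dense_domain
  rw [LinearPMap.isSelfAdjoint_def.1 hsa] at h1
  exact h1 x y

theorem IsBoundedInverse.unique {C : H →L[ℂ] H} (hB : IsBoundedInverse h B)
    (hC : IsBoundedInverse h C) : B = C := by
  ext y
  obtain ⟨hy, h1⟩ := hC.2 y
  conv_lhs => rw [← h1]
  exact hB.1 ⟨C y, hy⟩

theorem traceInvPow_eq (hB : IsBoundedInverse h B) (p : ℝ) : traceInvPow h p = opTrace (B ^ p) := by
  refine le_antisymm (iInf₂_le B hB) (le_iInf₂ fun C hC => ?_)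
  rw [hB.unique hC]

theorem exists_isBoundedInverse {p : ℝ} (htr : traceInvPow h p < ∞) :
    ∃ B, IsBoundedInverse h B ∧ opTrace (B ^ p) < ∞ := by
  simpa [traceInvPow, iInf_lt_iff] using htr

theorem IsBoundedInverse.nonneg (hB : IsBoundedInverse h B) (hsa : IsSelfAdjoint h)
    (hnonneg : ∀ x : h.domain, 0 ≤ (⟪(x : H), h x⟫_ℂ).re) : 0 ≤ B := by
  have hsymm : ∀ x y, ⟪B x, y⟫_ℂ = ⟪x, B y⟫_ℂ := by
    intro x y
    obtain ⟨hx, h1⟩ := hB.2 x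
    obtain ⟨hy, h2⟩ := hB.2 y
    have := inner_symm_of_isSelfAdjoint hsa ⟨B x, hx⟩ ⟨B y, hy⟩
    rw [h1, h2] at this
    exact this.symm
  rw [ContinuousLinearMap.nonneg_iff_isPositive, ContinuousLinearMap.isPositive_def]
  refine ⟨hsymm, fun x => ?_⟩
  obtain ⟨hx, h1⟩ := hB.2 x
  rw [ContinuousLinearMap.reApplyInnerSelf_apply]
  have := hnonneg ⟨B x, hx⟩
  rwa [h1] at this

theorem IsBoundedInverse.isEigen (hB : IsBoundedInverse h B) {c : ℝ} {x : H} (hc : c ≠ 0)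
    (hx : B x = (c : ℂ) • x) : IsEigen h c⁻¹ x := by
  obtain ⟨h1, h2⟩ := hB.2 x
  have hx' : x = (c : ℂ)⁻¹ • B x := by
    rw [hx, smul_smul, inv_mul_cancel₀ (by exact_mod_cast hc), one_smul]
  have hmem : x ∈ h.domain := by
    rw [hx']; exact h.domain.smul_mem _ h1
  refine ⟨hmem, ?_⟩
  have h3 : (⟨x, hmem⟩ : h.domain) = (c : ℂ)⁻¹ • ⟨B x, h1⟩ := Subtype.ext hx'
  rw [h3, h.map_smul, h2]
  push_cast
  rfl

theorem IsBoundedInverse.apply_eigenvector (hB : IsBoundedInverse h B) {a : ℝ} {x : H}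
    (hx : IsEigen h a x) (h0 : x ≠ 0) : a ≠ 0 ∧ B x = ((a⁻¹ : ℝ) : ℂ) • x := by
  obtain ⟨hm, he⟩ := hx
  have h1 := hB.1 ⟨x, hm⟩
  rw [he, map_smul] at h1
  have ha : a ≠ 0 := by
    rintro rfl
    simp at h1
    exact h0 h1.symm
  refine ⟨ha, ?_⟩
  have hac : (a : ℂ) ≠ 0 := by exact_mod_cast ha
  have h2 : x = (a : ℂ) • B x := h1.symm
  conv_rhs => rw [h2]
  rw [smul_smul]
  push_cast
  rw [inv_mul_cancel₀ hac, one_smul]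

/-- The trace of `B ^ p` is the squared Hilbert-Schmidt norm of `B ^ (p / 2)`, which is therefore
compact. Its eigenvectors are eigenvectors of `B`, the `2 / p`-th power, and the eigenvalues are
nonzero because an inverse has trivial kernel. -/
theorem exists_eigenbasis {p : ℝ} (hp : 1 ≤ p) (hB : IsBoundedInverse h B) (hB0 : 0 ≤ B)
    (htr : opTrace (B ^ p) < ∞) :
    ∃ (J : Type v) (u : HilbertBasis J ℂ H) (lam : J → ℝ), ∀ j, IsEigen h (lam j) (u j) := by
  have hS0 : 0 ≤ B ^ (p / 2) := CFC.rpow_nonneg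
  have hSsa : IsSelfAdjoint (B ^ (p / 2)) := IsSelfAdjoint.of_nonneg hS0
  have hsq : B ^ p = star (B ^ (p / 2)) * B ^ (p / 2) := by
    rw [hSsa.star_eq, ← pow_two, ← CFC.rpow_natCast _ 2 hS0,
      CFC.rpow_rpow_of_exponent_nonneg B _ _ (by linarith) (by norm_num) hB0]
    congr 1
    push_cast
    ring
  have hsum : Summable fun j => ‖(B ^ (p / 2)) (stdBasis H j)‖ ^ 2 := by
    rw [opTrace] at htr
    simp_rw [ofReal_re_inner_eq_enorm_sq hsq, enorm_sq_eq_ofReal] at htr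
    have := ENNReal.summable_toReal htr.ne
    simpa only [ENNReal.toReal_ofReal (sq_nonneg _)] using this
  obtain ⟨J, u, s, hs⟩ := exists_hilbertBasis_eigenvectors hSsa
    (isCompactOperator_of_summable (stdBasis H) hSsa hsum)
  have hBu : ∀ j, B (u j) = ((s j ^ (2 / p) : ℝ) : ℂ) • u j := by
    intro j
    have h1 := rpow_apply_eigenvector hS0 (hs j) (s := 2 / p) (by positivity)
    rw [CFC.rpow_rpow_of_exponent_nonneg B _ _ (by linarith) (by positivity) hB0] at h1
    rwa [show p / 2 * (2 / p) = 1 by field_simp, CFC.rpow_one B hB0] at h1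
  refine ⟨J, u, fun j => (s j ^ (2 / p))⁻¹, fun j => ?_⟩
  refine hB.isEigen ?_ (hBu j)
  intro h0
  have h1 := hBu j
  rw [h0] at h1
  obtain ⟨h2, h3⟩ := hB.2 (u j)
  have h4 : (⟨B (u j), h2⟩ : h.domain) = 0 := Subtype.ext (by simp [h1])
  rw [h4, h.map_zero] at h3
  exact u.orthonormal.ne_zero j h3.symm

variable {J : Type*} {u : HilbertBasis J ℂ H} {lam : J → ℝ}

theorem eigenvalue_pos (hB : IsBoundedInverse h B)
    (hnonneg : ∀ x : h.domain, 0 ≤ (⟪(x : H), h x⟫_ℂ).re)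
    (hu : ∀ j, IsEigen h (lam j) (u j)) (j : J) : 0 < lam j := by
  have h0 := (hB.apply_eigenvector (hu j) (u.orthonormal.ne_zero j)).1
  obtain ⟨hm, he⟩ := hu j
  have h1 := hnonneg ⟨u j, hm⟩
  rw [he, inner_smul_right, inner_self_eq_norm_sq_to_K, u.orthonormal.1 j] at h1
  simp at h1
  exact lt_of_le_of_ne h1 h0.symm

theorem opTrace_inverse_rpow (hB : IsBoundedInverse h B) (hB0 : 0 ≤ B)
    (hu : ∀ j, IsEigen h (lam j) (u j)) (hpos : ∀ j, 0 < lam j) {p : ℝ} (hp : 0 ≤ p) :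
    opTrace (B ^ p) = ∑' j, ENNReal.ofReal (lam j ^ (-p)) := by
  refine opTrace_diagonal u (fun j => Real.rpow_nonneg (hpos j).le _) fun j => ?_
  rw [rpow_apply_eigenvector hB0 (hB.apply_eigenvector (hu j) (u.orthonormal.ne_zero j)).2 hp,
    Real.inv_rpow (hpos j).le, Real.rpow_neg (hpos j).le]

theorem IsBoundedInverse.exists_le_eigenvalue (hB : IsBoundedInverse h B)
    (hu : ∀ j, IsEigen h (lam j) (u j)) (hpos : ∀ j, 0 < lam j) :
    ∃ M : ℝ, 0 < M ∧ ∀ j, M ≤ lam j := by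
  refine ⟨(‖B‖ + 1)⁻¹, by positivity, fun j => ?_⟩
  have h1 := (hB.apply_eigenvector (hu j) (u.orthonormal.ne_zero j)).2
  have h2 := B.le_opNorm (u j)
  rw [h1, norm_smul, u.orthonormal.1 j, Complex.norm_real, Real.norm_of_nonneg
    (inv_nonneg.2 (hpos j).le), mul_one, mul_one] at h2
  exact inv_le_of_inv_le₀ (hpos j) (h2.trans (by linarith))

/-- The functional calculus of a symmetric operator with an orthonormal basis of eigenvectors. -/
theorem isFunctionOf_of_eigenbasis
    (hsymm : ∀ x y : h.domain, ⟪h x, (y : H)⟫_ℂ = ⟪(x : H), h y⟫_ℂ)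
    (hu : ∀ j, IsEigen h (lam j) (u j)) {f : ℝ → ℝ} {D : H →L[ℂ] H}
    (hD : ∀ j, D (u j) = (f (lam j) : ℂ) • u j) : IsFunctionOf h f D := by
  constructor
  · have hd : Dense (Submodule.span ℂ (Set.range u) : Set H) := by
      rw [Submodule.dense_iff_topologicalClosure_eq_top]; exact u.dense_span
    refine hd.mono (Submodule.span_mono ?_)
    rintro _ ⟨j, rfl⟩
    exact ⟨lam j, hu j⟩
  · rintro a x ⟨hx, hax⟩
    refine ext_inner_hilbertBasis u fun j => ?_
    rw [inner_of_apply_basis u hD, inner_smul_right]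
    obtain ⟨hm, he⟩ := hu j
    have h1 := hsymm ⟨u j, hm⟩ ⟨x, hx⟩
    rw [he, hax, inner_smul_left, inner_smul_right, Complex.conj_ofReal] at h1
    simp only at h1
    -- By symmetry, an eigenvector with eigenvalue `a` has a nonzero coefficient along `u j` only if
    -- `lam j = a`.
    by_cases h0 : ⟪u j, x⟫_ℂ = 0
    · simp [h0]
    · have h2 := mul_right_cancel₀ h0 h1
      rw [Complex.ofReal_inj.1 h2]

theorem opFun_eq {K : Type*} [NormedAddCommGroup K] [InnerProductSpace ℂ K] {A : K →ₗ.[ℂ] K}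
    {f : ℝ → ℝ} {B : K →L[ℂ] K} (hB : IsFunctionOf A f B) : opFun A f = B := by
  have h : ∃ B, IsFunctionOf A f B := ⟨B, hB⟩
  rw [opFun, dif_pos h]
  exact h.choose_spec.unique hB

end Inverse

/-! ### Bases of tensor powers and tensor powers of diagonal operators -/

section Dense

variable {K : Type*} [NormedAddCommGroup K] [InnerProductSpace ℂ K]

theorem ext_inner_of_dense {s : Set K} (hs : Dense (Submodule.span ℂ s : Set K)) {x y : K}
    (h : ∀ v ∈ s, ⟪v, x⟫_ℂ = ⟪v, y⟫_ℂ) : x = y := by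
  refine hs.eq_of_inner_right ℂ fun v hv => ?_
  induction hv using Submodule.span_induction with
  | mem z hz => exact h z hz
  | zero => simp
  | add v w _ _ h1 h2 => rw [inner_add_left, inner_add_left, h1, h2]
  | smul c v _ h1 => rw [inner_smul_left, inner_smul_left, h1]

theorem dense_span_of_inner [CompleteSpace K] {s : Set K}
    (h : ∀ x : K, (∀ v ∈ s, ⟪v, x⟫_ℂ = 0) → x = 0) : Dense (Submodule.span ℂ s : Set K) := by
  rw [Submodule.dense_iff_topologicalClosure_eq_top, Submodule.topologicalClosure_eq_top_iff,
    eq_bot_iff]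
  intro x hx
  rw [Submodule.mem_orthogonal] at hx
  exact h x fun v hv => hx v (Submodule.subset_span hv)

theorem IsParseval.dense_span [CompleteSpace K] {J : Type*} {v : J → K} (hv : IsParseval v) :
    Dense (Submodule.span ℂ (Set.range v) : Set K) := by
  refine dense_span_of_inner fun x hx => ?_
  have h := hv x
  simp_rw [fun i => hx (v i) ⟨i, rfl⟩] at h
  simp only [enorm_zero, ne_eq, OfNat.ofNat_ne_zero, not_false_eq_true, zero_pow, tsum_zero] at h
  exact enorm_eq_zero.1 (pow_eq_zero_iff two_ne_zero |>.1 h.symm)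

theorem norm_diagonal_le [CompleteSpace K] {J : Type*} (b : HilbertBasis J ℂ K) {D : K →L[ℂ] K} {c : J → ℝ} {M : ℝ}
    (hD : ∀ j, D (b j) = (c j : ℂ) • b j) (hM : 0 ≤ M) (hc : ∀ j, |c j| ≤ M) : ‖D‖ ≤ M := by
  refine D.opNorm_le_bound hM fun x => ?_
  refine le_of_sq_le_sq ?_ (by positivity)
  rw [mul_pow]
  refine hasSum_le (fun j => ?_) (hasSum_norm_inner_sq b (D x))
    ((hasSum_norm_inner_sq b x).mul_left (M ^ 2))
  rw [inner_of_apply_basis b hD, norm_mul, mul_pow, Complex.norm_real, Real.norm_eq_abs]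
  gcongr
  exact hc j

end Dense

variable {H : Type v} [NormedAddCommGroup H] [InnerProductSpace ℂ H]

/-- In a reproducing kernel space the multilinearity of `tprod` is not built in; it is recovered by
testing against simple tensors. -/
theorem ext_inner_tprod {n : ℕ} {x y : TensorPow H n}
    (h : ∀ f : Fin n → H, ⟪tprod f, x⟫_ℂ = ⟪tprod f, y⟫_ℂ) : x = y :=
  ext_inner_of_dense (dense_span_tprod n) (by rintro _ ⟨f, rfl⟩; exact h f)

theorem norm_tprod {n : ℕ} (f : Fin n → H) : ‖tprod f‖ = ∏ i, ‖f i‖ := by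
  have h := inner_tprod f f
  simp_rw [inner_self_eq_norm_sq_to_K] at h
  rw [Finset.prod_pow] at h
  norm_cast at h
  exact (pow_left_inj₀ (norm_nonneg _) (Finset.prod_nonneg fun _ _ => norm_nonneg _)
    two_ne_zero).1 (by exact_mod_cast h)

theorem inner_tprod_update {n : ℕ} (f g : Fin n → H) (a : Fin n) (y : H) :
    ⟪tprod g, tprod (Function.update f a y)⟫_ℂ =
      ⟪g a, y⟫_ℂ * ∏ i ∈ Finset.univ.erase a, ⟪g i, f i⟫_ℂ := by
  rw [inner_tprod, ← Finset.mul_prod_erase _ _ (Finset.mem_univ a), Function.update_self]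
  congr 1
  refine Finset.prod_congr rfl fun i hi => ?_
  rw [Function.update_of_ne (Finset.ne_of_mem_erase hi)]

/-- The simple tensor as a function of one of its factors. -/
def tprodUpdate {n : ℕ} (f : Fin n → H) (a : Fin n) : H →L[ℂ] TensorPow H n :=
  LinearMap.mkContinuous
    { toFun := fun y => tprod (Function.update f a y)
      map_add' := fun y z => ext_inner_tprod fun g => by
        simp only [inner_add_right, inner_tprod_update, add_mul]
      map_smul' := fun c y => ext_inner_tprod fun g => by
        simp only [inner_smul_right, inner_tprod_update, RingHom.id_apply, mul_assoc] }
    (∏ i ∈ Finset.univ.erase a, ‖f i‖) fun y => by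
      rw [LinearMap.coe_mk, AddHom.coe_mk, norm_tprod,
        ← Finset.mul_prod_erase _ _ (Finset.mem_univ a), Function.update_self, mul_comm]
      refine le_of_eq ?_
      congr 1
      refine Finset.prod_congr rfl fun i hi => ?_
      rw [Function.update_of_ne (Finset.ne_of_mem_erase hi)]

theorem tprodUpdate_apply {n : ℕ} (f : Fin n → H) (a : Fin n) (y : H) :
    tprodUpdate f a y = tprod (Function.update f a y) := rfl

section Basis

variable {J : Type*} (b : HilbertBasis J ℂ H)

/-- The slots are freed one at a time: `s` is the set of slots that may hold arbitrary vectors, and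
a continuous linear function of one slot that vanishes on the basis vanishes. -/
theorem eq_zero_of_inner_tprod_basis {n : ℕ} {ψ : TensorPow H n}
    (h : ∀ x : Fin n → J, ⟪ψ, tprod (b ∘ x)⟫_ℂ = 0) : ψ = 0 := by
  classical
  have key : ∀ (s : Finset (Fin n)) (f : Fin n → H), (∀ i ∉ s, f i ∈ Set.range b) →
      ⟪ψ, tprod f⟫_ℂ = 0 := by
    intro s
    induction s using Finset.induction_on with
    | empty =>
      intro f hf
      choose x hx using fun i => hf i (Finset.notMem_empty i)
      rw [← h x]
      congr 2
      ext i
      exact (hx i).symm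
    | insert a s ha ih =>
      intro f hf
      have hd : Dense (Submodule.span ℂ (Set.range b) : Set H) := by
        rw [Submodule.dense_iff_topologicalClosure_eq_top]; exact b.dense_span
      have hL : (innerSL ℂ ψ : _ →L[ℂ] ℂ) ∘L tprodUpdate f a = 0 := by
        refine ContinuousLinearMap.ext_on hd ?_
        rintro _ ⟨j, rfl⟩
        rw [ContinuousLinearMap.comp_apply, tprodUpdate_apply, innerSL_apply_apply,
          zero_apply]
        refine ih _ fun i hi => ?_
        by_cases hia : i = a
        · subst hia; simp
        · rw [Function.update_of_ne hia]
          exact hf i (by simp [hia, hi])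
      have := congrArg (fun L => L (f a)) hL
      simpa [tprodUpdate_apply] using this
  refine ext_inner_tprod fun f => ?_
  rw [inner_zero_right, ← inner_conj_symm, key Finset.univ f (by simp), map_zero]

theorem orthonormal_tprod (n : ℕ) : Orthonormal ℂ fun x : Fin n → J => tprod (b ∘ x) := by
  classical
  rw [orthonormal_iff_ite]
  intro x y
  rw [inner_tprod]
  simp only [Function.comp_apply, orthonormal_iff_ite.1 b.orthonormal, Finset.prod_ite_zero,
    Finset.prod_const_one, funext_iff, Finset.mem_univ, true_imp_iff]

/-- The orthonormal basis of `⊗ⁿ H` made of the tensor products of vectors of a basis of `H`. -/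
def tensorBasis (n : ℕ) : HilbertBasis (Fin n → J) ℂ (TensorPow H n) :=
  HilbertBasis.mkOfOrthogonalEqBot (orthonormal_tprod b n) (by
    rw [eq_bot_iff]
    intro ψ hψ
    rw [Submodule.mem_orthogonal'] at hψ
    exact eq_zero_of_inner_tprod_basis b fun x => hψ _ (Submodule.subset_span ⟨x, rfl⟩))

theorem tensorBasis_apply {n : ℕ} (x : Fin n → J) : tensorBasis b n x = tprod (b ∘ x) := by
  rw [tensorBasis, HilbertBasis.coe_mkOfOrthogonalEqBot]

end Basis

section Symmetric

/-- The factor `(n!)^(-1/2)`. -/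
def symCoef (n : ℕ) : ℂ := ((Real.sqrt (n.factorial : ℝ) : ℂ))⁻¹

theorem symCoef_mul_self (n : ℕ) : symCoef n * symCoef n = (n.factorial : ℂ)⁻¹ := by
  rw [symCoef, ← mul_inv, ← Complex.ofReal_mul, Real.mul_self_sqrt (by positivity)]
  simp

theorem conj_symCoef (n : ℕ) : starRingEnd ℂ (symCoef n) = symCoef n := by
  rw [symCoef, map_inv₀, Complex.conj_ofReal]

variable {n : ℕ}

theorem symTensor_eq (f : Fin n → H) :
    symTensor f = symCoef n • ∑ σ : Equiv.Perm (Fin n), tprod (f ∘ σ) := rfl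

theorem inner_tprod_symTensor (f g : Fin n → H) :
    ⟪tprod f, symTensor g⟫_ℂ = symCoef n * ∑ σ : Equiv.Perm (Fin n), ∏ i, ⟪f i, g (σ i)⟫_ℂ := by
  rw [symTensor_eq, inner_smul_right, inner_sum]
  simp only [inner_tprod, Function.comp_apply]

theorem symTensor_comp_perm (f : Fin n → H) (τ : Equiv.Perm (Fin n)) :
    symTensor (f ∘ τ) = symTensor f := by
  rw [symTensor_eq, symTensor_eq]
  congr 1
  refine Fintype.sum_equiv (Equiv.mulLeft τ) _ _ fun σ => ?_
  rfl

theorem inner_tprod_comp_perm_symTensor (f g : Fin n → H) (τ : Equiv.Perm (Fin n)) :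
    ⟪tprod (f ∘ τ), symTensor g⟫_ℂ = ⟪tprod f, symTensor g⟫_ℂ := by
  rw [inner_tprod_symTensor, inner_tprod_symTensor]
  congr 1
  refine Fintype.sum_equiv (Equiv.mulRight τ⁻¹) _ _ fun σ => ?_
  refine Fintype.prod_equiv τ _ _ fun i => ?_
  simp

/-- The `n!` permuted simple tensors that make up the left vector all have the same inner product
with a symmetric one. -/
theorem inner_symTensor_symTensor (f g : Fin n → H) :
    ⟪symTensor f, symTensor g⟫_ℂ = symCoef n * n.factorial * ⟪tprod f, symTensor g⟫_ℂ := by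
  rw [symTensor_eq f, inner_smul_left, sum_inner]
  simp only [inner_tprod_comp_perm_symTensor, Finset.sum_const, Finset.card_univ,
    Fintype.card_perm, Fintype.card_fin, nsmul_eq_mul, conj_symCoef, mul_assoc]

theorem symCoef_mul_factorial (n : ℕ) : symCoef n * (symCoef n * n.factorial) = 1 := by
  rw [← mul_assoc, symCoef_mul_self, inv_mul_cancel₀]
  exact_mod_cast n.factorial_ne_zero

theorem inner_symProj (y : SymPow H n) (x : TensorPow H n) :
    ⟪y, symProj H n x⟫_ℂ = ⟪(y : TensorPow H n), x⟫_ℂ :=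
  Submodule.inner_orthogonalProjectionOnto_eq_of_mem_left _ _

theorem inner_symProj_left (y : SymPow H n) (x : TensorPow H n) :
    ⟪symProj H n x, y⟫_ℂ = ⟪x, (y : TensorPow H n)⟫_ℂ :=
  Submodule.inner_orthogonalProjectionOnto_eq_of_mem_right _ _

theorem symProj_coe (y : SymPow H n) : symProj H n (y : TensorPow H n) = y :=
  Submodule.orthogonalProjectionOnto_mem_subspace_eq_self y

theorem dense_span_symProd :
    Dense (Submodule.span ℂ (Set.range (symProd : (Fin n → H) → SymPow H n)) :
      Set (SymPow H n)) := by
  refine dense_span_of_inner fun x hx => ?_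
  have h1 : ∀ y ∈ SymPow H n, ⟪y, (x : TensorPow H n)⟫_ℂ = 0 := by
    intro y hy
    have hcl : IsClosed {y : TensorPow H n | ⟪y, (x : TensorPow H n)⟫_ℂ = 0} :=
      isClosed_eq (by fun_prop) continuous_const
    refine closure_minimal ?_ hcl hy
    intro z hz
    rw [SetLike.mem_coe] at hz
    rw [Set.mem_ofPred_eq]
    induction hz using Submodule.span_induction with
    | mem z hz => obtain ⟨f, rfl⟩ := hz; exact hx (symProd f) ⟨f, rfl⟩
    | zero => simp
    | add v w _ _ h1 h2 => rw [inner_add_left, h1, h2, add_zero]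
    | smul c v _ h1 => rw [inner_smul_left, h1, mul_zero]
  have h2 := h1 x x.2
  rw [inner_self_eq_zero] at h2
  exact Subtype.ext h2

/-- The projection averages over permutations with weight `1 / n!`, while `symProd` carries
`(n!)^(-1/2)`; this fixes the factor between the two conventions. -/
theorem symProj_tprod (f : Fin n → H) : symProj H n (tprod f) = symCoef n • symProd f := by
  refine ext_inner_of_dense dense_span_symProd ?_
  rintro _ ⟨g, rfl⟩
  rw [inner_symProj]
  change ⟪symTensor g, tprod f⟫_ℂ = ⟪symTensor g, symCoef n • symTensor f⟫_ℂ
  rw [inner_smul_right]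
  change ⟪symTensor g, tprod f⟫_ℂ = symCoef n * ⟪symTensor g, symTensor f⟫_ℂ
  rw [← inner_conj_symm (symTensor g) (symTensor f), inner_symTensor_symTensor, map_mul,
    inner_conj_symm, map_mul, conj_symCoef, map_natCast, ← mul_assoc, symCoef_mul_factorial,
    one_mul]

theorem symProd_eq (f : Fin n → H) :
    symProd f = (symCoef n * n.factorial) • symProj H n (tprod f) := by
  rw [symProj_tprod, smul_smul, mul_assoc, mul_comm (n.factorial : ℂ), ← mul_assoc]
  rw [mul_assoc, symCoef_mul_factorial, one_smul]

theorem symProd_comp_perm (f : Fin n → H) (τ : Equiv.Perm (Fin n)) :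
    symProd (f ∘ τ) = symProd f := Subtype.ext (symTensor_comp_perm f τ)

theorem inner_symProj_tprod (f g : Fin n → H) :
    ⟪symProj H n (tprod f), symProj H n (tprod g)⟫_ℂ =
      (n.factorial : ℂ)⁻¹ * ∑ σ : Equiv.Perm (Fin n), ∏ i, ⟪f i, g (σ i)⟫_ℂ := by
  rw [inner_symProj_left, symProj_tprod]
  change ⟪tprod f, symCoef n • symTensor g⟫_ℂ = _
  rw [inner_smul_right, inner_tprod_symTensor, ← mul_assoc, symCoef_mul_self]

variable {J : Type*} (b : HilbertBasis J ℂ H)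

/-- Projecting an orthonormal basis onto a closed subspace leaves its inner products with vectors of
that subspace unchanged. The projected vectors repeat under permutation of `x`, and their norms
compensate for it. -/
theorem isParseval_symProj_tprod (n : ℕ) :
    IsParseval fun x : Fin n → J => symProj H n (tprod (b ∘ x)) := by
  intro y
  simp_rw [inner_symProj_left, ← tensorBasis_apply]
  exact HilbertBasis.isParseval (tensorBasis b n) y

theorem norm_symProj_tprod_basis_le (x : Fin n → J) : ‖symProj H n (tprod (b ∘ x))‖ ≤ 1 := by
  refine (Submodule.norm_orthogonalProjectionOnto_apply_le _ _).trans ?_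
  rw [← tensorBasis_apply, (tensorBasis b n).orthonormal.1 x]

end Symmetric

section OpTensorPow

variable {n : ℕ} {J : Type*} {u : HilbertBasis J ℂ H} {A : H →L[ℂ] H} {c : J → ℝ}

theorem abs_eigenvalue_le_norm (hA : ∀ j, A (u j) = (c j : ℂ) • u j) (j : J) : |c j| ≤ ‖A‖ := by
  have h := A.le_opNorm (u j)
  rwa [hA, norm_smul, u.orthonormal.1 j, mul_one, mul_one, Complex.norm_real] at h

variable [CompleteSpace H]

/-- On the full tensor power the operator is diagonal in the product basis, and it maps symmetric
tensor products to symmetric tensor products. Its compression therefore realises the operator chosen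
in `opTensorPow`, and positivity and norm bounds are read off from `D`. -/
theorem exists_diagonal_opTensorPow (hA : ∀ j, A (u j) = (c j : ℂ) • u j) (n : ℕ) :
    ∃ D : TensorPow H n →L[ℂ] TensorPow H n,
      (∀ x, D (tensorBasis u n x) = ((∏ l, c (x l) : ℝ) : ℂ) • tensorBasis u n x) ∧
      (∀ f : Fin n → H, D (tprod f) = tprod (A ∘ f)) ∧
      opTensorPow A n = symProj H n ∘L D ∘L (SymPow H n).subtypeL := by
  obtain ⟨D, hD⟩ := exists_diagonal (tensorBasis u n) (fun x => ∏ l, c (x l)) (‖A‖ ^ n) (by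
    intro x
    rw [Finset.abs_prod]
    refine (Finset.prod_le_prod (fun _ _ => abs_nonneg _)
      fun l _ => abs_eigenvalue_le_norm hA (x l)).trans ?_
    simp)
  have hDt : ∀ f : Fin n → H, D (tprod f) = tprod (A ∘ f) := by
    intro f
    refine ext_inner_hilbertBasis (tensorBasis u n) fun x => ?_
    rw [hD, tensorBasis_apply, inner_tprod, inner_tprod]
    push_cast
    rw [← Finset.prod_mul_distrib]
    refine Finset.prod_congr rfl fun l _ => ?_
    rw [Function.comp_apply, Function.comp_apply, inner_of_apply_basis u hA]
  have hDs : ∀ f : Fin n → H,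
      (symProj H n ∘L D ∘L (SymPow H n).subtypeL) (symProd f) = symProd (A ∘ f) := by
    intro f
    have : D (symTensor f) = symTensor (A ∘ f) := by
      rw [symTensor_eq, symTensor_eq, map_smul, map_sum]
      simp only [hDt]
      rfl
    change symProj H n (D (symTensor f)) = _
    rw [this]
    exact symProj_coe (symProd (A ∘ f))
  refine ⟨D, apply_basis_of_inner _ hD, hDt, ?_⟩
  have hex : ∃ B : SymPow H n →L[ℂ] SymPow H n, ∀ f : Fin n → H,
      B (symProd f) = symProd (A ∘ f) := ⟨_, hDs⟩
  rw [opTensorPow, dif_pos hex]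
  refine ContinuousLinearMap.ext_on dense_span_symProd ?_
  rintro _ ⟨f, rfl⟩
  rw [hex.choose_spec f, hDs]

theorem opTensorPow_symProd (hA : ∀ j, A (u j) = (c j : ℂ) • u j) (f : Fin n → H) :
    opTensorPow A n (symProd f) = symProd (A ∘ f) := by
  obtain ⟨D, -, h2, h3⟩ := exists_diagonal_opTensorPow hA n
  have : D (symTensor f) = symTensor (A ∘ f) := by
    rw [symTensor_eq, symTensor_eq, map_smul, map_sum]
    simp only [h2]
    rfl
  rw [h3]
  change symProj H n (D (symTensor f)) = _
  rw [this]
  exact symProj_coe (symProd (A ∘ f))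

theorem opTensorPow_symProj_tprod (hA : ∀ j, A (u j) = (c j : ℂ) • u j) (f : Fin n → H) :
    opTensorPow A n (symProj H n (tprod f)) = symProj H n (tprod (A ∘ f)) := by
  rw [symProj_tprod, symProj_tprod, map_smul, opTensorPow_symProd hA]

theorem opTensorPow_symProj_tprod_basis (hA : ∀ j, A (u j) = (c j : ℂ) • u j) (x : Fin n → J) :
    opTensorPow A n (symProj H n (tprod (u ∘ x))) =
      ((∏ l, c (x l) : ℝ) : ℂ) • symProj H n (tprod (u ∘ x)) := by
  obtain ⟨D, h1, h2, h3⟩ := exists_diagonal_opTensorPow hA n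
  rw [opTensorPow_symProj_tprod hA, ← h2, ← tensorBasis_apply, h1, map_smul]

theorem inner_opTensorPow (hA : ∀ j, A (u j) = (c j : ℂ) • u j) (f g : Fin n → H) :
    ⟪symProj H n (tprod f), opTensorPow A n (symProj H n (tprod g))⟫_ℂ =
      (n.factorial : ℂ)⁻¹ * ∑ σ : Equiv.Perm (Fin n), ∏ i, ⟪f i, A (g (σ i))⟫_ℂ := by
  rw [opTensorPow_symProj_tprod hA, inner_symProj_tprod]
  rfl

theorem isSelfAdjoint_opTensorPow (hA : ∀ j, A (u j) = (c j : ℂ) • u j) :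
    IsSelfAdjoint (opTensorPow A n) := by
  obtain ⟨D, h1, h2, h3⟩ := exists_diagonal_opTensorPow hA n
  rw [ContinuousLinearMap.isSelfAdjoint_iff_isSymmetric]
  intro x y
  rw [h3]
  change ⟪symProj H n (D (x : TensorPow H n)), y⟫_ℂ = ⟪x, symProj H n (D (y : TensorPow H n))⟫_ℂ
  rw [inner_symProj, inner_symProj_left, diagonal_inner_left _ h1]

theorem opTensorPow_nonneg (hA : ∀ j, A (u j) = (c j : ℂ) • u j) (hc : ∀ j, 0 ≤ c j) :
    0 ≤ opTensorPow A n := by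
  obtain ⟨D, h1, h2, h3⟩ := exists_diagonal_opTensorPow hA n
  have hD := diagonal_nonneg _ (fun x => Finset.prod_nonneg fun l _ => hc (x l)) h1
  rw [ContinuousLinearMap.nonneg_iff_isPositive, ContinuousLinearMap.isPositive_def] at hD ⊢
  refine ⟨ContinuousLinearMap.isSelfAdjoint_iff_isSymmetric.1 (isSelfAdjoint_opTensorPow hA),
    fun x => ?_⟩
  have := hD.2 x
  rw [ContinuousLinearMap.reApplyInnerSelf_apply] at this ⊢
  rw [h3]
  change 0 ≤ RCLike.re ⟪symProj H n (D (x : TensorPow H n)), x⟫_ℂ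
  rwa [inner_symProj_left]

theorem norm_opTensorPow_le_one (hA : ∀ j, A (u j) = (c j : ℂ) • u j) (hc : ∀ j, |c j| ≤ 1) :
    ‖opTensorPow A n‖ ≤ 1 := by
  obtain ⟨D, h1, h2, h3⟩ := exists_diagonal_opTensorPow hA n
  have hD : ‖D‖ ≤ 1 := norm_diagonal_le _ h1 zero_le_one fun x => by
    rw [Finset.abs_prod]
    exact Finset.prod_le_one (fun _ _ => abs_nonneg _) fun l _ => hc _
  refine ContinuousLinearMap.opNorm_le_bound _ zero_le_one fun x => ?_
  rw [h3, one_mul]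
  change ‖symProj H n (D (x : TensorPow H n))‖ ≤ _
  refine (Submodule.norm_orthogonalProjectionOnto_apply_le _ _).trans ?_
  exact (D.le_of_opNorm_le hD _).trans (by simp)

end OpTensorPow

/-! ### Second quantization -/

variable {H : Type v} [NormedAddCommGroup H] [InnerProductSpace ℂ H]

section Sector

theorem inner_sector_left (n : ℕ) (a : SymPow H n) (y : Fock H) :
    ⟪sector H n a, y⟫_ℂ = ⟪a, y n⟫_ℂ :=
  lp.inner_single_left (𝕜 := ℂ) (G := fun n : ℕ => SymPow H n) n a y

theorem sector_apply_self (n : ℕ) (a : SymPow H n) : (sector H n a : Fock H) n = a :=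
  lp.single_apply_self (E := fun n : ℕ => SymPow H n) 2 n a

theorem sector_apply_ne {n m : ℕ} (h : m ≠ n) (a : SymPow H n) : (sector H n a : Fock H) m = 0 :=
  lp.single_apply_ne (E := fun n : ℕ => SymPow H n) 2 n a h

variable {J : Type*} (u : HilbertBasis J ℂ H)

theorem isParseval_sector :
    IsParseval fun a : Σ n : ℕ, (Fin n → J) => sector H a.1 (symProj H a.1 (tprod (u ∘ a.2))) := by
  intro y
  rw [ENNReal.tsum_sigma']
  simp_rw [inner_sector_left]
  have h1 : ∀ n : ℕ, ∑' x : Fin n → J, ‖⟪symProj H n (tprod (u ∘ x)), y n⟫_ℂ‖ₑ ^ 2 = ‖y n‖ₑ ^ 2 :=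
    fun n => isParseval_symProj_tprod u n (y n)
  simp_rw [h1, enorm_sq_eq_ofReal]
  have h2 := lp.norm_rpow_eq_tsum (p := 2) (by norm_num) y
  have h3 := (lp.memℓp y).summable (by norm_num)
  simp only [ENNReal.toReal_ofNat, Real.rpow_ofNat] at h2 h3
  rw [h2, ENNReal.ofReal_tsum_of_nonneg (fun _ => by positivity) h3]

theorem ext_inner_sector {y z : Fock H}
    (h : ∀ (n : ℕ) (x : Fin n → J), ⟪sector H n (symProd (u ∘ x)), y⟫_ℂ =
      ⟪sector H n (symProd (u ∘ x)), z⟫_ℂ) : y = z := by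
  refine ext_inner_of_dense (isParseval_sector u).dense_span ?_
  rintro _ ⟨⟨n, x⟩, rfl⟩
  simp only [symProj_tprod, map_smul, inner_smul_left, h]

theorem symProd_update_smul {n : ℕ} (f : Fin n → H) (j : Fin n) (c : ℂ) :
    symProd (Function.update f j (c • f j)) = c • symProd f := by
  rw [symProd_eq, symProd_eq, ← tprodUpdate_apply, map_smul, tprodUpdate_apply,
    Function.update_eq_self, map_smul, smul_comm]

end Sector

section SecondQuant

variable {h : H →ₗ.[ℂ] H} {J : Type*} {u : HilbertBasis J ℂ H} {lam : J → ℝ}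

/-- The graph of `ℍ₀`. -/
def secondQuantGraph (h : H →ₗ.[ℂ] H) : Submodule ℂ (Fock H × Fock H) :=
  (Submodule.span ℂ {x : Fock H × Fock H | ∃ (n : ℕ) (f : Fin n → h.domain),
    x = (sector H n (symProd fun i => (f i : H)),
      ∑ j, sector H n (symProd (Function.update (fun i => (f i : H)) j (h (f j)))))}
    ).topologicalClosure

/-- Symmetry moves `h` from the slot `j = σ i` onto the eigenvector `u (x i)`, which yields the
factor `lam (x i)`; the sum over `j` is reindexed by `σ`. -/
theorem sum_prod_inner_update {n : ℕ}
    (hsymm : ∀ x y : h.domain, ⟪h x, (y : H)⟫_ℂ = ⟪(x : H), h y⟫_ℂ)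
    (hu : ∀ j, IsEigen h (lam j) (u j)) (x : Fin n → J) (f : Fin n → h.domain)
    (σ : Equiv.Perm (Fin n)) :
    ∑ j, ∏ i, ⟪u (x i), Function.update (fun i => (f i : H)) j (h (f j)) (σ i)⟫_ℂ =
      (∑ l, (lam (x l) : ℂ)) * ∏ i, ⟪u (x i), (f (σ i) : H)⟫_ℂ := by
  rw [Finset.sum_mul]
  refine (Fintype.sum_equiv σ _ _ fun i0 => ?_).symm
  rw [← Finset.mul_prod_erase _ _ (Finset.mem_univ i0), ← mul_assoc,
    ← Finset.mul_prod_erase _ (fun i => ⟪u (x i), _⟫_ℂ) (Finset.mem_univ i0), Function.update_self]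
  congr 1
  · obtain ⟨hm, he⟩ := hu (x i0)
    have h1 := hsymm ⟨u (x i0), hm⟩ (f (σ i0))
    rw [he, inner_smul_left, Complex.conj_ofReal] at h1
    exact h1
  · refine Finset.prod_congr rfl fun i hi => ?_
    rw [Function.update_of_ne]
    exact fun hi' => Finset.ne_of_mem_erase hi (σ.injective hi')

/-- The relation is linear and closed, so it passes from the generators to the whole graph. It
serves both to show closability and to locate all eigenvectors of `ℍ₀`. -/
theorem inner_secondQuantGraph
    (hsymm : ∀ x y : h.domain, ⟪h x, (y : H)⟫_ℂ = ⟪(x : H), h y⟫_ℂ)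
    (hu : ∀ j, IsEigen h (lam j) (u j)) {n : ℕ} (x : Fin n → J) {z : Fock H × Fock H}
    (hz : z ∈ secondQuantGraph h) :
    ⟪sector H n (symProd (u ∘ x)), z.2⟫_ℂ =
      ((∑ l, lam (x l) : ℝ) : ℂ) * ⟪sector H n (symProd (u ∘ x)), z.1⟫_ℂ := by
  have hcl : IsClosed {z : Fock H × Fock H | ⟪sector H n (symProd (u ∘ x)), z.2⟫_ℂ =
      ((∑ l, lam (x l) : ℝ) : ℂ) * ⟪sector H n (symProd (u ∘ x)), z.1⟫_ℂ} :=
    isClosed_eq (by fun_prop) (by fun_prop)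
  refine closure_minimal ?_ hcl hz
  intro z hz
  rw [SetLike.mem_coe] at hz
  rw [Set.mem_ofPred_eq]
  induction hz using Submodule.span_induction with
  | zero => simp
  | add v w _ _ h1 h2 => simp only [Prod.fst_add, Prod.snd_add, inner_add_right, h1, h2, mul_add]
  | smul c v _ h1 =>
    simp only [Prod.smul_fst, Prod.smul_snd, inner_smul_right, h1]
    ring
  | mem z hz =>
    obtain ⟨m, f, rfl⟩ := hz
    simp only [inner_sum, inner_sector_left]
    by_cases hmn : n = m
    · subst hmn
      simp only [sector_apply_self]
      have key : ∀ g : Fin n → H, ⟪symProd (u ∘ x), symProd g⟫_ℂ =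
          symCoef n * n.factorial * (symCoef n *
            ∑ σ : Equiv.Perm (Fin n), ∏ i, ⟪u (x i), g (σ i)⟫_ℂ) := by
        intro g
        change ⟪symTensor (u ∘ x), symTensor g⟫_ℂ = _
        rw [inner_symTensor_symTensor, inner_tprod_symTensor]
        rfl
      simp only [key]
      rw [← Finset.mul_sum, ← Finset.mul_sum, Finset.sum_comm]
      simp only [sum_prod_inner_update hsymm hu]
      rw [← Finset.mul_sum]
      push_cast
      ring
    · simp only [sector_apply_ne hmn, inner_zero_right, Finset.sum_const_zero, mul_zero]

/-- The closed subspace must be single valued for `toLinearPMap` to have it as graph. A pair with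
zero first component has a second component orthogonal to a family with dense span. -/
theorem graph_secondQuant
    (hsymm : ∀ x y : h.domain, ⟪h x, (y : H)⟫_ℂ = ⟪(x : H), h y⟫_ℂ)
    (hu : ∀ j, IsEigen h (lam j) (u j)) : (secondQuant h).graph = secondQuantGraph h := by
  refine Submodule.toLinearPMap_graph_eq _ fun z hz h0 => ?_
  refine ext_inner_sector u fun n x => ?_
  rw [inner_secondQuantGraph hsymm hu x hz, h0, inner_zero_right, mul_zero]

theorem isEigen_iff_mem_graph {K : Type*} [NormedAddCommGroup K] [InnerProductSpace ℂ K]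
    {A : K →ₗ.[ℂ] K} {a : ℝ} {x : K} : IsEigen A a x ↔ (x, (a : ℂ) • x) ∈ A.graph := by
  rw [LinearPMap.mem_graph_iff]
  constructor
  · rintro ⟨hx, h⟩
    exact ⟨⟨x, hx⟩, rfl, h⟩
  · rintro ⟨y, rfl, h⟩
    exact ⟨y.2, h⟩

theorem isEigen_secondQuant
    (hsymm : ∀ x y : h.domain, ⟪h x, (y : H)⟫_ℂ = ⟪(x : H), h y⟫_ℂ)
    (hu : ∀ j, IsEigen h (lam j) (u j)) {n : ℕ} (x : Fin n → J) :
    IsEigen (secondQuant h) (∑ l, lam (x l)) (sector H n (symProd (u ∘ x))) := by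
  rw [isEigen_iff_mem_graph, graph_secondQuant hsymm hu]
  refine Submodule.le_topologicalClosure _ (Submodule.subset_span ?_)
  choose hm he using hu
  refine ⟨n, fun l => ⟨u (x l), hm (x l)⟩, ?_⟩
  refine Prod.ext rfl ?_
  simp only [he]
  rw [Complex.ofReal_sum, Finset.sum_smul]
  refine Finset.sum_congr rfl fun l _ => ?_
  rw [← map_smul, ← symProd_update_smul]
  rfl

theorem isFunctionOf_secondQuant
    (hsymm : ∀ x y : h.domain, ⟪h x, (y : H)⟫_ℂ = ⟪(x : H), h y⟫_ℂ)
    (hu : ∀ j, IsEigen h (lam j) (u j)) {f : ℝ → ℝ} {E : Fock H →L[ℂ] Fock H}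
    (hE : ∀ (n : ℕ) (x : Fin n → J) (y : Fock H), ⟪sector H n (symProd (u ∘ x)), E y⟫_ℂ =
      f (∑ l, lam (x l)) * ⟪sector H n (symProd (u ∘ x)), y⟫_ℂ) :
    IsFunctionOf (secondQuant h) f E := by
  constructor
  · refine (isParseval_sector u).dense_span.mono ?_
    refine Submodule.span_le.2 ?_
    rintro _ ⟨⟨n, x⟩, rfl⟩
    simp only [symProj_tprod, map_smul]
    exact Submodule.smul_mem _ _ (Submodule.subset_span ⟨_, isEigen_secondQuant hsymm hu x⟩)
  · intro a y hy
    rw [isEigen_iff_mem_graph, graph_secondQuant hsymm hu] at hy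
    refine ext_inner_sector u fun n x => ?_
    have h1 := inner_secondQuantGraph hsymm hu x hy
    rw [inner_smul_right] at h1
    rw [hE, inner_smul_right]
    by_cases h0 : ⟪sector H n (symProd (u ∘ x)), y⟫_ℂ = 0
    · rw [h0, mul_zero, mul_zero]
    · rw [Complex.ofReal_inj.1 (mul_right_cancel₀ h0 h1)]

end SecondQuant

/-! ### The Gibbs operator as a direct sum of tensor powers -/

section Gibbs

theorem inner_symProd_opTensorPow [CompleteSpace H] {n : ℕ} {J : Type*} {u : HilbertBasis J ℂ H}
    {A : H →L[ℂ] H} {c : J → ℝ} (hA : ∀ j, A (u j) = (c j : ℂ) • u j) (x : Fin n → J)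
    (w : SymPow H n) : ⟪symProd (u ∘ x), opTensorPow A n w⟫_ℂ =
      ((∏ l, c (x l) : ℝ) : ℂ) * ⟪symProd (u ∘ x), w⟫_ℂ := by
  have h1 := ContinuousLinearMap.isSelfAdjoint_iff_isSymmetric.1 (isSelfAdjoint_opTensorPow hA)
    (symProd (u ∘ x)) w
  refine h1.symm.trans ?_
  rw [ContinuousLinearMap.coe_coe, symProd_eq, map_smul, opTensorPow_symProj_tprod_basis hA,
    smul_comm]
  refine (inner_smul_left (𝕜 := ℂ) _ w ((∏ l, c (x l) : ℝ) : ℂ)).trans ?_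
  rw [Complex.conj_ofReal]

variable [CompleteSpace H] {h : H →ₗ.[ℂ] H} {J : Type*} {u : HilbertBasis J ℂ H} {lam : J → ℝ}
  {T : ℝ} {q : H →L[ℂ] H}

/-- The operator `⨁ₙ q^{⊗n}` on Fock space. -/
def fockPow (q : H →L[ℂ] H) (hq : ∀ n, ‖opTensorPow q n‖ ≤ 1) : Fock H →L[ℂ] Fock H :=
  lp.mapCLM 2 (fun n => opTensorPow q n) zero_le_one hq

theorem fockPow_apply (hq : ∀ n, ‖opTensorPow q n‖ ≤ 1) (y : Fock H) (n : ℕ) :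
    fockPow q hq y n = opTensorPow q n (y n) := by
  rfl

theorem inner_fockPow_symm (hq : ∀ n, ‖opTensorPow q n‖ ≤ 1)
    (hsa : ∀ n, IsSelfAdjoint (opTensorPow q n)) (y z : Fock H) :
    ⟪fockPow q hq y, z⟫_ℂ = ⟪y, fockPow q hq z⟫_ℂ := by
  rw [lp.inner_eq_tsum, lp.inner_eq_tsum]
  refine tsum_congr fun n => ?_
  rw [fockPow_apply, fockPow_apply]
  exact ContinuousLinearMap.isSelfAdjoint_iff_isSymmetric.1 (hsa n) (y n) (z n)

theorem fockPow_nonneg (hq : ∀ n, ‖opTensorPow q n‖ ≤ 1) (h0 : ∀ n, 0 ≤ opTensorPow q n) :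
    0 ≤ fockPow q hq := by
  rw [ContinuousLinearMap.nonneg_iff_isPositive, ContinuousLinearMap.isPositive_def]
  refine ⟨inner_fockPow_symm hq fun n => IsSelfAdjoint.of_nonneg (h0 n), fun y => ?_⟩
  rw [ContinuousLinearMap.reApplyInnerSelf_apply]
  refine (Complex.hasSum_re (lp.hasSum_inner (fockPow q hq y) y)).nonneg fun n => ?_
  have h1 := h0 n
  rw [ContinuousLinearMap.nonneg_iff_isPositive, ContinuousLinearMap.isPositive_def] at h1
  rw [fockPow_apply]
  exact h1.2 (y n)

variable (hsymm : ∀ x y : h.domain, ⟪h x, (y : H)⟫_ℂ = ⟪(x : H), h y⟫_ℂ)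
  (hu : ∀ j, IsEigen h (lam j) (u j)) (hpos : ∀ j, 0 < lam j) (hT : 0 < T)
  (hq : ∀ j, q (u j) = ((Real.exp (-lam j / T) : ℝ) : ℂ) • u j)

include hpos hT hq in
theorem norm_opTensorPow_exp_le (n : ℕ) : ‖opTensorPow q n‖ ≤ 1 := by
  refine norm_opTensorPow_le_one hq fun j => ?_
  rw [abs_of_pos (Real.exp_pos _), Real.exp_le_one_iff]
  exact div_nonpos_of_nonpos_of_nonneg (neg_nonpos.2 (hpos j).le) hT.le

include hsymm hu hpos hT hq in
theorem opFun_secondQuant_exp :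
    opFun (secondQuant h) (fun a => Real.exp (-a / T)) =
      fockPow q (norm_opTensorPow_exp_le hpos hT hq) := by
  refine opFun_eq (isFunctionOf_secondQuant hsymm hu fun n x y => ?_)
  rw [inner_sector_left, inner_sector_left, fockPow_apply]
  refine (inner_symProd_opTensorPow hq x (y n)).trans ?_
  rw [← Real.exp_sum, ← Finset.sum_div, Finset.sum_neg_distrib]

include hsymm hu hpos hT hq in
theorem partitionFunction_eq :
    partitionFunction h T = ∑' n, opTrace (opTensorPow q n) := by
  have h0 : ∀ n, 0 ≤ opTensorPow q n := fun n => opTensorPow_nonneg hq fun j => (Real.exp_pos _).le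
  rw [partitionFunction, opFun_secondQuant_exp hsymm hu hpos hT hq,
    opTrace_eq_of_isParseval (isParseval_sector u) (fockPow_nonneg _ h0), ENNReal.tsum_sigma']
  refine tsum_congr fun n => ?_
  rw [opTrace_eq_of_isParseval (isParseval_symProj_tprod u n) (h0 n)]
  refine tsum_congr fun x => ?_
  rw [inner_sector_left, fockPow_apply, sector_apply_self]

include hsymm hu hpos hT hq in
theorem block_gibbs (n : ℕ) :
    block (gibbs h T) n =
      (((partitionFunction h T).toReal⁻¹ : ℝ) : ℂ) • opTensorPow q n := by
  ext1 y
  refine ext_inner_left ℂ fun z => ?_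
  rw [block, ContinuousLinearMap.comp_apply, ContinuousLinearMap.comp_apply,
    ContinuousLinearMap.adjoint_inner_right, gibbs, opFun_secondQuant_exp hsymm hu hpos hT hq,
    smul_apply, smul_apply, inner_smul_right, inner_smul_right,
    inner_sector_left, fockPow_apply, sector_apply_self]

end Gibbs

/-! ### Permanents of Gram matrices -/

section Per

variable {H : Type*} [NormedAddCommGroup H] [InnerProductSpace ℂ H]

/-- The permanent of the matrix `⟨Fᵢ, q Gⱼ⟩`. -/
def per {α : Type*} [Fintype α] [DecidableEq α] (q : H →L[ℂ] H) (F G : α → H) : ℂ :=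
  ∑ σ : Equiv.Perm α, ∏ i, ⟪F i, q (G (σ i))⟫_ℂ

/-- The family `F` with one more member `a`. -/
def optCons {α β : Type*} (a : β) (F : α → β) : Option α → β := fun o => o.elim a F

/-- The family `G` with one member replaced by `γ`, or `G` itself. -/
def optUpdate {α β : Type*} [DecidableEq α] (γ : β) (G : α → β) (o : Option α) : α → β :=
  o.elim G fun a => Function.update G a γ

variable {α β : Type*} [Fintype α] [DecidableEq α] [Fintype β] [DecidableEq β] {q s : H →L[ℂ] H}

theorem per_comp_equiv (ε : α ≃ β) (F G : β → H) : per q (F ∘ ε) (G ∘ ε) = per q F G := by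
  rw [per, per]
  refine Fintype.sum_equiv (Equiv.permCongr ε) _ _ fun σ => ?_
  refine Fintype.prod_equiv ε _ _ fun i => ?_
  simp [Equiv.permCongr_apply]

theorem optUpdate_eq (γ : H) (G : α → H) (o : Option α) (a : α) :
    optUpdate γ G o a = optCons γ G (Equiv.swap none o (some a)) := by
  cases o with
  | none => simp [optUpdate, optCons]
  | some b =>
    by_cases h : a = b
    · subst h; simp [optUpdate, optCons]
    · rw [Equiv.swap_apply_of_ne_of_ne (by simp) (by simpa using h)]
      simp [optUpdate, optCons, h]

/-- Laplace expansion along the row of `φ`. A permutation of `Option α` amounts to the image `o` of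
`none` and a permutation of `α`; the column used up by `φ` is replaced by that of `γ` in the
remaining permanent. -/
theorem per_optCons (φ γ : H) (F G : α → H) :
    per q (optCons φ F) (optCons γ G) =
      ∑ o : Option α, ⟪φ, q (optCons γ G o)⟫_ℂ * per q F (optUpdate γ G o) := by
  rw [per, ← Equiv.sum_comp Equiv.Perm.decomposeOption.symm, Fintype.sum_prod_type]
  refine Finset.sum_congr rfl fun o _ => ?_
  rw [per, Finset.mul_sum]
  refine Finset.sum_congr rfl fun σ _ => ?_
  rw [Fintype.prod_option]
  have h0 : Equiv.Perm.decomposeOption.symm (o, σ) none = o := by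
    simp [Equiv.Perm.decomposeOption]
  have h1 : ∀ i, optCons γ G (Equiv.Perm.decomposeOption.symm (o, σ) (some i)) =
      optUpdate γ G o (σ i) := fun i => by
    rw [optUpdate_eq]
    simp [Equiv.Perm.decomposeOption]
  rw [h0]
  simp only [h1]
  rfl

theorem norm_inner_le_of_eq_mul_self [CompleteSpace H] (hs : IsSelfAdjoint s) (hq : q = s * s)
    (x y : H) :
    ‖⟪x, q y⟫_ℂ‖ ≤ ‖s x‖ * ‖s y‖ := by
  rw [hq, mul_apply_eq_comp]
  have := ContinuousLinearMap.isSelfAdjoint_iff_isSymmetric.1 hs x (s y)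
  rw [ContinuousLinearMap.coe_coe] at this
  rw [← this]
  exact norm_inner_le_norm _ _

/-- Splitting `q = s * s` makes a basis vector `e j` present on both sides contribute `‖s (e j)‖ ^
2`, which is summable when `s` is Hilbert-Schmidt. All exchanges of sums below rest on this. -/
theorem norm_per_le [CompleteSpace H] (hs : IsSelfAdjoint s) (hq : q = s * s) (F G : α → H) :
    ‖per q F G‖ ≤ (Fintype.card α).factorial * ((∏ i, ‖s (F i)‖) * ∏ i, ‖s (G i)‖) := by
  rw [per]
  refine (norm_sum_le _ _).trans ?_
  rw [← Fintype.card_perm, ← nsmul_eq_mul, ← Finset.card_univ]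
  refine Finset.sum_le_card_nsmul _ _ _ fun σ _ => ?_
  rw [norm_prod, ← Equiv.prod_comp σ (fun i => ‖s (G i)‖), ← Finset.prod_mul_distrib]
  exact Finset.prod_le_prod (fun _ _ => norm_nonneg _)
    fun i _ => norm_inner_le_of_eq_mul_self hs hq _ _

/-- A permanent depends on each row through an inner product, so expanding the row vector in a basis
is Parseval's identity in each term of the row expansion. -/
theorem hasSum_per_optCons {J : Type*} (e : HilbertBasis J ℂ H) (v γ : H) (F G : α → H) :
    HasSum (fun c => ⟪v, e c⟫_ℂ * per q (optCons (e c) F) (optCons γ G))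
      (per q (optCons v F) (optCons γ G)) := by
  simp only [per_optCons, Finset.mul_sum, ← mul_assoc]
  refine hasSum_sum fun o _ => ?_
  exact (e.hasSum_inner_mul_inner v (q (optCons γ G o))).mul_right _

end Per

section ProductSums

theorem tsum_prod_pow {J : Type*} (a : J → ℝ≥0∞) (n : ℕ) :
    ∑' x : Fin n → J, ∏ l, a (x l) = (∑' j, a j) ^ n := by
  induction n with
  | zero => simp
  | succ n ih =>
    rw [← (Fin.consEquiv fun _ : Fin (n + 1) => J).tsum_eq, ENNReal.tsum_prod']
    simp only [Fin.prod_univ_succ, Fin.consEquiv_apply, Fin.cons_zero, Fin.cons_succ,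
      ENNReal.tsum_mul_left, ih, ENNReal.tsum_mul_right]
    rw [pow_succ']

theorem tsum_ofReal_ne_top_iff {J : Type*} {a : J → ℝ} (ha : ∀ j, 0 ≤ a j) :
    ∑' j, ENNReal.ofReal (a j) ≠ ∞ ↔ Summable a := by
  constructor
  · intro h
    simpa only [ENNReal.toReal_ofReal (ha _)] using ENNReal.summable_toReal h
  · intro h
    rw [← ENNReal.ofReal_tsum_of_nonneg ha h]
    exact ENNReal.ofReal_ne_top

theorem summable_prod_pow {J : Type*} {a : J → ℝ} (ha : ∀ j, 0 ≤ a j) (h : Summable a) (n : ℕ) :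
    Summable fun x : Fin n → J => ∏ l, a (x l) := by
  rw [← tsum_ofReal_ne_top_iff fun x => Finset.prod_nonneg fun l _ => ha _]
  simp_rw [ENNReal.ofReal_prod_of_nonneg fun l _ => ha _]
  rw [tsum_prod_pow fun j => ENNReal.ofReal (a j)]
  exact ENNReal.pow_ne_top ((tsum_ofReal_ne_top_iff ha).2 h)

end ProductSums

/-! ### The recursion for traced permanents and the quantum Wick theorem -/

section Recursion

variable {H : Type*} [NormedAddCommGroup H] [InnerProductSpace ℂ H] [CompleteSpace H]
  {α : Type*} [Fintype α] [DecidableEq α] {J : Type*} {e : HilbertBasis J ℂ H} {q s : H →L[ℂ] H}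

/-- The permanent for the families `f` and `g` completed by the same basis vectors. -/
def perBasis (q : H →L[ℂ] H) (e : HilbertBasis J ℂ H) {m : ℕ} (f g : α → H) (x : Fin m → J) : ℂ :=
  per q (Sum.elim f (e ∘ x)) (Sum.elim g (e ∘ x))

/-- The trace over `m` particles. -/
def wickTerm (q : H →L[ℂ] H) (e : HilbertBasis J ℂ H) (f g : α → H) (m : ℕ) : ℂ :=
  (m.factorial : ℂ)⁻¹ * ∑' x : Fin m → J, perBasis q e f g x

theorem norm_perBasis_le (hs : IsSelfAdjoint s) (hq : q = s * s) {m : ℕ} (f g : α → H)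
    (x : Fin m → J) : ‖perBasis q e f g x‖ ≤
      ((Fintype.card (α ⊕ Fin m)).factorial * ((∏ i, ‖s (f i)‖) * ∏ i, ‖s (g i)‖)) *
        ∏ l, ‖s (e (x l))‖ ^ 2 := by
  refine (norm_per_le hs hq _ _).trans (le_of_eq ?_)
  simp only [Fintype.prod_sum_type, Sum.elim_inl, Sum.elim_inr, Finset.prod_pow,
    Function.comp_apply]
  ring

variable (hs : IsSelfAdjoint s) (hq : q = s * s) (hsum : Summable fun j => ‖s (e j)‖ ^ 2)

include hs hq hsum in
theorem summable_perBasis (m : ℕ) (f g : α → H) :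
    Summable fun x : Fin m → J => perBasis q e f g x :=
  Summable.of_norm_bounded ((summable_prod_pow (fun _ => by positivity) hsum m).mul_left _)
    fun x => norm_perBasis_le hs hq f g x

/-- The equivalence that moves the new index to the left. -/
def optionSumEquiv (α β : Type*) : Option (α ⊕ β) ≃ Option α ⊕ β where
  toFun o := o.elim (Sum.inl none) (Sum.map some id)
  invFun a := a.elim (fun o => o.map Sum.inl) fun b => some (Sum.inr b)
  left_inv o := by rcases o with _ | (a | b) <;> rfl
  right_inv a := by rcases a with (_ | a) | b <;> rfl

theorem optCons_sumElim {β M : Type*} (a : H) (f : β → H) (y : M → H) :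
    optCons a (Sum.elim f y) = Sum.elim (optCons a f) y ∘ optionSumEquiv β M := by
  ext o
  rcases o with _ | (a | b) <;> rfl

theorem per_sumElim_optCons {M : Type*} [Fintype M] [DecidableEq M] (φ γ : H) (f g : α → H)
    (y z : M → H) :
    per q (Sum.elim (optCons φ f) y) (Sum.elim (optCons γ g) z) =
      per q (optCons φ (Sum.elim f y)) (optCons γ (Sum.elim g z)) := by
  rw [optCons_sumElim, optCons_sumElim, per_comp_equiv]

/-- Relabelling rows and columns by the same bijection preserves a permanent, so the slot `l` can be
moved to the front. -/
theorem per_sumElim_insertNth {m : ℕ} (l : Fin (m + 1)) (a c : H) (f g : α → H)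
    (y z : Fin m → H) :
    per q (Sum.elim f (l.insertNth a y)) (Sum.elim g (l.insertNth c z)) =
      per q (optCons a (Sum.elim f y)) (optCons c (Sum.elim g z)) := by
  let ε : α ⊕ Fin (m + 1) ≃ Option (α ⊕ Fin m) :=
    { toFun := Sum.elim (fun a => some (Sum.inl a)) fun i => (finSuccEquiv' l i).map Sum.inr
      invFun := fun o => o.elim (Sum.inr l) (Sum.map id l.succAbove)
      left_inv := by
        rintro (a | i)
        · rfl
        · rcases Fin.eq_self_or_eq_succAbove l i with rfl | ⟨j, rfl⟩ <;> simp
      right_inv := by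
        rintro (_ | (a | i)) <;> simp }
  have key : ∀ (a : H) (f : α → H) (y : Fin m → H),
      Sum.elim f (l.insertNth a y) = optCons a (Sum.elim f y) ∘ ε := by
    intro a f y
    ext o
    rcases o with b | i
    · rfl
    · rcases Fin.eq_self_or_eq_succAbove l i with rfl | ⟨j, rfl⟩ <;> simp [ε, optCons]
  rw [key, key, per_comp_equiv]

/-- In the row expansion, `φ` meets either `γ` or a member of `g`, or else a traced vector `e (x
l)`, whose column is then taken over by `γ`. -/
theorem perBasis_optCons {m : ℕ} (φ γ : H) (f g : α → H) (x : Fin m → J) :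
    perBasis q e (optCons φ f) (optCons γ g) x =
      (∑ o : Option α, ⟪φ, q (optCons γ g o)⟫_ℂ * perBasis q e f (optUpdate γ g o) x) +
        ∑ l, ⟪φ, q (e (x l))⟫_ℂ *
          per q (Sum.elim f (e ∘ x)) (Sum.elim g (Function.update (e ∘ x) l γ)) := by
  rw [perBasis, per_sumElim_optCons, per_optCons, Fintype.sum_option, Fintype.sum_sum_type,
    ← add_assoc, Fintype.sum_option]
  refine congrArg₂ (· + ·) (congrArg₂ (· + ·) rfl ?_) ?_
  · refine Finset.sum_congr rfl fun a _ => ?_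
    simp only [optUpdate, optCons, Option.elim_some, Sum.elim_inl, perBasis, Sum.update_elim_inl]
  · refine Finset.sum_congr rfl fun a _ => ?_
    simp only [optUpdate, optCons, Option.elim_some, Sum.elim_inr, Sum.update_elim_inr,
      Function.comp_apply]

/-- Insertion of a value at a given place of a tuple. -/
def insertNthPairEquiv (J : Type*) {m : ℕ} (l : Fin (m + 1)) :
    J × (Fin m → J) ≃ (Fin (m + 1) → J) := Fin.insertNthEquiv (fun _ => J) l

theorem insertNthPairEquiv_apply {J : Type*} {m : ℕ} (l : Fin (m + 1)) (z : J × (Fin m → J)) :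
    insertNthPairEquiv J l z = l.insertNth z.1 z.2 := rfl

include hs hq hsum in
-- The index `x l` now occurs only in the coefficient `⟨q φ, e (x l)⟩` and in one row. Summing over
-- it substitutes `q φ` for that row by `hasSum_per_optCons`, and absolute summability allows this
-- sum to be done first.
theorem hasSum_contraction {m : ℕ} (l : Fin (m + 1)) (φ γ : H) (f g : α → H) :
    HasSum (fun x : Fin (m + 1) → J => ⟪φ, q (e (x l))⟫_ℂ *
        per q (Sum.elim f (e ∘ x)) (Sum.elim g (Function.update (e ∘ x) l γ)))
      (∑' y : Fin m → J, perBasis q e (optCons (q φ) f) (optCons γ g) y) := by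
  have hqsymm : ∀ x y, ⟪q x, y⟫_ℂ = ⟪x, q y⟫_ℂ := by
    intro x y
    have h1 := ContinuousLinearMap.isSelfAdjoint_iff_isSymmetric.1 hs
    rw [hq, mul_apply_eq_comp, mul_apply_eq_comp]
    exact (h1 (s x) y).trans (h1 x (s y))
  let F : J × (Fin m → J) → ℂ := fun z => ⟪q φ, e z.1⟫_ℂ *
    per q (optCons (e z.1) (Sum.elim f (e ∘ z.2))) (optCons γ (Sum.elim g (e ∘ z.2)))
  rw [← (insertNthPairEquiv J l).hasSum_iff]
  have hterm : ∀ z, ((fun x : Fin (m + 1) → J => ⟪φ, q (e (x l))⟫_ℂ *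
        per q (Sum.elim f (e ∘ x)) (Sum.elim g (Function.update (e ∘ x) l γ))) ∘
      (insertNthPairEquiv J l)) z = F z := by
    rintro ⟨c, y⟩
    have h1 : e ∘ insertNthPairEquiv J l (c, y) = l.insertNth (e c) (e ∘ y) := by
      ext i
      rcases Fin.eq_self_or_eq_succAbove l i with rfl | ⟨j, rfl⟩ <;>
        simp [insertNthPairEquiv_apply]
    have h2 : insertNthPairEquiv J l (c, y) l = c := by simp [insertNthPairEquiv_apply]
    simp only [Function.comp_apply, F]
    rw [h1, h2, Fin.update_insertNth, per_sumElim_insertNth, hqsymm]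
  refine HasSum.congr_fun ?_ hterm
  have hsm : Summable F := by
    have hp : Summable fun z : J × (Fin m → J) => ‖s (e z.1)‖ ^ 2 * ∏ l, ‖s (e (z.2 l))‖ ^ 2 := by
      have h1 := summable_prod_pow (a := fun j => ‖s (e j)‖ ^ 2) (fun _ => by positivity) hsum m
      exact Summable.mul_of_nonneg (f := fun j => ‖s (e j)‖ ^ 2)
        (g := fun y : Fin m → J => ∏ l, ‖s (e (y l))‖ ^ 2) hsum h1
        (fun _ => sq_nonneg _) fun _ => Finset.prod_nonneg fun _ _ => sq_nonneg _
    refine Summable.of_norm_bounded (hp.mul_left (‖s φ‖ *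
      ((Fintype.card (Option (α ⊕ Fin m))).factorial *
        ((∏ i, ‖s (f i)‖) * (‖s γ‖ * ∏ i, ‖s (g i)‖))))) fun z => ?_
    rw [norm_mul, hqsymm]
    refine (mul_le_mul (norm_inner_le_of_eq_mul_self hs hq _ _) (norm_per_le hs hq _ _)
      (norm_nonneg _) (by positivity)).trans (le_of_eq ?_)
    simp only [Fintype.prod_option, Fintype.prod_sum_type, optCons, Option.elim_none,
      Option.elim_some, Sum.elim_inl, Sum.elim_inr, Function.comp_apply, Finset.prod_pow]
    ring
  have h2 : ∀ y : Fin m → J, HasSum (fun c => ⟪q φ, e c⟫_ℂ *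
      per q (optCons (e c) (Sum.elim f (e ∘ y))) (optCons γ (Sum.elim g (e ∘ y))))
      (perBasis q e (optCons (q φ) f) (optCons γ g) y) := by
    intro y
    rw [perBasis, per_sumElim_optCons]
    exact hasSum_per_optCons e (q φ) γ _ _
  have h3 : HasSum (F ∘ Equiv.prodComm (Fin m → J) J) (∑' z, F z) :=
    (Equiv.prodComm (Fin m → J) J).hasSum_iff.2 hsm.hasSum
  rw [(h3.prod_fiberwise h2).tsum_eq]
  exact hsm.hasSum

include hs hq hsum in
-- The `m + 1` traced slots contribute equally; the resulting factor is what `1 / (m + 1)!` absorbs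
-- in `wickTerm_optCons_succ`.
theorem tsum_perBasis_optCons (m : ℕ) (φ γ : H) (f g : α → H) :
    ∑' x : Fin (m + 1) → J, perBasis q e (optCons φ f) (optCons γ g) x =
      (∑ o : Option α, ⟪φ, q (optCons γ g o)⟫_ℂ *
        ∑' x : Fin (m + 1) → J, perBasis q e f (optUpdate γ g o) x) +
      (m + 1) * ∑' y : Fin m → J, perBasis q e (optCons (q φ) f) (optCons γ g) y := by
  have h1 : ∀ o : Option α, HasSum (fun x : Fin (m + 1) → J =>
      ⟪φ, q (optCons γ g o)⟫_ℂ * perBasis q e f (optUpdate γ g o) x)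
      (⟪φ, q (optCons γ g o)⟫_ℂ *
        ∑' x : Fin (m + 1) → J, perBasis q e f (optUpdate γ g o) x) := fun o =>
    (summable_perBasis hs hq hsum (m + 1) f (optUpdate γ g o)).hasSum.mul_left _
  have h2 := hasSum_sum (s := Finset.univ) fun (l : Fin (m + 1)) _ =>
    hasSum_contraction (e := e) hs hq hsum l φ γ f g
  have h3 := (hasSum_sum (s := Finset.univ) fun o _ => h1 o).add h2
  rw [Finset.sum_const, Finset.card_univ, Fintype.card_fin, nsmul_eq_mul, Nat.cast_succ] at h3
  exact (h3.congr_fun fun x => perBasis_optCons φ γ f g x).tsum_eq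

/-- The part of `wickTerm` where the first vector is paired with one of the given vectors. -/
def wickPairing (q : H →L[ℂ] H) (e : HilbertBasis J ℂ H) (φ γ : H) (f g : α → H) (m : ℕ) : ℂ :=
  ∑ o : Option α, ⟪φ, q (optCons γ g o)⟫_ℂ * wickTerm q e f (optUpdate γ g o) m

theorem wickTerm_optCons_zero (φ γ : H) (f g : α → H) :
    wickTerm q e (optCons φ f) (optCons γ g) 0 = wickPairing q e φ γ f g 0 := by
  have h0 : ∀ F : (Fin 0 → J) → ℂ, ∑' x, F x = F (fun i => i.elim0) := fun F => by
    rw [tsum_eq_single (fun i => i.elim0)]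
    exact fun x hx => absurd (Subsingleton.elim _ _) hx
  rw [wickTerm, h0, perBasis_optCons, wickPairing, Finset.univ_eq_empty (α := Fin 0),
    Finset.sum_empty, add_zero, Nat.factorial_zero, Nat.cast_one, inv_one, one_mul]
  refine Finset.sum_congr rfl fun o _ => ?_
  rw [wickTerm, h0, Nat.factorial_zero, Nat.cast_one, inv_one, one_mul]

include hs hq hsum in
theorem wickTerm_optCons_succ (φ γ : H) (f g : α → H) (m : ℕ) :
    wickTerm q e (optCons φ f) (optCons γ g) (m + 1) =
      wickPairing q e φ γ f g (m + 1) + wickTerm q e (optCons (q φ) f) (optCons γ g) m := by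
  rw [wickTerm, tsum_perBasis_optCons hs hq hsum, mul_add, wickPairing, Finset.mul_sum]
  congr 1
  · refine Finset.sum_congr rfl fun o _ => ?_
    rw [wickTerm]
    ring
  · rw [wickTerm, Nat.factorial_succ]
    have h1 : ((m : ℂ) + 1) ≠ 0 := by exact_mod_cast m.succ_ne_zero
    have h2 : (m.factorial : ℂ) ≠ 0 := by exact_mod_cast m.factorial_ne_zero
    push_cast
    field_simp

include hs hq hsum in
-- Each contraction trades one traced particle for one factor `q` on `φ`. Here `a.1` counts the
-- contractions made before `φ` meets a given vector, and `a.2` the traced particles that remain.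
theorem wickTerm_optCons (φ γ : H) (f g : α → H) (m : ℕ) :
    wickTerm q e (optCons φ f) (optCons γ g) m =
      ∑ a ∈ Finset.HasAntidiagonal.antidiagonal m, wickPairing q e ((q ^ a.1) φ) γ f g a.2 := by
  induction m generalizing φ with
  | zero => simp [wickTerm_optCons_zero]
  | succ m ih =>
    rw [wickTerm_optCons_succ hs hq hsum, ih, Finset.Nat.sum_antidiagonal_succ]
    simp only [pow_zero, one_apply_eq_self, pow_succ, mul_apply_eq_comp]

include hs hq in
theorem isSelfAdjoint_of_eq_mul_self : IsSelfAdjoint q := by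
  rw [hq]
  have := IsSelfAdjoint.star_mul_self s
  rwa [hs.star_eq] at this

/-- The equation for `r` makes the Neumann series telescope, with remainder `q ^ n (r g)`. -/
theorem hasSum_pow_apply {r : H →L[ℂ] H} (hlt : ‖q‖ < 1) (hr : r = q + q * r) (g : H) :
    HasSum (fun l : ℕ => (q ^ l) (q g)) (r g) := by
  have hn : ∀ (l : ℕ) (y : H), ‖(q ^ l) y‖ ≤ ‖q‖ ^ l * ‖y‖ := fun l y => by
    refine (ContinuousLinearMap.le_opNorm _ _).trans ?_
    gcongr
    rcases l with _ | l
    · rw [pow_zero, pow_zero]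
      exact ContinuousLinearMap.norm_id_le
    · exact norm_pow_le' q l.succ_pos
  have hsm : Summable fun l : ℕ => (q ^ l) (q g) :=
    Summable.of_norm_bounded ((summable_geometric_of_lt_one (norm_nonneg _) hlt).mul_right ‖q g‖)
      fun l => hn l _
  rw [hsm.hasSum_iff_tendsto_nat]
  have hpart : ∀ n : ℕ, ∑ l ∈ Finset.range n, (q ^ l) (q g) = r g - (q ^ n) (r g) := by
    intro n
    induction n with
    | zero => simp
    | succ n ih =>
      have h1 : (q ^ n) (r g) = (q ^ n) (q g) + (q ^ (n + 1)) (r g) := by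
        conv_lhs => rw [hr]
        rw [add_apply, map_add, mul_apply_eq_comp, pow_succ, mul_apply_eq_comp]
      rw [Finset.sum_range_succ, ih, h1]
      abel
  simp_rw [hpart]
  have h0 : Filter.Tendsto (fun n : ℕ => (q ^ n) (r g)) Filter.atTop (nhds 0) := by
    refine squeeze_zero_norm (fun n => hn n (r g)) ?_
    simpa using (tendsto_pow_atTop_nhds_zero_of_lt_one (norm_nonneg _) hlt).mul_const ‖r g‖
  simpa using tendsto_const_nhds.sub h0

theorem hasSum_antidiagonal_mul {a b : ℕ → ℂ} {A B : ℂ} (ha : HasSum a A) (hb : HasSum b B) :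
    HasSum (fun m => ∑ k ∈ Finset.HasAntidiagonal.antidiagonal m, a k.1 * b k.2) (A * B) := by
  have ha' := ha.summable.norm
  have hb' := hb.summable.norm
  rw [← ha.tsum_eq, ← hb.tsum_eq,
    tsum_mul_tsum_eq_tsum_sum_antidiagonal_of_summable_norm ha' hb']
  exact (summable_norm_sum_mul_antidiagonal_of_summable_norm ha' hb').of_norm.hasSum

include hs hq hsum in
-- Summing over the particle number turns each antidiagonal sum into a Cauchy product. One factor is
-- the Neumann series, which gives `⟨φ, r y⟩`; the other is the induction hypothesis. The outcome is
-- the row expansion of the permanent of `r`.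
theorem hasSum_wickTerm_optCons {r : H →L[ℂ] H} (hlt : ‖q‖ < 1) (hr : r = q + q * r) {Z : ℂ}
    (φ γ : H) (f g : α → H)
    (ih : ∀ g : α → H, HasSum (wickTerm q e f g) (Z * per r f g)) :
    HasSum (wickTerm q e (optCons φ f) (optCons γ g)) (Z * per r (optCons φ f) (optCons γ g)) := by
  have hsymm := ContinuousLinearMap.isSelfAdjoint_iff_isSymmetric.1
    ((isSelfAdjoint_of_eq_mul_self hs hq))
  have hpow : ∀ (l : ℕ) (x y : H), ⟪(q ^ l) x, y⟫_ℂ = ⟪x, (q ^ l) y⟫_ℂ := fun l => by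
    have h1 := (isSelfAdjoint_of_eq_mul_self hs hq).pow l
    exact ContinuousLinearMap.isSelfAdjoint_iff_isSymmetric.1 h1
  have hgeom : ∀ y : H, HasSum (fun l : ℕ => ⟪(q ^ l) φ, q y⟫_ℂ) ⟪φ, r y⟫_ℂ := fun y => by
    simp_rw [hpow]
    exact (hasSum_pow_apply hlt hr y).mapL (innerSL ℂ φ)
  rw [per_optCons, Finset.mul_sum]
  have h1 : ∀ m, wickTerm q e (optCons φ f) (optCons γ g) m = ∑ o : Option α,
      ∑ a ∈ Finset.HasAntidiagonal.antidiagonal m, ⟪(q ^ a.1) φ, q (optCons γ g o)⟫_ℂ *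
        wickTerm q e f (optUpdate γ g o) a.2 := fun m => by
    rw [wickTerm_optCons hs hq hsum, Finset.sum_comm]
    rfl
  have h2 : ∀ o : Option α, HasSum (fun m => ∑ a ∈ Finset.HasAntidiagonal.antidiagonal m,
      ⟪(q ^ a.1) φ, q (optCons γ g o)⟫_ℂ * wickTerm q e f (optUpdate γ g o) a.2)
      (Z * (⟪φ, r (optCons γ g o)⟫_ℂ * per r f (optUpdate γ g o))) := fun o => by
    rw [mul_left_comm]
    exact hasSum_antidiagonal_mul (a := fun l => ⟪(q ^ l) φ, q (optCons γ g o)⟫_ℂ)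
      (b := wickTerm q e f (optUpdate γ g o)) (hgeom _) (ih _)
  exact (hasSum_sum (s := Finset.univ) fun o _ => h2 o).congr_fun h1

theorem wickTerm_comp_equiv {β : Type*} [Fintype β] [DecidableEq β] (ε : β ≃ α) (f g : α → H)
    (m : ℕ) : wickTerm q e (f ∘ ε) (g ∘ ε) m = wickTerm q e f g m := by
  rw [wickTerm, wickTerm]
  congr 1
  refine tsum_congr fun x => ?_
  rw [perBasis, perBasis, ← per_comp_equiv (Equiv.sumCongr ε (Equiv.refl (Fin m)))]
  congr 1 <;> ext (a | b) <;> rfl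

include hs hq hsum in
/-- Wick's theorem for the Gibbs state. -/
theorem hasSum_wickTerm {r : H →L[ℂ] H} (hlt : ‖q‖ < 1) (hr : r = q + q * r) {Z : ℂ}
    (hZ : ∀ f g : Fin 0 → H, HasSum (wickTerm q e f g) Z) (k : ℕ) (f g : Fin k → H) :
    HasSum (wickTerm q e f g) (Z * per r f g) := by
  induction k with
  | zero => simpa [per] using hZ f g
  | succ k ih =>
    have key : ∀ f : Fin (k + 1) → H,
        f = optCons (f 0) (fun i => f i.succ) ∘ finSuccEquiv k := by
      intro f
      ext i
      refine Fin.cases ?_ (fun i => ?_) i <;> simp [optCons]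
    rw [key f, key g, per_comp_equiv]
    refine HasSum.congr_fun ?_ fun m => wickTerm_comp_equiv _ _ _ _
    exact hasSum_wickTerm_optCons hs hq hsum hlt hr _ _ _ _ (ih _)

end Recursion

/-! ### The partition function and the density matrices -/

section Nonneg

variable {K : Type*} [NormedAddCommGroup K] [InnerProductSpace ℂ K] [CompleteSpace K]
  {A : K →L[ℂ] K} (hA : 0 ≤ A)
include hA

theorem inner_eq_ofReal_re_of_nonneg (y : K) : ⟪y, A y⟫_ℂ = ((⟪y, A y⟫_ℂ).re : ℂ) := by
  have := ContinuousLinearMap.isSelfAdjoint_iff_isSymmetric.1 (IsSelfAdjoint.of_nonneg hA)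
  refine (Complex.conj_eq_iff_re.1 ?_).symm
  rw [inner_conj_symm]
  exact this y y

theorem inner_apply_eq_of_nonneg : ∃ S : K →L[ℂ] K, ∀ x y, ⟪x, A y⟫_ℂ = ⟪S x, S y⟫_ℂ := by
  obtain ⟨S, hS, h⟩ := exists_eq_star_mul_self hA
  refine ⟨S, fun x y => ?_⟩
  rw [h, ContinuousLinearMap.star_eq_adjoint, mul_apply_eq_comp,
    ContinuousLinearMap.adjoint_inner_right]

theorem re_inner_nonneg_of_nonneg (y : K) : 0 ≤ (⟪y, A y⟫_ℂ).re := by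
  obtain ⟨S, h⟩ := inner_apply_eq_of_nonneg hA
  rw [h]
  exact inner_self_nonneg (𝕜 := ℂ)

theorem norm_inner_le_add_of_nonneg (y z : K) :
    ‖⟪y, A z⟫_ℂ‖ ≤ (⟪y, A y⟫_ℂ).re + (⟪z, A z⟫_ℂ).re := by
  obtain ⟨S, h⟩ := inner_apply_eq_of_nonneg hA
  have h1 : ∀ a, (⟪S a, S a⟫_ℂ).re = ‖S a‖ ^ 2 := fun a => by
    rw [inner_self_eq_norm_sq_to_K]; norm_cast
  rw [h, h, h, h1, h1]
  have h2 : ‖⟪S y, S z⟫_ℂ‖ ≤ ‖S y‖ * ‖S z‖ := norm_inner_le_norm _ _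
  nlinarith [sq_nonneg (‖S y‖ - ‖S z‖), norm_nonneg (S y), norm_nonneg (S z)]

end Nonneg

theorem hasSum_of_insertNthPairEquiv {J : Type*} {m : ℕ} {F : (Fin (m + 1) → J) → ℂ}
    (hF : Summable F) {g : J → ℂ}
    (hg : ∀ j, HasSum (fun y => F (insertNthPairEquiv J (0 : Fin (m + 1)) (j, y))) (g j)) :
    HasSum g (∑' x, F x) :=
  ((insertNthPairEquiv J (0 : Fin (m + 1))).hasSum_iff.2 hF.hasSum).prod_fiberwise hg

/-! ### Thermal one-particle operators: finiteness of the partition function and density matrices -/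

section Thermal

variable {H : Type v} [NormedAddCommGroup H] [InnerProductSpace ℂ H] [CompleteSpace H]
  {J : Type*} {u : HilbertBasis J ℂ H} {c : J → ℝ} {q s r : H →L[ℂ] H}

/-- A trace class operator `q` with eigenvalues in `(0, 1)`, with `s = q^(1/2)` and
`r = q / (1 - q)`. -/
structure IsThermal (u : HilbertBasis J ℂ H) (c : J → ℝ) (q s r : H →L[ℂ] H) : Prop where
  pos : ∀ j, 0 < c j
  bound : ∃ a < 1, ∀ j, c j ≤ a
  summable : Summable c
  apply_q : ∀ j, q (u j) = (c j : ℂ) • u j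
  apply_s : ∀ j, s (u j) = (Real.sqrt (c j) : ℂ) • u j
  apply_r : ∀ j, r (u j) = ((c j / (1 - c j) : ℝ) : ℂ) • u j

theorem clm_ext_hilbertBasis (u : HilbertBasis J ℂ H) {A B : H →L[ℂ] H}
    (h : ∀ j, A (u j) = B (u j)) : A = B := by
  have hd : Dense (Submodule.span ℂ (Set.range u) : Set H) := by
    rw [Submodule.dense_iff_topologicalClosure_eq_top]; exact u.dense_span
  refine ContinuousLinearMap.ext_on hd ?_
  rintro _ ⟨j, rfl⟩
  exact h j

theorem exists_isThermal (hpos : ∀ j, 0 < c j) (hbound : ∃ a < 1, ∀ j, c j ≤ a)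
    (hsum : Summable c) : ∃ q s r, IsThermal u c q s r := by
  obtain ⟨a, ha, hca⟩ := hbound
  obtain ⟨q, hq⟩ := exists_diagonal u c 1 fun j => by
    rw [abs_of_pos (hpos j)]; exact (hca j).trans ha.le
  obtain ⟨s, hs⟩ := exists_diagonal u (fun j => Real.sqrt (c j)) 1 fun j => by
    rw [abs_of_nonneg (Real.sqrt_nonneg _), ← Real.sqrt_one]
    exact Real.sqrt_le_sqrt ((hca j).trans ha.le)
  obtain ⟨r, hr⟩ := exists_diagonal u (fun j => c j / (1 - c j)) (1 / (1 - a)) fun j => by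
    have h1 := hca j
    have h2 := hpos j
    rw [abs_of_nonneg (div_nonneg h2.le (by linarith))]
    exact div_le_div₀ zero_le_one (by linarith) (by linarith) (by linarith)
  exact ⟨q, s, r, hpos, ⟨a, ha, hca⟩, hsum, apply_basis_of_inner u hq, apply_basis_of_inner u hs,
    apply_basis_of_inner u hr⟩

namespace IsThermal

variable (h : IsThermal u c q s r)
include h

theorem isSelfAdjoint_s : IsSelfAdjoint s := diagonal_isSelfAdjoint u h.apply_s

theorem eq_mul_self : q = s * s := by
  refine clm_ext_hilbertBasis u fun j => ?_
  rw [mul_apply_eq_comp, h.apply_s, map_smul, h.apply_s, h.apply_q, smul_smul,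
    ← Complex.ofReal_mul, Real.mul_self_sqrt (h.pos j).le]

theorem lt_one (j : J) : c j < 1 := by
  obtain ⟨a, ha, hca⟩ := h.bound
  exact (hca j).trans_lt ha

theorem norm_lt_one : ‖q‖ < 1 := by
  obtain ⟨a, ha, hca⟩ := h.bound
  refine (norm_diagonal_le u h.apply_q (le_max_left 0 a) fun j => ?_).trans_lt
    (max_lt zero_lt_one ha)
  rw [abs_of_pos (h.pos j)]
  exact (hca j).trans (le_max_right _ _)

theorem resolvent_eq : r = q + q * r := by
  refine clm_ext_hilbertBasis u fun j => ?_
  have h1 : 1 - c j ≠ 0 := by linarith [h.lt_one j]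
  rw [add_apply, mul_apply_eq_comp, h.apply_r, map_smul, h.apply_q, smul_smul, ← add_smul,
    ← Complex.ofReal_mul, ← Complex.ofReal_add]
  congr 2
  field_simp
  ring

/-- The Hilbert-Schmidt norm of `s` does not depend on the basis. An arbitrary basis is needed
because partial traces are taken along `stdBasis`, not along the eigenbasis. -/
theorem summable_norm_sq {L : Type*} (e : HilbertBasis L ℂ H) :
    Summable fun j => ‖s (e j)‖ ^ 2 := by
  rw [← tsum_ofReal_ne_top_iff fun _ => sq_nonneg _]
  simp_rw [← enorm_sq_eq_ofReal]
  rw [tsum_enorm_sq_adjoint (HilbertBasis.isParseval e) (HilbertBasis.isParseval u) s,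
    ← ContinuousLinearMap.star_eq_adjoint, h.isSelfAdjoint_s.star_eq]
  simp_rw [enorm_sq_eq_ofReal]
  rw [tsum_ofReal_ne_top_iff fun _ => sq_nonneg _]
  refine h.summable.congr fun j => ?_
  rw [h.apply_s, norm_smul, u.orthonormal.1 j, mul_one, Complex.norm_real, Real.norm_eq_abs,
    sq_abs, Real.sq_sqrt (h.pos j).le]

theorem nonneg (n : ℕ) : 0 ≤ opTensorPow q n :=
  opTensorPow_nonneg h.apply_q fun j => (h.pos j).le

theorem summable_perBasis {L : Type*} (e : HilbertBasis L ℂ H) {α : Type*} [Fintype α]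
    [DecidableEq α] (m : ℕ) (f g : α → H) : Summable fun x : Fin m → L => perBasis q e f g x :=
  FreeGibbs.summable_perBasis h.isSelfAdjoint_s h.eq_mul_self (h.summable_norm_sq e) m f g

theorem perBasis_empty {L : Type*} (e : HilbertBasis L ℂ H) {m : ℕ} (f g : Fin 0 → H)
    (x : Fin m → L) : perBasis q e f g x =
      m.factorial * ⟪symProj H m (tprod (e ∘ x)),
        opTensorPow q m (symProj H m (tprod (e ∘ x)))⟫_ℂ := by
  have h1 : (m.factorial : ℂ) ≠ 0 := by exact_mod_cast m.factorial_ne_zero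
  rw [inner_opTensorPow h.apply_q, mul_inv_cancel_left₀ h1]
  have h2 : ∀ f : Fin 0 → H, e ∘ x = Sum.elim f (e ∘ x) ∘ (Equiv.emptySum (Fin 0) (Fin m)).symm :=
    fun f => by ext i; rfl
  change _ = per q (e ∘ x) (e ∘ x)
  conv_rhs => rw [h2 g]
  conv_rhs => enter [2]; rw [← h2 g, h2 f]
  rw [per_comp_equiv]
  rfl

theorem wickTerm_empty {L : Type*} (e : HilbertBasis L ℂ H) (f g : Fin 0 → H) (m : ℕ) :
    opTrace (opTensorPow q m) ≠ ∞ ∧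
      wickTerm q e f g m = ((opTrace (opTensorPow q m)).toReal : ℂ) := by
  have hne : (m.factorial : ℂ) ≠ 0 := by exact_mod_cast m.factorial_ne_zero
  let a : (Fin m → L) → ℝ := fun x => (⟪symProj H m (tprod (e ∘ x)),
        opTensorPow q m (symProj H m (tprod (e ∘ x)))⟫_ℂ).re
  have ha : ∀ x, 0 ≤ a x := fun x => re_inner_nonneg_of_nonneg (h.nonneg _) _
  have hper : ∀ x, (m.factorial : ℂ)⁻¹ * perBasis q e f g x = (a x : ℂ) := fun x => by
    rw [h.perBasis_empty, inv_mul_cancel_left₀ hne]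
    exact inner_eq_ofReal_re_of_nonneg (h.nonneg m) _
  have hsm : Summable a := by
    rw [← Complex.summable_ofReal]
    exact ((h.summable_perBasis e m f g).mul_left _).congr fun x => hper x
  have htr : opTrace (opTensorPow q m) = ENNReal.ofReal (∑' x, a x) := by
    rw [opTrace_eq_of_isParseval (isParseval_symProj_tprod e m) (h.nonneg m),
      ENNReal.ofReal_tsum_of_nonneg ha hsm]
  refine ⟨by rw [htr]; exact ENNReal.ofReal_ne_top, ?_⟩
  rw [htr, ENNReal.toReal_ofReal (tsum_nonneg ha), Complex.ofReal_tsum, wickTerm, ← tsum_mul_left]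
  exact tsum_congr hper

theorem pow_apply (l : ℕ) (j : J) : (q ^ l) (u j) = ((c j ^ l : ℝ) : ℂ) • u j := by
  induction l with
  | zero => simp
  | succ l ih =>
    rw [pow_succ, mul_apply_eq_comp, h.apply_q, map_smul, ih, smul_smul, ← Complex.ofReal_mul,
      pow_succ, mul_comm]

/-- For a single eigenvector on both sides the recursion becomes scalar, since `⟨q ^ l (u j), q (u
j)⟩ = c j ^ (l + 1)`. -/
theorem wickTerm_optCons_basis (f : Fin 0 → H) (m : ℕ) (j : J) :
    wickTerm q u (optCons (u j) f) (optCons (u j) f) m =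
      ((∑ k ∈ Finset.HasAntidiagonal.antidiagonal m,
        c j ^ (k.1 + 1) * (opTrace (opTensorPow q k.2)).toReal : ℝ) : ℂ) := by
  rw [wickTerm_optCons h.isSelfAdjoint_s h.eq_mul_self (h.summable_norm_sq u), Complex.ofReal_sum]
  refine Finset.sum_congr rfl fun k _ => ?_
  rw [wickPairing, Fintype.sum_option, Finset.univ_eq_empty, Finset.sum_empty, add_zero,
    (h.wickTerm_empty u _ _ _).2]
  simp only [optCons, Option.elim_none]
  rw [h.apply_q, h.pow_apply, inner_smul_left, inner_smul_right, inner_self_eq_norm_sq_to_K,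
    u.orthonormal.1 j, Complex.conj_ofReal]
  push_cast
  ring

theorem perBasis_insertNth (f : Fin 0 → H) (m : ℕ) (z : J × (Fin m → J)) :
    perBasis q u f f (insertNthPairEquiv J (0 : Fin (m + 1)) z) =
      perBasis q u (optCons (u z.1) f) (optCons (u z.1) f) z.2 := by
  have h1 : u ∘ insertNthPairEquiv J (0 : Fin (m + 1)) z =
      (0 : Fin (m + 1)).insertNth (u z.1) (u ∘ z.2) := by
    ext i
    rcases Fin.eq_self_or_eq_succAbove 0 i with rfl | ⟨j, rfl⟩ <;>
      simp [insertNthPairEquiv_apply]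
  rw [perBasis, h1, per_sumElim_insertNth, ← per_sumElim_optCons]
  rfl

theorem hasSum_wickTerm_optCons_basis (f : Fin 0 → H) (m : ℕ) :
    HasSum (fun j => (m.factorial : ℂ) * wickTerm q u (optCons (u j) f) (optCons (u j) f) m)
      (∑' x : Fin (m + 1) → J, perBasis q u f f x) := by
  refine hasSum_of_insertNthPairEquiv (h.summable_perBasis u (m + 1) f f) fun j => ?_
  have hne : (m.factorial : ℂ) ≠ 0 := by exact_mod_cast m.factorial_ne_zero
  simp only [h.perBasis_insertNth]
  rw [wickTerm, mul_inv_cancel_left₀ hne]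
  exact (h.summable_perBasis u m _ _).hasSum

/-- Newton's identity for the traces of `q` over the spaces of `n` bosons. -/
theorem newton (m : ℕ) :
    ((m : ℝ≥0∞) + 1) * opTrace (opTensorPow q (m + 1)) =
      ∑' j, ∑ k ∈ Finset.HasAntidiagonal.antidiagonal m,
        ENNReal.ofReal (c j) ^ (k.1 + 1) * opTrace (opTensorPow q k.2) := by
  let f : Fin 0 → H := fun i => i.elim0
  let w : ℕ → ℝ := fun m => (opTrace (opTensorPow q m)).toReal
  have hfin : ∀ m, opTrace (opTensorPow q m) ≠ ∞ := fun m => (h.wickTerm_empty u f f m).1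
  have hw0 : ∀ m, 0 ≤ w m := fun m => ENNReal.toReal_nonneg
  have htot2 : HasSum (fun j => ∑ k ∈ Finset.HasAntidiagonal.antidiagonal m,
      c j ^ (k.1 + 1) * w k.2) ((m + 1) * w (m + 1)) := by
    rw [← Complex.hasSum_ofReal]
    -- One of the `m + 1` traced vectors is singled out as a given vector `u j`, and the sum over
    -- `j` is kept outside.
    have h1 := (h.hasSum_wickTerm_optCons_basis f m).mul_left ((m.factorial : ℂ)⁻¹)
    have hne : (m.factorial : ℂ) ≠ 0 := by exact_mod_cast m.factorial_ne_zero
    have h2 := (h.wickTerm_empty u f f (m + 1)).2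
    have hne' : ((m + 1).factorial : ℂ) ≠ 0 := by exact_mod_cast (m + 1).factorial_ne_zero
    rw [wickTerm, inv_mul_eq_iff_eq_mul₀ hne'] at h2
    rw [h2, Nat.factorial_succ] at h1
    convert! h1 using 1
    · ext j
      rw [inv_mul_cancel_left₀ hne, h.wickTerm_optCons_basis]
    · push_cast
      rw [mul_assoc, mul_left_comm _ ((m : ℂ) + 1), mul_left_comm ((m.factorial : ℂ)⁻¹),
        mul_inv_cancel_left₀ hne]
  have hnn : ∀ j, 0 ≤ ∑ k ∈ Finset.HasAntidiagonal.antidiagonal m, c j ^ (k.1 + 1) * w k.2 :=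
    fun j => Finset.sum_nonneg fun k _ => mul_nonneg (pow_nonneg (h.pos j).le _) (hw0 _)
  have h1 := congrArg ENNReal.ofReal htot2.tsum_eq
  rw [ENNReal.ofReal_tsum_of_nonneg hnn htot2.summable, ENNReal.ofReal_mul (by positivity),
    ENNReal.ofReal_toReal (hfin _), ENNReal.ofReal_add (by positivity) zero_le_one,
    ENNReal.ofReal_natCast, ENNReal.ofReal_one] at h1
  rw [← h1]
  refine tsum_congr fun j => ?_
  rw [ENNReal.ofReal_sum_of_nonneg fun k _ => mul_nonneg (pow_nonneg (h.pos j).le _) (hw0 _)]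
  refine Finset.sum_congr rfl fun k _ => ?_
  rw [ENNReal.ofReal_mul (pow_nonneg (h.pos j).le _), ENNReal.ofReal_toReal (hfin _),
    ENNReal.ofReal_pow (h.pos j).le]

end IsThermal

theorem ennreal_tsum_antidiagonal (a b : ℕ → ℝ≥0∞) :
    ∑' m, ∑ k ∈ Finset.HasAntidiagonal.antidiagonal m, a k.1 * b k.2 =
      (∑' l, a l) * ∑' k, b k := by
  have h1 : ∑' m, ∑ k ∈ Finset.HasAntidiagonal.antidiagonal m, a k.1 * b k.2 =
      ∑' z : Σ m : ℕ, Finset.HasAntidiagonal.antidiagonal m, a z.2.1.1 * b z.2.1.2 := by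
    rw [ENNReal.tsum_sigma']
    refine tsum_congr fun m => ?_
    rw [tsum_fintype, Finset.univ_eq_attach,
      Finset.sum_attach _ fun k : ℕ × ℕ => a k.1 * b k.2]
  rw [h1, ← Finset.HasAntidiagonal.sigmaAntidiagonalEquivProd.symm.tsum_eq, ENNReal.tsum_prod']
  simp only [Finset.HasAntidiagonal.sigmaAntidiagonalEquivProd_symm_apply_snd_coe]
  simp only [ENNReal.tsum_mul_left, ENNReal.tsum_mul_right]

namespace IsThermal

variable (h : IsThermal u c q s r)
include h

theorem tsum_geometric (j : J) :
    ∑' l : ℕ, ENNReal.ofReal (c j) ^ (l + 1) = ENNReal.ofReal (c j / (1 - c j)) := by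
  have h1 := h.lt_one j
  rw [ENNReal.tsum_geometric_add_one, div_eq_mul_inv, ENNReal.ofReal_mul (h.pos j).le,
    ENNReal.ofReal_inv_of_pos (by linarith), ENNReal.ofReal_sub _ (h.pos j).le, ENNReal.ofReal_one]

theorem tsum_antidiagonal (b : ℕ → ℝ≥0∞) (j : J) :
    ∑' m, ∑ k ∈ Finset.HasAntidiagonal.antidiagonal m, ENNReal.ofReal (c j) ^ (k.1 + 1) * b k.2 =
      ENNReal.ofReal (c j / (1 - c j)) * ∑' k, b k := by
  rw [← h.tsum_geometric, ← ennreal_tsum_antidiagonal]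

/-- Newton's identity summed over `m` is a Cauchy product with geometric series. In `[0, ∞]` no
convergence is required. -/
theorem tsum_number_opTrace :
    ∑' n : ℕ, (n : ℝ≥0∞) * opTrace (opTensorPow q n) =
      (∑' j, ENNReal.ofReal (c j / (1 - c j))) * ∑' n, opTrace (opTensorPow q n) := by
  rw [tsum_eq_zero_add' ENNReal.summable]
  simp only [Nat.cast_zero, zero_mul, zero_add, Nat.cast_add, Nat.cast_one, h.newton]
  rw [ENNReal.tsum_comm]
  simp_rw [h.tsum_antidiagonal fun n => opTrace (opTensorPow q n)]
  rw [ENNReal.tsum_mul_right]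

theorem summable_resolvent : ∑' j, ENNReal.ofReal (c j / (1 - c j)) ≠ ∞ := by
  obtain ⟨a, ha, hca⟩ := h.bound
  rw [tsum_ofReal_ne_top_iff fun j => div_nonneg (h.pos j).le (by linarith [h.lt_one j])]
  refine Summable.of_nonneg_of_le (fun j => div_nonneg (h.pos j).le (by linarith [h.lt_one j]))
    (fun j => ?_) (h.summable.mul_right (1 / (1 - a)))
  have := hca j
  rw [div_eq_mul_one_div]
  exact mul_le_mul_of_nonneg_left (one_div_le_one_div_of_le (by linarith) (by linarith))
    (h.pos j).le

/-- This is the truncated form of `tsum_number_opTrace`, usable before the partition function is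
known to be finite. Cutting the traces off beyond `M` leaves the terms with `m < M` unchanged, and
the full Cauchy product bounds them. -/
theorem sum_number_opTrace_le (M : ℕ) :
    ∑ n ∈ Finset.range (M + 1), (n : ℝ≥0∞) * opTrace (opTensorPow q n) ≤
      (∑' j, ENNReal.ofReal (c j / (1 - c j))) *
        ∑ n ∈ Finset.range (M + 1), opTrace (opTensorPow q n) := by
  let b : ℕ → ℝ≥0∞ := fun n => if n < M + 1 then opTrace (opTensorPow q n) else 0
  have hb : ∑ n ∈ Finset.range (M + 1), opTrace (opTensorPow q n) = ∑' n, b n := by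
    rw [tsum_eq_sum (s := Finset.range (M + 1)) fun n hn => if_neg (by simpa using hn)]
    exact Finset.sum_congr rfl fun n hn => (if_pos (Finset.mem_range.1 hn)).symm
  rw [hb, Finset.sum_range_succ']
  simp only [Nat.cast_zero, zero_mul, add_zero, Nat.cast_add, Nat.cast_one, h.newton]
  calc ∑ m ∈ Finset.range M, ∑' j, ∑ k ∈ Finset.HasAntidiagonal.antidiagonal m,
        ENNReal.ofReal (c j) ^ (k.1 + 1) * opTrace (opTensorPow q k.2)
      = ∑ m ∈ Finset.range M, ∑' j, ∑ k ∈ Finset.HasAntidiagonal.antidiagonal m,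
        ENNReal.ofReal (c j) ^ (k.1 + 1) * b k.2 := by
        refine Finset.sum_congr rfl fun m hm => tsum_congr fun j =>
          Finset.sum_congr rfl fun k hk => ?_
        have h1 := Finset.HasAntidiagonal.mem_antidiagonal.1 hk
        have h2 := Finset.mem_range.1 hm
        rw [show b k.2 = opTrace (opTensorPow q k.2) from if_pos (by omega)]
    _ ≤ ∑' m, ∑' j, ∑ k ∈ Finset.HasAntidiagonal.antidiagonal m,
        ENNReal.ofReal (c j) ^ (k.1 + 1) * b k.2 := ENNReal.sum_le_tsum _
    _ = _ := by
        rw [ENNReal.tsum_comm]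
        simp_rw [h.tsum_antidiagonal b]
        rw [ENNReal.tsum_mul_right]

/-- A bounded mean particle number keeps mass from escaping to large `n`, as in Markov's inequality.
With `N > 2 t`, the truncated bound gives `N S(M + 1) ≤ N S(N) + t S(M + 1)`, hence `S(M + 1) ≤ 2
S(N)` for all `M`. The cancellation is legitimate because each single trace is finite. -/
theorem tsum_opTrace_ne_top : ∑' n, opTrace (opTensorPow q n) ≠ ∞ := by
  set t := ∑' j, ENNReal.ofReal (c j / (1 - c j)) with ht
  have htop : t ≠ ∞ := h.summable_resolvent
  have hfin : ∀ m, opTrace (opTensorPow q m) ≠ ∞ := fun m =>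
    (h.wickTerm_empty u (fun i => i.elim0) (fun i => i.elim0) m).1
  obtain ⟨N, hN⟩ := ENNReal.exists_nat_gt (ENNReal.mul_ne_top ENNReal.ofNat_ne_top htop : 2 * t ≠ ∞)
  have hN0 : (N : ℝ≥0∞) ≠ 0 := (zero_le.trans_lt hN).ne'
  set S : ℕ → ℝ≥0∞ := fun M => ∑ n ∈ Finset.range M, opTrace (opTensorPow q n) with hS
  have hSfin : ∀ M, S M ≠ ∞ := fun M => ENNReal.sum_ne_top.2 fun n _ => hfin n
  have key : ∀ M, S (M + 1) ≤ 2 * S N := by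
    intro M
    have h1 : N * S (M + 1) ≤ N * S N + t * S (M + 1) := by
      calc N * S (M + 1) = ∑ n ∈ Finset.range (M + 1), N * opTrace (opTensorPow q n) := by
            rw [hS, Finset.mul_sum]
        _ ≤ ∑ n ∈ Finset.range (M + 1), ((if n < N then N * opTrace (opTensorPow q n) else 0) +
              n * opTrace (opTensorPow q n)) := by
            refine Finset.sum_le_sum fun n _ => ?_
            split_ifs with hn
            · exact le_self_add
            · rw [zero_add]
              have : (N : ℝ≥0∞) ≤ n := by exact_mod_cast not_lt.1 hn
              gcongr
        _ ≤ N * S N + t * S (M + 1) := by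
            rw [Finset.sum_add_distrib]
            refine add_le_add ?_ (h.sum_number_opTrace_le M)
            rw [← Finset.sum_filter, hS, Finset.mul_sum]
            refine Finset.sum_le_sum_of_subset fun n hn => ?_
            exact Finset.mem_range.2 (Finset.mem_filter.1 hn).2
    have h2 : N * S (M + 1) + N * S (M + 1) ≤ 2 * (N * S N) + N * S (M + 1) := by
      calc N * S (M + 1) + N * S (M + 1) = 2 * (N * S (M + 1)) := (two_mul _).symm
        _ ≤ 2 * (N * S N + t * S (M + 1)) := by gcongr
        _ = 2 * (N * S N) + (2 * t) * S (M + 1) := by ring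
        _ ≤ _ := by gcongr
    have h3 := ENNReal.le_of_add_le_add_right
      (ENNReal.mul_ne_top (ENNReal.natCast_ne_top N) (hSfin _)) h2
    rw [mul_left_comm] at h3
    exact (ENNReal.mul_le_mul_iff_right hN0 (ENNReal.natCast_ne_top N)).1 h3
  rw [ENNReal.tsum_eq_iSup_nat]
  refine ne_top_of_le_ne_top (ENNReal.mul_ne_top ENNReal.ofNat_ne_top (hSfin N) : 2 * S N ≠ ∞)
    (iSup_le fun M => ?_)
  exact (Finset.sum_le_sum_of_subset (Finset.range_mono M.le_succ)).trans (key M)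

theorem opTrace_opTensorPow_zero_ne_zero : opTrace (opTensorPow q 0) ≠ 0 := by
  rw [opTrace_eq_of_isParseval (isParseval_symProj_tprod u 0) (h.nonneg 0)]
  rw [tsum_eq_single (fun i : Fin 0 => i.elim0) fun x hx => absurd (Subsingleton.elim _ _) hx]
  rw [inner_opTensorPow h.apply_q]
  simp

theorem hasSum_wickTerm_empty {L : Type*} (e : HilbertBasis L ℂ H) (f g : Fin 0 → H) :
    HasSum (wickTerm q e f g) ((∑' n, opTrace (opTensorPow q n)).toReal : ℂ) := by
  have h1 : wickTerm q e f g = fun m => ((opTrace (opTensorPow q m)).toReal : ℂ) := by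
    ext m; exact (h.wickTerm_empty e f g m).2
  rw [h1, Complex.hasSum_ofReal]
  rw [ENNReal.tsum_toReal_eq fun m => (h.wickTerm_empty e f g m).1]
  exact ENNReal.hasSum_toReal h.tsum_opTrace_ne_top

theorem hasSum_wickTerm {L : Type*} (e : HilbertBasis L ℂ H) {k : ℕ} (f g : Fin k → H) :
    HasSum (wickTerm q e f g) ((∑' n, opTrace (opTensorPow q n)).toReal * per r f g) :=
  FreeGibbs.hasSum_wickTerm h.isSelfAdjoint_s h.eq_mul_self (h.summable_norm_sq e) h.norm_lt_one
    h.resolvent_eq (h.hasSum_wickTerm_empty e) k f g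

theorem inner_append {L : Type*} (e : HilbertBasis L ℂ H) {k m : ℕ} (f g : Fin k → H)
    (x : Fin m → L) :
    ⟪symProj H (k + m) (tprod (Fin.append f fun l => e (x l))),
      opTensorPow q (k + m) (symProj H (k + m) (tprod (Fin.append g fun l => e (x l))))⟫_ℂ =
      ((k + m).factorial : ℂ)⁻¹ * perBasis q e f g x := by
  rw [inner_opTensorPow h.apply_q]
  congr 1
  have h2 : ∀ f : Fin k → H, Sum.elim f (e ∘ x) =
      Fin.append f (fun l => e (x l)) ∘ finSumFinEquiv := by
    intro f
    ext (i | i) <;> simp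
  rw [perBasis, h2, h2, per_comp_equiv]
  rfl

/-- `hasSum_wickTerm` only controls the iterated sum. For `f = g` the terms are nonnegative, so
joint summability follows; in general they are dominated by the two diagonal cases through
Cauchy-Schwarz for the positive operator `q^{⊗(k + m)}`. -/
theorem summable_sigma_perBasis {L : Type*} (e : HilbertBasis L ℂ H) {k : ℕ} (f g : Fin k → H) :
    Summable fun x : Σ m : ℕ, (Fin m → L) =>
      (x.1.factorial : ℂ)⁻¹ * perBasis q e f g x.2 := by
  let R : (Fin k → H) → (Σ m : ℕ, (Fin m → L)) → ℝ := fun f x =>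
    (x.1.factorial : ℝ)⁻¹ * ((k + x.1).factorial *
      (⟪symProj H (k + x.1) (tprod (Fin.append f fun l => e (x.2 l))),
      opTensorPow q (k + x.1) (symProj H (k + x.1)
        (tprod (Fin.append f fun l => e (x.2 l))))⟫_ℂ).re)
  have hR0 : ∀ f x, 0 ≤ R f x := fun f x =>
    mul_nonneg (by positivity) (mul_nonneg (by positivity) (re_inner_nonneg_of_nonneg (h.nonneg _) _))
  have hper : ∀ (f g : Fin k → H) {m : ℕ} (x : Fin m → L), perBasis q e f g x = (k + m).factorial *
      ⟪symProj H (k + m) (tprod (Fin.append f fun l => e (x l))),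
      opTensorPow q (k + m) (symProj H (k + m) (tprod (Fin.append g fun l => e (x l))))⟫_ℂ :=
    fun f g m x => by
      rw [h.inner_append, mul_inv_cancel_left₀]
      exact_mod_cast (k + m).factorial_ne_zero
  have hRc : ∀ f x, (R f x : ℂ) = (x.1.factorial : ℂ)⁻¹ * perBasis q e f f x.2 := fun f x => by
    rw [hper]
    refine (Complex.ofReal_mul _ _).trans ?_
    rw [Complex.ofReal_mul, ← inner_eq_ofReal_re_of_nonneg (h.nonneg _), Complex.ofReal_inv,
      Complex.ofReal_natCast, Complex.ofReal_natCast]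
  have hRsum : ∀ f, Summable (R f) := fun f => by
    rw [summable_sigma_of_nonneg (hR0 f)]
    constructor
    · intro m
      rw [← Complex.summable_ofReal]
      exact ((h.summable_perBasis e m f f).mul_left ((m.factorial : ℂ)⁻¹)).congr
        fun x => (hRc f ⟨m, x⟩).symm
    · rw [← Complex.summable_ofReal]
      refine (h.hasSum_wickTerm e f f).summable.congr fun m => ?_
      rw [Complex.ofReal_tsum, wickTerm, ← tsum_mul_left]
      exact tsum_congr fun x => (hRc f ⟨m, x⟩).symm
  refine Summable.of_norm_bounded ((hRsum f).add (hRsum g)) fun x => ?_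
  rw [hper, norm_mul, norm_mul, norm_inv, Complex.norm_natCast, Complex.norm_natCast,
    ← mul_add, ← mul_add]
  gcongr
  exact norm_inner_le_add_of_nonneg (h.nonneg _) _ _

theorem hasSum_sigma_perBasis {L : Type*} (e : HilbertBasis L ℂ H) {k : ℕ} (f g : Fin k → H) :
    HasSum (fun x : Σ m : ℕ, (Fin m → L) => (x.1.factorial : ℂ)⁻¹ * perBasis q e f g x.2)
      ((∑' n, opTrace (opTensorPow q n)).toReal * per r f g) := by
  have h1 := (h.summable_sigma_perBasis e f g).hasSum
  have h2 := h1.sigma fun m => ((h.summable_perBasis e m f g).mul_left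
    (m.factorial : ℂ)⁻¹).hasSum
  simp only [tsum_mul_left] at h2
  rw [← HasSum.unique h2 (h.hasSum_wickTerm e f g)]
  exact h1

end IsThermal

theorem inner_smul_congr {K : Type*} [NormedAddCommGroup K] [InnerProductSpace ℂ K] {x y y' : K}
    (a b : ℂ) (h : ⟪x, y⟫_ℂ = ⟪x, y'⟫_ℂ) : ⟪a • x, b • y⟫_ℂ = ⟪a • x, b • y'⟫_ℂ := by
  rw [inner_smul_left, inner_smul_left, inner_smul_right, inner_smul_right, h]

theorem IsDensityMatrix.unique {Γ : Fock H →L[ℂ] Fock H} {k : ℕ}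
    {D D' : SymPow H k →L[ℂ] SymPow H k} (hD : IsDensityMatrix Γ k D)
    (hD' : IsDensityMatrix Γ k D') : D = D' := by
  refine ContinuousLinearMap.ext_on dense_span_symProd ?_
  rintro _ ⟨g, rfl⟩
  refine ext_inner_of_dense dense_span_symProd ?_
  rintro _ ⟨f, rfl⟩
  rw [symProd_eq f, symProd_eq g, map_smul, map_smul]
  exact inner_smul_congr _ _ ((hD f g).unique (hD' f g))

theorem densityMatrix_eq {Γ : Fock H →L[ℂ] Fock H} {k : ℕ}
    {D : SymPow H k →L[ℂ] SymPow H k} (hD : IsDensityMatrix Γ k D) : densityMatrix Γ k = D := by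
  have hex : ∃ D, IsDensityMatrix Γ k D := ⟨D, hD⟩
  rw [densityMatrix, dif_pos hex]
  exact hex.choose_spec.unique hD

section Gibbs

variable {A : H →ₗ.[ℂ] H} {lam : J → ℝ} {T : ℝ}
  (hsymm : ∀ x y : A.domain, ⟪A x, (y : H)⟫_ℂ = ⟪(x : H), A y⟫_ℂ)
  (hu : ∀ j, IsEigen A (lam j) (u j)) (hpos : ∀ j, 0 < lam j) (hT : 0 < T)
  (h : IsThermal u (fun j => Real.exp (-lam j / T)) q s r)

include hsymm hu hpos hT h

theorem partitionFunction_ne_top : partitionFunction A T ≠ ∞ := by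
  rw [partitionFunction_eq hsymm hu hpos hT h.apply_q]
  exact h.tsum_opTrace_ne_top

theorem partitionFunction_ne_zero : partitionFunction A T ≠ 0 := by
  rw [partitionFunction_eq hsymm hu hpos hT h.apply_q]
  exact fun h0 => h.opTrace_opTensorPow_zero_ne_zero (ENNReal.tsum_eq_zero.1 h0 0)

theorem isDensityMatrix_gibbs (k : ℕ) : IsDensityMatrix (gibbs A T) k (opTensorPow r k) := by
  intro f g
  have hZ := partitionFunction_eq hsymm hu hpos hT h.apply_q
  have hZr : (partitionFunction A T).toReal ≠ 0 :=
    (ENNReal.toReal_pos (partitionFunction_ne_zero hsymm hu hpos hT h)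
      (partitionFunction_ne_top hsymm hu hpos hT h)).ne'
  have h1 := (h.hasSum_sigma_perBasis (stdBasis H) f g).mul_left
    (((partitionFunction A T).toReal : ℂ)⁻¹ * (k.factorial : ℂ)⁻¹)
  rw [inner_opTensorPow h.apply_r]
  convert! h1 using 1
  · ext ⟨m, x⟩
    rw [block_gibbs hsymm hu hpos hT h.apply_q, smul_apply]
    refine (congrArg _ (inner_smul_right (𝕜 := ℂ) _ _ _)).trans ?_
    dsimp only
    rw [h.inner_append]
    -- The binomial coefficient turns `1 / (k + m)!` into `1 / (k! m!)`: the `m!` belongs to the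
    -- trace over `m` particles, the `k!` to the matrix elements of `r^{⊗k}`.
    have h6 : (((k + m).choose k * k.factorial * m.factorial : ℕ) : ℂ) = (k + m).factorial := by
      rw [Nat.choose_symm_add, Nat.add_choose_mul_factorial_mul_factorial]
    rw [← h6]
    have h2 : ((k + m).choose k : ℂ) ≠ 0 := by
      exact_mod_cast (Nat.choose_pos (Nat.le_add_right k m)).ne'
    have h3 : (m.factorial : ℂ) ≠ 0 := by exact_mod_cast m.factorial_ne_zero
    have h4 : (k.factorial : ℂ) ≠ 0 := by exact_mod_cast k.factorial_ne_zero
    push_cast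
    field_simp
  · rw [← hZ]
    have h5 : ((partitionFunction A T).toReal : ℂ) ≠ 0 := by exact_mod_cast hZr
    rw [per]
    field_simp

theorem numberExpectation_gibbs : numberExpectation (gibbs A T) =
    ∑' j, ENNReal.ofReal (1 / (Real.exp (lam j / T) - 1)) := by
  have hZ := partitionFunction_eq hsymm hu hpos hT h.apply_q
  have h0 := partitionFunction_ne_zero hsymm hu hpos hT h
  have htop := partitionFunction_ne_top hsymm hu hpos hT h
  have hZr := ENNReal.toReal_pos h0 htop
  have h1 : ∀ n, opTrace (block (gibbs A T) n) =
      (partitionFunction A T)⁻¹ * opTrace (opTensorPow q n) := fun n => by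
    rw [block_gibbs hsymm hu hpos hT h.apply_q, opTrace, opTrace, ← ENNReal.tsum_mul_left]
    refine tsum_congr fun i => ?_
    rw [smul_apply]
    refine (congrArg (fun z : ℂ => ENNReal.ofReal z.re) (inner_smul_right (𝕜 := ℂ) _ _ _)).trans ?_
    rw [Complex.re_ofReal_mul, ENNReal.ofReal_mul (inv_nonneg.2 hZr.le),
      ENNReal.ofReal_inv_of_pos hZr, ENNReal.ofReal_toReal htop]
  rw [numberExpectation]
  simp_rw [h1, mul_left_comm _ (partitionFunction A T)⁻¹]
  rw [ENNReal.tsum_mul_left, h.tsum_number_opTrace, ← hZ, mul_left_comm,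
    ENNReal.inv_mul_cancel h0 htop, mul_one]
  refine tsum_congr fun j => ?_
  congr 1
  rw [neg_div, Real.exp_neg]
  have h2 : Real.exp (lam j / T) ≠ 0 := (Real.exp_pos _).ne'
  have h3 : Real.exp (lam j / T) - 1 ≠ 0 := by
    have := Real.add_one_lt_exp (div_pos (hpos j) hT).ne'
    have := div_pos (hpos j) hT
    linarith
  field_simp

end Gibbs

end Thermal

/-! ### Schatten norms of diagonal operators and limits -/

section Schatten

/-- The members of `v` are eigenvectors of `A* A` with eigenvalue `c j ^ 2`, hence of its powers.
The weights `‖v j‖ ^ 2` account for the redundancy of the family. -/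
theorem schattenNorm_eq_of_isParseval {K : Type*} [NormedAddCommGroup K] [InnerProductSpace ℂ K]
    [CompleteSpace K] {J : Type*} {v : J → K} (hv : IsParseval v) {A : K →L[ℂ] K}
    (hA : IsSelfAdjoint A) {c : J → ℝ} (hc : ∀ j, A (v j) = (c j : ℂ) • v j) {p : ℝ}
    (hp : 0 ≤ p) :
    schattenNorm p A = (∑' j, ENNReal.ofReal (|c j| ^ p * ‖v j‖ ^ 2)) ^ (1 / p) := by
  have h0 : 0 ≤ ContinuousLinearMap.adjoint A * A := by
    rw [← ContinuousLinearMap.star_eq_adjoint]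
    exact star_mul_self_nonneg A
  have h1 : ∀ j, (ContinuousLinearMap.adjoint A * A) (v j) = ((c j ^ 2 : ℝ) : ℂ) • v j := fun j => by
    rw [← ContinuousLinearMap.star_eq_adjoint, hA.star_eq, mul_apply_eq_comp, hc, map_smul, hc,
      smul_smul, ← Complex.ofReal_mul, sq]
  have h2 : ∀ x : ℝ, (x ^ 2) ^ (p / 2) = |x| ^ p := fun x => by
    rw [← sq_abs, ← Real.rpow_natCast, ← Real.rpow_mul (abs_nonneg x)]
    congr 1
    push_cast
    ring
  rw [schattenNorm, opTrace_eq_of_isParseval hv CFC.rpow_nonneg]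
  congr 1
  refine tsum_congr fun j => ?_
  rw [rpow_apply_eigenvector h0 (h1 j) (by positivity), inner_smul_right,
    inner_self_eq_norm_sq_to_K, h2]
  norm_cast
  exact congrArg ENNReal.ofReal (Complex.re_ofReal_mul _ _)

variable {H : Type*} [NormedAddCommGroup H] [InnerProductSpace ℂ H] [CompleteSpace H]
  {J : Type*} {u : HilbertBasis J ℂ H} {k : ℕ}

/-- Dropping the weights, which are at most one, overcounts by summing over ordered tuples, but
leaves sums that factorise. -/
theorem schattenNorm_le {A : SymPow H k →L[ℂ] SymPow H k} (hA : IsSelfAdjoint A)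
    {c : (Fin k → J) → ℝ}
    (hc : ∀ x, A (symProj H k (tprod (u ∘ x))) = (c x : ℂ) • symProj H k (tprod (u ∘ x))) {p : ℝ}
    (hp : 0 ≤ p) (hsum : Summable fun x => |c x| ^ p) :
    schattenNorm p A ≤ ENNReal.ofReal (∑' x, |c x| ^ p) ^ (1 / p) := by
  rw [schattenNorm_eq_of_isParseval (isParseval_symProj_tprod u k) hA hc hp,
    ENNReal.ofReal_tsum_of_nonneg (fun x => by positivity) hsum]
  refine ENNReal.rpow_le_rpow (ENNReal.tsum_le_tsum fun x => ENNReal.ofReal_le_ofReal ?_)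
    (by positivity)
  exact mul_le_of_le_one_right (by positivity)
    (pow_le_one₀ (norm_nonneg _) (norm_symProj_tprod_basis_le u x))

theorem schattenNorm_lt_top {A : SymPow H k →L[ℂ] SymPow H k} (hA : IsSelfAdjoint A)
    {c : (Fin k → J) → ℝ}
    (hc : ∀ x, A (symProj H k (tprod (u ∘ x))) = (c x : ℂ) • symProj H k (tprod (u ∘ x))) {p : ℝ}
    (hp : 0 ≤ p) (hsum : Summable fun x => |c x| ^ p) : schattenNorm p A < ∞ :=
  (schattenNorm_le hA hc hp hsum).trans_lt
    (ENNReal.rpow_lt_top_of_nonneg (by positivity) ENNReal.ofReal_ne_top)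

theorem abs_prod_rpow {c : J → ℝ} (p : ℝ) (x : Fin k → J) :
    |∏ l, c (x l)| ^ p = ∏ l, |c (x l)| ^ p := by
  rw [Finset.abs_prod, ← Real.finsetProd_rpow _ _ fun _ _ => abs_nonneg _]

theorem schattenNorm_opTensorPow_lt_top {A : H →L[ℂ] H} {c : J → ℝ}
    (hA : ∀ j, A (u j) = (c j : ℂ) • u j) {p : ℝ} (hp : 0 ≤ p)
    (hsum : Summable fun j => |c j| ^ p) : schattenNorm p (opTensorPow A k) < ∞ := by
  refine schattenNorm_lt_top (isSelfAdjoint_opTensorPow hA) (opTensorPow_symProj_tprod_basis hA) hp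
    ?_
  simp_rw [abs_prod_rpow]
  exact summable_prod_pow (fun j => by positivity) hsum k

theorem isSelfAdjoint_ofReal_smul {K : Type*} [NormedAddCommGroup K] [InnerProductSpace ℂ K]
    [CompleteSpace K] {A : K →L[ℂ] K} (hA : IsSelfAdjoint A) (a : ℝ) :
    IsSelfAdjoint ((a : ℂ) • A) :=
  IsSelfAdjoint.smul (Complex.conj_ofReal a) hA

theorem smul_opTensorPow_symProj_tprod_basis {A : H →L[ℂ] H} {c : J → ℝ}
    (hA : ∀ j, A (u j) = (c j : ℂ) • u j) (a : ℝ) (x : Fin k → J) :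
    ((a : ℂ) • opTensorPow A k) (symProj H k (tprod (u ∘ x))) =
      ((a * ∏ l, c (x l) : ℝ) : ℂ) • symProj H k (tprod (u ∘ x)) := by
  rw [smul_apply, opTensorPow_symProj_tprod_basis hA, smul_smul, Complex.ofReal_mul]

theorem schattenNorm_smul_opTensorPow_lt_top {A : H →L[ℂ] H} {c : J → ℝ}
    (hA : ∀ j, A (u j) = (c j : ℂ) • u j) {p : ℝ} (hp : 0 ≤ p)
    (hsum : Summable fun j => |c j| ^ p) (a : ℝ) :
    schattenNorm p ((a : ℂ) • opTensorPow A k) < ∞ := by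
  refine schattenNorm_lt_top (isSelfAdjoint_ofReal_smul (isSelfAdjoint_opTensorPow hA) a)
    (smul_opTensorPow_symProj_tprod_basis hA a) hp ?_
  simp_rw [abs_mul, Real.mul_rpow (abs_nonneg _) (abs_nonneg _), abs_prod_rpow]
  exact (summable_prod_pow (fun j => by positivity) hsum k).mul_left _

/-- The difference is diagonal on projected products with eigenvalues `d T x`. Since `0 ≤ b T j / T
≤ a j`, they are dominated by `k! ∏ a (x l)`, whose `p`-th power is summable over tuples, so
dominated convergence applies. -/
theorem tendsto_schattenNorm_sub {ρ : ℝ → H →L[ℂ] H} {B : H →L[ℂ] H} {b : ℝ → J → ℝ} {a : J → ℝ}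
    (hρ : ∀ T j, 0 < T → ρ T (u j) = (b T j : ℂ) • u j) (hB : ∀ j, B (u j) = (a j : ℂ) • u j)
    (hb0 : ∀ T j, 0 < T → 0 ≤ b T j) (hb : ∀ T j, 0 < T → b T j / T ≤ a j)
    (hlim : ∀ j, Filter.Tendsto (fun T => b T j / T) Filter.atTop (nhds (a j))) {p : ℝ}
    (hp : 1 ≤ p) (hsum : Summable fun j => a j ^ p) :
    Filter.Tendsto (fun T : ℝ => schattenNorm p
        (((k.factorial / T ^ k : ℝ) : ℂ) • opTensorPow (ρ T) k -
          (k.factorial : ℂ) • opTensorPow B k)) Filter.atTop (nhds 0) := by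
  have hp0 : 0 < p := zero_lt_one.trans_le hp
  have ha : ∀ j, 0 ≤ a j := fun j =>
    (div_nonneg (hb0 1 j one_pos) zero_le_one).trans (hb 1 j one_pos)
  let d : ℝ → (Fin k → J) → ℝ := fun T x =>
    (k.factorial : ℝ) * ((∏ l, b T (x l) / T) - ∏ l, a (x l))
  have hd : ∀ T, 0 < T → ∀ x, |d T x| ^ p ≤ (k.factorial : ℝ) ^ p * ∏ l, a (x l) ^ p := by
    intro T hT x
    rw [Real.finsetProd_rpow _ _ fun l _ => ha _, ← Real.mul_rpow (by positivity)
      (Finset.prod_nonneg fun l _ => ha _)]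
    refine Real.rpow_le_rpow (abs_nonneg _) ?_ hp0.le
    rw [abs_mul, Nat.abs_cast]
    refine mul_le_mul_of_nonneg_left ?_ (Nat.cast_nonneg _)
    have h1 : 0 ≤ ∏ l, b T (x l) / T := Finset.prod_nonneg fun l _ => div_nonneg (hb0 _ _ hT) hT.le
    have h2 : ∏ l, b T (x l) / T ≤ ∏ l, a (x l) :=
      Finset.prod_le_prod (fun l _ => div_nonneg (hb0 _ _ hT) hT.le) fun l _ => hb T _ hT
    rw [abs_sub_comm, abs_of_nonneg (sub_nonneg.2 h2)]
    linarith
  have hbound : Summable fun x : Fin k → J => (k.factorial : ℝ) ^ p * ∏ l, a (x l) ^ p :=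
    (summable_prod_pow (fun j => Real.rpow_nonneg (ha j) p) hsum k).mul_left _
  have hlim' : ∀ x, Filter.Tendsto (fun T => |d T x| ^ p) Filter.atTop (nhds 0) := fun x => by
    have h1 : Filter.Tendsto (fun T => |d T x| ^ p) Filter.atTop (nhds (|(k.factorial : ℝ) *
        ((∏ l, a (x l)) - ∏ l, a (x l))| ^ p)) := by
      refine Filter.Tendsto.rpow_const (Filter.Tendsto.abs ?_) (Or.inr hp0.le)
      exact ((tendsto_finsetProd _ fun l _ => hlim (x l)).sub_const _).const_mul _
    simpa [Real.zero_rpow hp0.ne'] using h1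
  have hts : Filter.Tendsto (fun T => ∑' x, |d T x| ^ p) Filter.atTop (nhds 0) := by
    have h1 := tendsto_tsum_of_dominated_convergence hbound hlim'
      ((Filter.eventually_gt_atTop 0).mono fun T hT x => by
        rw [Real.norm_eq_abs, abs_of_nonneg (by positivity)]
        exact hd T hT x)
    simpa using h1
  have hup : Filter.Tendsto (fun T => ENNReal.ofReal (∑' x, |d T x| ^ p) ^ (1 / p)) Filter.atTop
      (nhds 0) := by
    have h1 := ((ENNReal.continuous_rpow_const (y := 1 / p)).tendsto _).comp
      (ENNReal.tendsto_ofReal hts)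
    rw [ENNReal.ofReal_zero, ENNReal.zero_rpow_of_pos (by positivity)] at h1
    exact h1
  refine tendsto_of_tendsto_of_tendsto_of_le_of_le' tendsto_const_nhds hup
    (Filter.Eventually.of_forall fun _ => zero_le)
    ((Filter.eventually_gt_atTop 0).mono fun T hT => ?_)
  have hρT := fun j => hρ T j hT
  have hsa : IsSelfAdjoint (((k.factorial / T ^ k : ℝ) : ℂ) • opTensorPow (ρ T) k -
      (k.factorial : ℂ) • opTensorPow B k) := by
    refine (isSelfAdjoint_ofReal_smul (isSelfAdjoint_opTensorPow hρT) _).sub ?_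
    have h1 := isSelfAdjoint_ofReal_smul (isSelfAdjoint_opTensorPow (n := k) hB) (k.factorial : ℝ)
    rwa [Complex.ofReal_natCast] at h1
  refine schattenNorm_le hsa (u := u) (c := d T) (fun x => ?_) hp0.le
    (hbound.of_nonneg_of_le (fun x => by positivity) (hd T hT))
  have h1 := smul_opTensorPow_symProj_tprod_basis hB (k.factorial : ℝ) x
  rw [Complex.ofReal_natCast] at h1
  rw [sub_apply, smul_opTensorPow_symProj_tprod_basis hρT, h1, ← sub_smul]
  congr 1
  rw [← Complex.ofReal_sub]
  congr 1
  simp only [d]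
  rw [Finset.prod_div_distrib, Finset.prod_const, Finset.card_univ, Fintype.card_fin]
  ring

end Schatten

/-! ### Bounds and limits for the Bose-Einstein factors -/

section Bose

theorem summable_exp_neg_div {J : Type*} {lam : J → ℝ} (hpos : ∀ j, 0 < lam j) {p T : ℝ}
    (hp : 0 < p) (hT : 0 < T) (hsum : Summable fun j => lam j ^ (-p)) :
    Summable fun j => Real.exp (-lam j / T) := by
  refine Summable.of_nonneg_of_le (fun _ => (Real.exp_pos _).le) (fun j => ?_)
    (hsum.mul_left ((T * p) ^ p))
  -- The scale `T * p` is chosen so that the power `-p` of this inequality bounds `exp (-lam j / T)`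
  -- by a multiple of `lam j ^ (-p)`.
  have h1 : lam j / (T * p) ≤ Real.exp (lam j / (T * p)) := by
    linarith [Real.add_one_le_exp (lam j / (T * p))]
  have hTp : 0 < T * p := mul_pos hT hp
  have h2 : Real.exp (-lam j / T) = Real.exp (lam j / (T * p)) ^ (-p) := by
    rw [← Real.exp_mul]
    congr 1
    field_simp
  have h3 : (T * p) ^ p * lam j ^ (-p) = (lam j / (T * p)) ^ (-p) := by
    rw [Real.div_rpow (hpos j).le hTp.le, Real.rpow_neg hTp.le, div_inv_eq_mul, mul_comm]
  rw [h2, h3]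
  exact Real.rpow_le_rpow_of_nonpos (div_pos (hpos j) hTp) h1 (by linarith)

theorem exists_exp_neg_div_le {J : Type*} {lam : J → ℝ} {M T : ℝ} (hM : 0 < M) (hT : 0 < T)
    (h : ∀ j, M ≤ lam j) : ∃ a < 1, ∀ j, Real.exp (-lam j / T) ≤ a := by
  refine ⟨Real.exp (-M / T), by
    rw [← Real.exp_zero]
    exact Real.exp_lt_exp.2 (div_neg_of_neg_of_pos (by linarith) hT), fun j => ?_⟩
  rw [Real.exp_le_exp]
  have := h j
  gcongr

theorem exp_sub_one_pos {a T : ℝ} (ha : 0 < a) (hT : 0 < T) : 0 < Real.exp (a / T) - 1 := by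
  linarith [Real.add_one_lt_exp (div_pos ha hT).ne', div_pos ha hT]

theorem bose_nonneg {a T : ℝ} (ha : 0 < a) (hT : 0 < T) : 0 ≤ 1 / (Real.exp (a / T) - 1) :=
  (one_div_pos.2 (exp_sub_one_pos ha hT)).le

theorem bose_div_le {a T : ℝ} (ha : 0 < a) (hT : 0 < T) :
    1 / (Real.exp (a / T) - 1) / T ≤ a⁻¹ := by
  rw [div_div, one_div]
  refine inv_anti₀ ha ?_
  have h1 := Real.add_one_le_exp (a / T)
  have h2 : a = a / T * T := by field_simp
  nlinarith

theorem bose_eq (a T : ℝ) :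
    1 / (Real.exp (a / T) - 1) = Real.exp (-a / T) / (1 - Real.exp (-a / T)) := by
  have h2 : Real.exp (a / T) ≠ 0 := (Real.exp_pos _).ne'
  rw [neg_div, Real.exp_neg, ← mul_div_mul_left (Real.exp (a / T))⁻¹ _ h2, mul_inv_cancel₀ h2,
    mul_sub, mul_inv_cancel₀ h2, mul_one]

/-- The quotient is `a⁻¹` divided by the slope of `exp` between `0` and `a / T`, and that slope
tends to one. -/
theorem tendsto_bose_div {a : ℝ} (ha : 0 < a) :
    Filter.Tendsto (fun T : ℝ => 1 / (Real.exp (a / T) - 1) / T) Filter.atTop (nhds a⁻¹) := by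
  have h0 : Filter.Tendsto (fun T : ℝ => a / T) Filter.atTop (nhdsWithin 0 {0}ᶜ) := by
    refine tendsto_nhdsWithin_iff.2 ⟨tendsto_const_nhds.div_atTop Filter.tendsto_id, ?_⟩
    exact (Filter.eventually_gt_atTop 0).mono fun T hT => (div_pos ha hT).ne'
  have h1 := (hasDerivAt_iff_tendsto_slope.1 (Real.hasDerivAt_exp 0)).comp h0
  rw [Real.exp_zero] at h1
  have h2 := (h1.inv₀ one_ne_zero).const_mul a⁻¹
  rw [inv_one, mul_one] at h2
  refine h2.congr' ((Filter.eventually_gt_atTop 0).mono fun T hT => ?_)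
  have h3 := (exp_sub_one_pos ha hT).ne'
  simp only [Function.comp_apply, slope_def_field, Real.exp_zero, sub_zero]
  field_simp

/-- The limit may be infinite, so no summable majorant is available. The upper bound is termwise,
and the lower bound comes from finite partial sums. -/
theorem tendsto_tsum_ofReal_div {J : Type*} {b : ℝ → J → ℝ} {a : J → ℝ}
    (hb : ∀ T j, 0 < T → b T j / T ≤ a j)
    (hlim : ∀ j, Filter.Tendsto (fun T => b T j / T) Filter.atTop (nhds (a j))) :
    Filter.Tendsto (fun T : ℝ => (∑' j, ENNReal.ofReal (b T j)) / ENNReal.ofReal T) Filter.atTop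
      (nhds (∑' j, ENNReal.ofReal (a j))) := by
  have h1 : ∀ T, 0 < T → (∑' j, ENNReal.ofReal (b T j)) / ENNReal.ofReal T =
      ∑' j, ENNReal.ofReal (b T j / T) := fun T hT => by
    rw [div_eq_mul_inv, ← ENNReal.tsum_mul_right]
    refine tsum_congr fun j => ?_
    rw [ENNReal.ofReal_div_of_pos hT, div_eq_mul_inv]
  rw [tendsto_order]
  constructor
  · intro y hy
    obtain ⟨s, hs⟩ := ((tendsto_order.1 (ENNReal.summable (f := fun j =>
      ENNReal.ofReal (a j))).hasSum).1 y hy).exists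
    have h2 : Filter.Tendsto (fun T => ∑ j ∈ s, ENNReal.ofReal (b T j / T)) Filter.atTop
        (nhds (∑ j ∈ s, ENNReal.ofReal (a j))) :=
      tendsto_finsetSum _ fun j _ => ENNReal.tendsto_ofReal (hlim j)
    filter_upwards [(tendsto_order.1 h2).1 y hs, Filter.eventually_gt_atTop 0] with T hT hT0
    rw [h1 T hT0]
    exact hT.trans_le (ENNReal.sum_le_tsum s)
  · intro y hy
    filter_upwards [Filter.eventually_gt_atTop 0] with T hT0
    rw [h1 T hT0]
    exact (ENNReal.tsum_le_tsum fun j => ENNReal.ofReal_le_ofReal (hb T j hT0)).trans_lt hy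

end Bose

/-! ### Moments of the Gaussian measure -/

section OneMode

open MeasureTheory

variable {a : ℝ}

theorem integral_complexGaussian {E : Type*} [NormedAddCommGroup E] [NormedSpace ℝ E] (ha : 0 < a)
    (f : ℂ → E) : ∫ z, f z ∂complexGaussian a =
      ∫ z : ℂ, (a / Real.pi * Real.exp (-a * ‖z‖ ^ 2)) • f z := by
  rw [complexGaussian, integral_withDensity_eq_integral_toReal_smul (by fun_prop)
    (Filter.Eventually.of_forall fun _ => ENNReal.ofReal_lt_top)]
  refine integral_congr_ae (Filter.Eventually.of_forall fun z => ?_)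
  have : 0 ≤ a / Real.pi * Real.exp (-a * ‖z‖ ^ 2) :=
    mul_nonneg (div_nonneg ha.le Real.pi_pos.le) (Real.exp_pos _).le
  simp only [ENNReal.toReal_ofReal this]

theorem integral_norm_pow_complexGaussian (ha : 0 < a) (m : ℕ) :
    ∫ z, ‖z‖ ^ (2 * m) ∂complexGaussian a = m.factorial / a ^ m := by
  have h1 := Complex.integral_rpow_mul_exp_neg_mul_rpow (p := 2) (q := 2 * m) (b := a)
    one_le_two (by have : (0 : ℝ) ≤ m := Nat.cast_nonneg m
                   linarith) ha
  rw [integral_complexGaussian ha]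
  have h2 : ∀ z : ℂ, (a / Real.pi * Real.exp (-a * ‖z‖ ^ 2)) • ‖z‖ ^ (2 * m) =
      a / Real.pi * (‖z‖ ^ (2 * m : ℝ) * Real.exp (-a * ‖z‖ ^ (2 : ℝ))) := fun z => by
    rw [Real.rpow_two, show (2 * m : ℝ) = ((2 * m : ℕ) : ℝ) by push_cast; ring, Real.rpow_natCast,
      smul_eq_mul]
    ring
  simp_rw [h2]
  rw [integral_const_mul, h1, show ((2 * m + 2) / 2 : ℝ) = m + 1 by ring, Real.Gamma_nat_eq_factorial,
    show (-(2 * m + 2) / 2 : ℝ) = -((m + 1 : ℕ) : ℝ) by push_cast; ring, Real.rpow_neg ha.le,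
    Real.rpow_natCast]
  have := Real.pi_ne_zero
  field_simp
  rw [pow_succ, mul_comm]

/-- The integral of a non-integrable function is zero by convention, whereas this one equals `m! / a
^ m`. -/
theorem integrable_norm_pow_complexGaussian (ha : 0 < a) (m : ℕ) :
    Integrable (fun z : ℂ => ‖z‖ ^ (2 * m)) (complexGaussian a) := by
  refine Integrable.of_integral_ne_zero ?_
  rw [integral_norm_pow_complexGaussian ha]
  have := m.factorial_ne_zero
  positivity

theorem isProbabilityMeasure_complexGaussian (ha : 0 < a) :
    IsProbabilityMeasure (complexGaussian a) := by
  have h1 := integrable_norm_pow_complexGaussian ha 0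
  simp only [mul_zero, pow_zero] at h1
  have h2 := integral_norm_pow_complexGaussian ha 0
  simp only [mul_zero, pow_zero, Nat.factorial_zero, Nat.cast_one, div_one] at h2
  have h3 := (integrable_const_iff_isFiniteMeasure (one_ne_zero (α := ℝ))).1 h1
  rw [integral_const, smul_eq_mul, mul_one] at h2
  refine ⟨?_⟩
  rw [← ENNReal.ofReal_toReal (measure_ne_top _ Set.univ)]
  exact (congrArg ENNReal.ofReal h2).trans ENNReal.ofReal_one

theorem integrable_monomial_complexGaussian (ha : 0 < a) (m n : ℕ) :
    Integrable (fun z : ℂ => z ^ m * (starRingEnd ℂ z) ^ n) (complexGaussian a) := by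
  have := isProbabilityMeasure_complexGaussian ha
  refine Integrable.mono' ((integrable_const (1 : ℝ)).add
    (integrable_norm_pow_complexGaussian ha (m + n))) (by fun_prop)
    (Filter.Eventually.of_forall fun z => ?_)
  rw [norm_mul, norm_pow, norm_pow, RCLike.norm_conj, ← pow_add]
  simp only [Pi.add_apply]
  rw [mul_comm 2, pow_mul]
  nlinarith [sq_nonneg (‖z‖ ^ (m + n) - 1), sq_nonneg (‖z‖ ^ (m + n))]

theorem integral_monomial_complexGaussian (ha : 0 < a) (m n : ℕ) :
    ∫ z, z ^ m * (starRingEnd ℂ z) ^ n ∂complexGaussian a =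
      if m = n then (m.factorial : ℂ) / (a : ℂ) ^ m else 0 := by
  split_ifs with h
  · subst h
    have h1 : ∀ z : ℂ, z ^ m * (starRingEnd ℂ z) ^ m = ((‖z‖ ^ (2 * m) : ℝ) : ℂ) := fun z => by
      rw [← mul_pow, Complex.mul_conj, Complex.normSq_eq_norm_sq, pow_mul]
      push_cast
      rfl
    simp_rw [h1]
    rw [integral_complex_ofReal, integral_norm_pow_complexGaussian ha]
    push_cast
    rfl
  · rw [integral_complexGaussian ha]
    set g : ℂ → ℂ := fun z => (a / Real.pi * Real.exp (-a * ‖z‖ ^ 2)) •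
      (z ^ m * (starRingEnd ℂ z) ^ n) with hg
    -- The rotation with `w ^ (m - n) = -1` preserves the Gaussian weight and Lebesgue measure and
    -- changes the sign of the monomial, so the integral equals its own opposite.
    let w : Circle := Circle.exp (Real.pi / ((m : ℝ) - n))
    have hmn : ((m : ℝ) - n) ≠ 0 := sub_ne_zero.2 (by exact_mod_cast h)
    have hw : (w : ℂ) ^ m * (starRingEnd ℂ (w : ℂ)) ^ n = -1 := by
      rw [← Circle.coe_inv_eq_conj, ← Circle.coe_pow, ← Circle.coe_pow, ← Circle.coe_mul,
        ← Circle.exp_neg, ← Circle.exp_nsmul, ← Circle.exp_nsmul, ← Circle.exp_add,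
        Circle.coe_exp, ← Complex.exp_pi_mul_I]
      congr 2
      rw [Complex.ofReal_inj, nsmul_eq_mul, nsmul_eq_mul]
      field_simp
      ring
    have h2 : ∀ z, g (rotation w z) = -g z := fun z => by
      simp only [hg, rotation_apply, map_mul, mul_pow, norm_mul, Circle.norm_coe, one_mul]
      rw [mul_mul_mul_comm, hw, neg_one_mul, smul_neg]
    have h3 := (LinearIsometryEquiv.measurePreserving (rotation w)).integral_comp
      (rotation w).toHomeomorph.measurableEmbedding g
    simp_rw [h2] at h3
    rw [integral_neg] at h3
    exact self_eq_neg.1 h3.symm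

end OneMode

/-! ### Occupation numbers and counting of permutations -/

section Counting

variable {ι : Type*} [DecidableEq ι] {k : ℕ}

/-- The number of times that `i` occurs in `x`. -/
def occ (x : Fin k → ι) (i : ι) : ℕ := (Finset.univ.filter fun l => x l = i).card

theorem occ_comp_perm (x : Fin k → ι) (σ : Equiv.Perm (Fin k)) (i : ι) :
    occ (x ∘ σ) i = occ x i :=
  Finset.card_equiv σ fun l => by simp

theorem exists_perm_of_occ_eq {x y : Fin k → ι} (h : ∀ i, occ x i = occ y i) :
    ∃ σ : Equiv.Perm (Fin k), y = x ∘ σ := by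
  have e : ∀ i, Nonempty ({l // y l = i} ≃ {l // x l = i}) := fun i => by
    refine ⟨Fintype.equivOfCardEq ?_⟩
    rw [Fintype.card_subtype, Fintype.card_subtype]
    exact (h i).symm
  exact ⟨Equiv.ofFiberEquiv fun i => (e i).some,
    funext fun l => (Equiv.ofFiberEquiv_map (fun i => (e i).some) l).symm⟩

theorem prod_comp_eq_prod_pow_occ {M : Type*} [CommMonoid M] (x : Fin k → ι) {s : Finset ι}
    (hs : ∀ l, x l ∈ s) (f : ι → M) : ∏ l, f (x l) = ∏ i ∈ s, f i ^ occ x i := by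
  rw [← Finset.prod_fiberwise_of_maps_to (g := x) (t := s) fun l _ => hs l]
  refine Finset.prod_congr rfl fun i _ => ?_
  rw [Finset.prod_congr rfl fun l hl => by rw [(Finset.mem_filter.1 hl).2], Finset.prod_const, occ]

/-- These permutations form a coset of the stabiliser of `x`, which permutes the equal entries among
themselves. -/
theorem card_perm_comp_eq (x : Fin k → ι) {s : Finset ι} (hs : ∀ l, x l ∈ s)
    (σ₀ : Equiv.Perm (Fin k)) :
    (Finset.univ.filter fun σ : Equiv.Perm (Fin k) => x ∘ σ₀ = x ∘ σ).card =
      ∏ i ∈ s, (occ x i).factorial := by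
  have h1 : (Finset.univ.filter fun σ : Equiv.Perm (Fin k) => x ∘ σ₀ = x ∘ σ).card =
      (Finset.univ.filter fun σ : Equiv.Perm (Fin k) => x ∘ σ = x).card := by
    refine Finset.card_equiv (Equiv.mulRight σ₀⁻¹) fun σ => ?_
    simp only [Finset.mem_filter, Finset.mem_univ, true_and, Equiv.coe_mulRight]
    constructor
    · intro h
      ext l
      simpa [Equiv.Perm.mul_apply, Equiv.Perm.inv_def] using (congrFun h (σ₀.symm l)).symm
    · intro h
      ext l
      simpa [Equiv.Perm.mul_apply, Equiv.Perm.inv_def] using (congrFun h (σ₀ l)).symm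
  rw [h1, ← Fintype.card_subtype, DomMulAct.stabilizer_card']
  refine (Finset.prod_subset (s₂ := s) ?_ fun i _ hi => ?_).trans ?_
  · intro i hi
    obtain ⟨l, -, rfl⟩ := Finset.mem_image.1 hi
    exact hs l
  · have : IsEmpty {a // x a = i} := ⟨fun l => hi (Finset.mem_image.2 ⟨l.1, Finset.mem_univ _, l.2⟩)⟩
    rw [Fintype.card_eq_zero, Nat.factorial_zero]
  · refine Finset.prod_congr rfl fun i _ => ?_
    rw [Fintype.card_subtype, occ]

/-- If `y` rearranges `x`, the factorials on the left count the permutations that achieve it.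
Otherwise some occupation number differs and both sides vanish. -/
theorem prod_moment_eq_sum_perm (lam : ι → ℝ) (x y : Fin k → ι) {s : Finset ι}
    (hx : ∀ l, x l ∈ s) (hy : ∀ l, y l ∈ s) :
    ∏ i ∈ s, (if occ x i = occ y i then ((occ x i).factorial : ℂ) / (lam i : ℂ) ^ occ x i else 0) =
      ∑ σ : Equiv.Perm (Fin k), if y = x ∘ σ then ((∏ l, (lam (x l))⁻¹ : ℝ) : ℂ) else 0 := by
  by_cases h : ∃ σ₀ : Equiv.Perm (Fin k), y = x ∘ σ₀
  · obtain ⟨σ₀, rfl⟩ := h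
    rw [← Finset.sum_filter, Finset.sum_const, card_perm_comp_eq x hx σ₀, nsmul_eq_mul,
      prod_comp_eq_prod_pow_occ x hx fun i => (lam i)⁻¹]
    simp only [occ_comp_perm, if_true]
    push_cast
    rw [← Finset.prod_mul_distrib]
    refine Finset.prod_congr rfl fun i _ => ?_
    rw [inv_pow, div_eq_mul_inv]
  · rw [Finset.sum_eq_zero fun σ _ => if_neg fun h' => h ⟨σ, h'⟩]
    have h1 : ∃ i, occ x i ≠ occ y i := by
      by_contra! hne
      exact h (exists_perm_of_occ_eq hne)
    obtain ⟨i, hi⟩ := h1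
    have his : i ∈ s := by
      by_contra hn
      refine hi ?_
      rw [occ, occ, Finset.filter_false_of_mem fun l _ (e : x l = i) => hn (e ▸ hx l),
        Finset.filter_false_of_mem fun l _ (e : y l = i) => hn (e ▸ hy l)]
    exact Finset.prod_eq_zero his (if_neg hi)

end Counting

/-! ### Independence of the modes and the Gaussian Wick theorem -/

section Wick

open MeasureTheory

variable {ι : Type*} {lam : ι → ℝ} (hpos : ∀ i, 0 < lam i)

include hpos

theorem isProbabilityMeasure_mu0 : IsProbabilityMeasure (mu0 lam) := by
  have := fun i => isProbabilityMeasure_complexGaussian (hpos i)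
  rw [mu0]
  infer_instance

theorem integrable_prod_mu0 {s : Finset ι} {g : ι → ℂ → ℂ}
    (hg : ∀ i, Integrable (g i) (complexGaussian (lam i))) :
    Integrable (fun α => ∏ i ∈ s, g i (α i)) (mu0 lam) := by
  have := fun i => isProbabilityMeasure_complexGaussian (hpos i)
  have h1 : Integrable (fun y : (i : s) → ℂ => ∏ i : s, g i (y i))
      (Measure.pi fun i : s => complexGaussian (lam i)) :=
    Integrable.fintype_prod_dep fun i => hg i
  rw [← Measure.infinitePi_map_restrict (fun i => complexGaussian (lam i))] at h1
  refine (h1.comp_measurable (by fun_prop)).congr (Filter.Eventually.of_forall fun α => ?_)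
  exact Finset.prod_coe_sort s fun i => g i (α i)

theorem integral_prod_mu0 {s : Finset ι} {g : ι → ℂ → ℂ}
    (hg : ∀ i, Integrable (g i) (complexGaussian (lam i))) :
    ∫ α, ∏ i ∈ s, g i (α i) ∂mu0 lam = ∏ i ∈ s, ∫ z, g i z ∂complexGaussian (lam i) := by
  have := fun i => isProbabilityMeasure_complexGaussian (hpos i)
  have h1 : Integrable (fun y : (i : s) → ℂ => ∏ i : s, g i (y i))
      (Measure.pi fun i : s => complexGaussian (lam i)) :=
    Integrable.fintype_prod_dep fun i => hg i
  have h2 := integral_restrict_infinitePi (μ := fun i => complexGaussian (lam i))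
    h1.aestronglyMeasurable
  rw [integral_fintype_prod_eq_prod (fun (i : s) z => g i z),
    Finset.prod_coe_sort s fun i => ∫ z, g i z ∂complexGaussian (lam i)] at h2
  rw [← h2, mu0]
  refine integral_congr_ae (Filter.Eventually.of_forall fun α => ?_)
  exact (Finset.prod_coe_sort s fun i => g i (α i)).symm

omit hpos in
theorem prod_mul_prod_conj_eq [DecidableEq ι] {k : ℕ} (x y : Fin k → ι) {s : Finset ι}
    (hx : ∀ l, x l ∈ s) (hy : ∀ l, y l ∈ s) (α : ι → ℂ) :
    (∏ l, α (x l)) * ∏ l, starRingEnd ℂ (α (y l)) =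
      ∏ i ∈ s, (α i ^ occ x i * (starRingEnd ℂ (α i)) ^ occ y i) := by
  rw [prod_comp_eq_prod_pow_occ x hx α, prod_comp_eq_prod_pow_occ y hy fun i => starRingEnd ℂ (α i),
    Finset.prod_mul_distrib]

theorem integrable_prod_mul_prod_conj {k : ℕ} (x y : Fin k → ι) :
    Integrable (fun α => (∏ l, α (x l)) * ∏ l, starRingEnd ℂ (α (y l))) (mu0 lam) := by
  classical
  let s : Finset ι := Finset.univ.image x ∪ Finset.univ.image y
  have hx : ∀ l, x l ∈ s := fun l => Finset.mem_union_left _ (by simp)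
  have hy : ∀ l, y l ∈ s := fun l => Finset.mem_union_right _ (by simp)
  simp_rw [prod_mul_prod_conj_eq x y hx hy]
  exact integrable_prod_mu0 hpos (g := fun i z => z ^ occ x i * (starRingEnd ℂ z) ^ occ y i)
    fun i => integrable_monomial_complexGaussian (hpos i) _ _

open Classical in
/-- Wick's theorem for the Gaussian measure. -/
theorem integral_prod_mul_prod_conj {k : ℕ} (x y : Fin k → ι) :
    ∫ α, (∏ l, α (x l)) * ∏ l, starRingEnd ℂ (α (y l)) ∂mu0 lam =
      ∑ σ : Equiv.Perm (Fin k), if y = x ∘ σ then ((∏ l, (lam (x l))⁻¹ : ℝ) : ℂ) else 0 := by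
  let s : Finset ι := Finset.univ.image x ∪ Finset.univ.image y
  have hx : ∀ l, x l ∈ s := fun l => Finset.mem_union_left _ (by simp)
  have hy : ∀ l, y l ∈ s := fun l => Finset.mem_union_right _ (by simp)
  simp_rw [prod_mul_prod_conj_eq x y hx hy]
  rw [integral_prod_mu0 hpos (g := fun i z => z ^ occ x i * (starRingEnd ℂ z) ^ occ y i)
    fun i => integrable_monomial_complexGaussian (hpos i) _ _, ← prod_moment_eq_sum_perm lam x y hx hy]
  exact Finset.prod_congr rfl fun i _ => integral_monomial_complexGaussian (hpos i) _ _

end Wick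

/-! ### The density matrices of the Gaussian measure -/

section Coordinates

variable {H : Type*} [NormedAddCommGroup H] [InnerProductSpace ℂ H] [CompleteSpace H]
  {ι : Type*} {u : HilbertBasis ι ℂ H} {k : ℕ}

theorem coord_eq (Ψ : SymPow H k) (x : Fin k → ι) :
    coord u Ψ x = ⟪symProj H k (tprod (u ∘ x)), Ψ⟫_ℂ := (inner_symProj_left Ψ _).symm

theorem coord_comp_perm (Ψ : SymPow H k) (x : Fin k → ι) (σ : Equiv.Perm (Fin k)) :
    coord u Ψ (x ∘ σ) = coord u Ψ x := by
  rw [coord_eq, coord_eq, symProj_tprod, symProj_tprod, ← Function.comp_assoc, symProd_comp_perm]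

theorem inner_eigenvector_of_isSelfAdjoint {K : Type*} [NormedAddCommGroup K]
    [InnerProductSpace ℂ K] [CompleteSpace K] {A : K →L[ℂ] K} (hA : IsSelfAdjoint A) {c : ℝ}
    {x : K} (hx : A x = (c : ℂ) • x) (y : K) : ⟪x, A y⟫_ℂ = c * ⟪x, y⟫_ℂ := by
  have h1 := ContinuousLinearMap.isSelfAdjoint_iff_isSymmetric.1 hA x y
  rw [ContinuousLinearMap.coe_coe, hx, inner_smul_left, Complex.conj_ofReal] at h1
  exact h1.symm

theorem hasSum_inner_opTensorPow {A : H →L[ℂ] H} {c : ι → ℝ} (hA : ∀ j, A (u j) = (c j : ℂ) • u j)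
    (Φ Ψ : SymPow H k) :
    HasSum (fun x : Fin k → ι => ((∏ l, c (x l) : ℝ) : ℂ) *
      (starRingEnd ℂ (coord u Φ x) * coord u Ψ x)) ⟪Φ, opTensorPow A k Ψ⟫_ℂ := by
  have h1 := (tensorBasis u k).hasSum_inner_mul_inner (Φ : TensorPow H k)
    ((opTensorPow A k Ψ : SymPow H k) : TensorPow H k)
  refine h1.congr_fun fun x => ?_
  have h2 : ⟪tensorBasis u k x, ((opTensorPow A k Ψ : SymPow H k) : TensorPow H k)⟫_ℂ =
      ((∏ l, c (x l) : ℝ) : ℂ) * coord u Ψ x := by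
    rw [tensorBasis_apply, coord_eq]
    exact (inner_symProj_left _ _).symm.trans (inner_eigenvector_of_isSelfAdjoint
      (isSelfAdjoint_opTensorPow hA) (opTensorPow_symProj_tprod_basis hA x) Ψ)
  have h3 : ⟪(Φ : TensorPow H k), tensorBasis u k x⟫_ℂ = starRingEnd ℂ (coord u Φ x) := by
    rw [tensorBasis_apply, coord, inner_conj_symm]
  rw [h2, h3]
  ring

end Coordinates

/-! ### Integrability of Sobolev norms and of pairings -/

section Gaussian

open MeasureTheory

theorem integrable_tsum_of_summable {X I : Type*} [MeasurableSpace X] [Countable I]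
    {μ : Measure X} {F : I → X → ℂ} (hm : ∀ i, Measurable (F i)) (hF : ∀ i, Integrable (F i) μ)
    (hsum : Summable fun i => ∫ x, ‖F i x‖ ∂μ) : Integrable (fun x => ∑' i, F i x) μ := by
  refine ⟨(Measurable.tsum hm).aestronglyMeasurable, ?_⟩
  refine (lintegral_mono fun x => enorm_tsum_le_tsum_enorm).trans_lt ?_
  rw [lintegral_tsum fun i => (hm i).enorm.aemeasurable]
  have h1 : ∀ i, ∫⁻ x, ‖F i x‖ₑ ∂μ = ENNReal.ofReal (∫ x, ‖F i x‖ ∂μ) := fun i => by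
    rw [ofReal_integral_eq_lintegral_ofReal (hF i).norm
      (Filter.Eventually.of_forall fun _ => norm_nonneg _)]
    simp only [ofReal_norm]
  simp_rw [h1]
  exact ((tsum_ofReal_ne_top_iff fun i => integral_nonneg fun _ => norm_nonneg _).2 hsum).lt_top

variable {ι : Type*} {lam : ι → ℝ} (hpos : ∀ i, 0 < lam i)

include hpos

theorem integrable_prod_norm_sq {k : ℕ} (x : Fin k → ι) :
    Integrable (fun α => ∏ l, ‖α (x l)‖ ^ 2) (mu0 lam) := by
  refine (integrable_prod_mul_prod_conj hpos x x).re.congr (Filter.Eventually.of_forall fun α => ?_)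
  simp only [← Finset.prod_mul_distrib, Complex.mul_conj, Complex.normSq_eq_norm_sq]
  rw [← Complex.ofReal_prod]
  exact Complex.ofReal_re _

theorem integral_prod_norm_sq_le {k : ℕ} (x : Fin k → ι) :
    ∫ α, ∏ l, ‖α (x l)‖ ^ 2 ∂mu0 lam ≤ k.factorial * ∏ l, (lam (x l))⁻¹ := by
  classical
  have h1 : ((∫ α, ∏ l, ‖α (x l)‖ ^ 2 ∂mu0 lam : ℝ) : ℂ) =
      ∑ σ : Equiv.Perm (Fin k), if x = x ∘ σ then ((∏ l, (lam (x l))⁻¹ : ℝ) : ℂ) else 0 := by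
    rw [← integral_complex_ofReal]
    refine Eq.trans (integral_congr_ae (Filter.Eventually.of_forall fun α => ?_))
      ((integral_prod_mul_prod_conj hpos x x).trans (Finset.sum_congr rfl fun σ _ => by congr))
    simp only [← Finset.prod_mul_distrib, Complex.mul_conj, Complex.normSq_eq_norm_sq]
    rw [← Complex.ofReal_prod]
  have hP : 0 ≤ ∏ l, (lam (x l))⁻¹ := Finset.prod_nonneg fun l _ => (inv_pos.2 (hpos _)).le
  have h2 : ∫ α, ∏ l, ‖α (x l)‖ ^ 2 ∂mu0 lam =
      ∑ σ : Equiv.Perm (Fin k), if x = x ∘ σ then (∏ l, (lam (x l))⁻¹ : ℝ) else 0 := by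
    rw [← Complex.ofReal_inj, h1, Complex.ofReal_sum]
    refine Finset.sum_congr rfl fun σ _ => ?_
    split_ifs <;> simp
  rw [h2]
  refine (Finset.sum_le_card_nsmul _ _ (∏ l, (lam (x l))⁻¹) fun σ _ => ?_).trans (le_of_eq ?_)
  · split_ifs
    · exact le_rfl
    · exact hP
  · rw [Finset.card_univ, Fintype.card_perm, Fintype.card_fin, nsmul_eq_mul]

variable {p : ℝ} (hsum : Summable fun i => lam i ^ (-p))

omit hpos in
/-- `‖u‖²` in `ℌ^s`, with values in `[0, ∞]`. -/
def sobolevENormSq (lam : ι → ℝ) (s : ℝ) (α : ι → ℂ) : ℝ≥0∞ :=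
  ∑' i, ENNReal.ofReal (lam i ^ s * ‖α i‖ ^ 2)

theorem toReal_sobolevENormSq (s : ℝ) (α : ι → ℂ) :
    (sobolevENormSq lam s α).toReal = sobolevNormSq lam s α := by
  rw [sobolevENormSq, ENNReal.tsum_toReal_eq fun _ => ENNReal.ofReal_ne_top, sobolevNormSq]
  exact tsum_congr fun i => ENNReal.toReal_ofReal
    (mul_nonneg (Real.rpow_nonneg (hpos i).le _) (sq_nonneg _))

theorem mem_sobolevSpace_iff (s : ℝ) (α : ι → ℂ) :
    α ∈ sobolevSpace lam s ↔ sobolevENormSq lam s α ≠ ∞ :=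
  (tsum_ofReal_ne_top_iff fun i =>
    mul_nonneg (Real.rpow_nonneg (hpos i).le _) (sq_nonneg _)).symm

include hsum

theorem countable_of_summable_rpow : Countable ι := by
  have h1 := hsum.countable_support
  have h2 : Function.support (fun i => lam i ^ (-p)) = Set.univ :=
    Set.eq_univ_of_forall fun i => (Real.rpow_pos_of_pos (hpos i) _).ne'
  rw [h2] at h1
  exact Set.countable_univ_iff.1 h1

omit hsum in
theorem measurable_sobolevENormSq [Countable ι] (s : ℝ) : Measurable (sobolevENormSq lam s) :=
  Measurable.tsum fun i => by fun_prop

/-- Expanding the power over `k`-tuples, each term has expectation at most `k! ∏ lam ^ (1 - p) lam⁻¹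
= k! ∏ lam ^ (-p)`. This explains the exponent `1 - p`. -/
theorem lintegral_sobolevENormSq_pow_ne_top (k : ℕ) :
    ∫⁻ α, sobolevENormSq lam (1 - p) α ^ k ∂mu0 lam ≠ ∞ := by
  have := countable_of_summable_rpow hpos hsum
  have hw : ∀ i, 0 ≤ lam i ^ (1 - p) := fun i => Real.rpow_nonneg (hpos i).le _
  have h1 : ∀ α, sobolevENormSq lam (1 - p) α ^ k = ∑' x : Fin k → ι,
      ENNReal.ofReal ((∏ l, lam (x l) ^ (1 - p)) * ∏ l, ‖α (x l)‖ ^ 2) := fun α => by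
    rw [sobolevENormSq, ← tsum_prod_pow]
    refine tsum_congr fun x => ?_
    rw [← Finset.prod_mul_distrib, ENNReal.ofReal_prod_of_nonneg]
    exact fun l _ => mul_nonneg (hw _) (sq_nonneg _)
  simp_rw [h1]
  have hm : ∀ x : Fin k → ι, Measurable fun α : ι → ℂ =>
      ENNReal.ofReal ((∏ l, lam (x l) ^ (1 - p)) * ∏ l, ‖α (x l)‖ ^ 2) := fun x => by fun_prop
  rw [lintegral_tsum fun x => (hm x).aemeasurable]
  have hQ : ∀ x : Fin k → ι, 0 ≤ ∏ l, lam (x l) ^ (1 - p) := fun x =>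
    Finset.prod_nonneg fun l _ => hw _
  have h2 : ∀ x : Fin k → ι, ∫⁻ α, ENNReal.ofReal ((∏ l, lam (x l) ^ (1 - p)) *
      ∏ l, ‖α (x l)‖ ^ 2) ∂mu0 lam ≤ ENNReal.ofReal (k.factorial * ∏ l, lam (x l) ^ (-p)) := by
    intro x
    rw [← ofReal_integral_eq_lintegral_ofReal ((integrable_prod_norm_sq hpos x).const_mul _)
      (Filter.Eventually.of_forall fun α => mul_nonneg (hQ x)
        (Finset.prod_nonneg fun _ _ => sq_nonneg _)), integral_const_mul]
    refine ENNReal.ofReal_le_ofReal ((mul_le_mul_of_nonneg_left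
      (integral_prod_norm_sq_le hpos x) (hQ x)).trans (le_of_eq ?_))
    rw [mul_left_comm, ← Finset.prod_mul_distrib]
    congr 1
    refine Finset.prod_congr rfl fun l _ => ?_
    rw [← Real.rpow_neg_one, ← Real.rpow_add (hpos _)]
    congr 1
    ring
  refine ne_top_of_le_ne_top ?_ (ENNReal.tsum_le_tsum h2)
  rw [tsum_ofReal_ne_top_iff fun x => mul_nonneg (Nat.cast_nonneg _)
    (Finset.prod_nonneg fun l _ => Real.rpow_nonneg (hpos _).le _)]
  exact (summable_prod_pow (fun i => Real.rpow_nonneg (hpos i).le _) hsum k).mul_left _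

theorem ae_mem_sobolevSpace : ∀ᵐ α ∂mu0 lam, α ∈ sobolevSpace lam (1 - p) := by
  have := countable_of_summable_rpow hpos hsum
  have h1 := lintegral_sobolevENormSq_pow_ne_top hpos hsum 1
  simp only [pow_one] at h1
  filter_upwards [ae_lt_top (measurable_sobolevENormSq hpos (1 - p)) h1] with α hα
  exact (mem_sobolevSpace_iff hpos _ α).2 hα.ne

theorem integrable_sobolevNormSq_pow (k : ℕ) :
    Integrable (fun α => sobolevNormSq lam (1 - p) α ^ k) (mu0 lam) := by
  have := countable_of_summable_rpow hpos hsum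
  have h1 := integrable_toReal_of_lintegral_ne_top
    ((measurable_sobolevENormSq hpos (1 - p)).pow_const k).aemeasurable
    (lintegral_sobolevENormSq_pow_ne_top hpos hsum k)
  refine h1.congr (Filter.Eventually.of_forall fun α => ?_)
  simp only [ENNReal.toReal_pow, toReal_sobolevENormSq hpos]

omit hsum in
-- The inequality `s t ≤ (b / 2a) s² + (a / 2b) t²`, with weights matched to the second moments `a²`
-- and `b²`, gives the Cauchy-Schwarz bound.
theorem integral_norm_prod_mul_le {k : ℕ} (x y : Fin k → ι) :
    ∫ α, (∏ l, ‖α (x l)‖) * ∏ l, ‖α (y l)‖ ∂mu0 lam ≤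
      k.factorial * (Real.sqrt (∏ l, (lam (x l))⁻¹) * Real.sqrt (∏ l, (lam (y l))⁻¹)) := by
  have hP : ∀ x : Fin k → ι, 0 < ∏ l, (lam (x l))⁻¹ := fun x =>
    Finset.prod_pos fun l _ => inv_pos.2 (hpos _)
  set a := Real.sqrt (∏ l, (lam (x l))⁻¹) with ha
  set b := Real.sqrt (∏ l, (lam (y l))⁻¹) with hb
  have ha0 : 0 < a := Real.sqrt_pos.2 (hP x)
  have hb0 : 0 < b := Real.sqrt_pos.2 (hP y)
  have ha2 : ∏ l, (lam (x l))⁻¹ = a ^ 2 := (Real.sq_sqrt (hP x).le).symm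
  have hb2 : ∏ l, (lam (y l))⁻¹ = b ^ 2 := (Real.sq_sqrt (hP y).le).symm
  have hint : Integrable (fun α : ι → ℂ => b / (2 * a) * ∏ l, ‖α (x l)‖ ^ 2 +
      a / (2 * b) * ∏ l, ‖α (y l)‖ ^ 2) (mu0 lam) :=
    ((integrable_prod_norm_sq hpos x).const_mul _).add ((integrable_prod_norm_sq hpos y).const_mul _)
  refine (integral_mono_of_nonneg (Filter.Eventually.of_forall fun α => by positivity) hint
    (Filter.Eventually.of_forall fun α => ?_)).trans ?_
  · simp only [Finset.prod_pow]
    set s := ∏ l, ‖α (x l)‖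
    set t := ∏ l, ‖α (y l)‖
    have h1 : b / (2 * a) * s ^ 2 + a / (2 * b) * t ^ 2 - s * t =
        (b * s - a * t) ^ 2 / (2 * a * b) := by
      field_simp
      ring
    have h2 : 0 ≤ (b * s - a * t) ^ 2 / (2 * a * b) := by positivity
    linarith
  · rw [integral_add ((integrable_prod_norm_sq hpos x).const_mul _)
      ((integrable_prod_norm_sq hpos y).const_mul _), integral_const_mul, integral_const_mul]
    have h1 := integral_prod_norm_sq_le hpos x
    have h2 := integral_prod_norm_sq_le hpos y
    rw [ha2] at h1
    rw [hb2] at h2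
    calc _ ≤ b / (2 * a) * (k.factorial * a ^ 2) + a / (2 * b) * (k.factorial * b ^ 2) := by gcongr
      _ = _ := by field_simp; ring

variable {H : Type*} [NormedAddCommGroup H] [InnerProductSpace ℂ H] [CompleteSpace H]
  {u : HilbertBasis ι ℂ H} {k : ℕ}

/-- The terms of the series that defines `tensorPairing`. -/
def pairingTerm (u : ι → H) (Φ : SymPow H k) (x : Fin k → ι) (α : ι → ℂ) : ℂ :=
  (∏ l, starRingEnd ℂ (α (x l))) * coord u Φ x

omit hpos hsum in
theorem measurable_pairingTerm (Φ : SymPow H k) (x : Fin k → ι) :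
    Measurable (pairingTerm u Φ x) := by
  unfold pairingTerm
  fun_prop

omit hsum in
-- This is the duality of the weights `lam ^ (1 - p)` and `lam ^ (p - 1)`, through `2 s t ≤ s² / w +
-- w t²`.
theorem summable_norm_pairingTerm {Φ : SymPow H k} (hΦ : Φ ∈ symSobolevSpace lam u k (p - 1))
    {α : ι → ℂ} (hα : α ∈ sobolevSpace lam (1 - p)) :
    Summable fun x => ‖pairingTerm u Φ x α‖ := by
  have h1 := summable_prod_pow
    (fun i => mul_nonneg (Real.rpow_nonneg (hpos i).le _) (sq_nonneg _)) hα k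
  refine Summable.of_nonneg_of_le (fun _ => norm_nonneg _) (fun x => ?_) (h1.add hΦ)
  rw [pairingTerm, norm_mul, norm_prod]
  simp only [RCLike.norm_conj]
  rw [Finset.prod_mul_distrib, Finset.prod_pow]
  set s := ∏ l, ‖α (x l)‖
  set t := ‖coord u Φ x‖
  have hw : 0 < ∏ l, lam (x l) ^ (p - 1) := Finset.prod_pos fun l _ =>
    Real.rpow_pos_of_pos (hpos _) _
  have hw' : ∏ l, lam (x l) ^ (1 - p) = (∏ l, lam (x l) ^ (p - 1))⁻¹ := by
    rw [← Finset.prod_inv_distrib]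
    refine Finset.prod_congr rfl fun l _ => ?_
    rw [← Real.rpow_neg (hpos _).le, neg_sub]
  rw [hw']
  set w := ∏ l, lam (x l) ^ (p - 1)
  have h2 : w⁻¹ * s ^ 2 + w * t ^ 2 - 2 * (s * t) = (s - w * t) ^ 2 / w := by
    field_simp
    ring
  have h3 : 0 ≤ (s - w * t) ^ 2 / w := by positivity
  have h4 : 0 ≤ s * t := mul_nonneg (Finset.prod_nonneg fun _ _ => norm_nonneg _) (norm_nonneg _)
  linarith

/-- The same inequality with the typical size `(∏ lam⁻¹)^(1/2)` in place of the Gaussian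
coordinates: now `s² / w = ∏ lam ^ (-p)`, summable by the trace condition. -/
theorem summable_sqrt_mul_coord {Φ : SymPow H k} (hΦ : Φ ∈ symSobolevSpace lam u k (p - 1)) :
    Summable fun x : Fin k → ι => Real.sqrt (∏ l, (lam (x l))⁻¹) * ‖coord u Φ x‖ := by
  have h1 := summable_prod_pow (fun i => Real.rpow_nonneg (hpos i).le _) hsum k
  refine Summable.of_nonneg_of_le (fun _ => by positivity) (fun x => ?_) (h1.add hΦ)
  have hw : 0 < ∏ l, lam (x l) ^ (p - 1) := Finset.prod_pos fun l _ =>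
    Real.rpow_pos_of_pos (hpos _) _
  have hP : 0 < ∏ l, (lam (x l))⁻¹ := Finset.prod_pos fun l _ => inv_pos.2 (hpos _)
  have hw' : ∏ l, lam (x l) ^ (-p) = (∏ l, (lam (x l))⁻¹) * (∏ l, lam (x l) ^ (p - 1))⁻¹ := by
    rw [← Finset.prod_inv_distrib, ← Finset.prod_mul_distrib]
    refine Finset.prod_congr rfl fun l _ => ?_
    rw [← Real.rpow_neg (hpos _).le, ← Real.rpow_neg_one, ← Real.rpow_add (hpos _)]
    congr 1
    ring
  rw [hw']
  have hs := Real.sq_sqrt hP.le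
  set s := Real.sqrt (∏ l, (lam (x l))⁻¹)
  rw [← hs]
  set t := ‖coord u Φ x‖
  set w := ∏ l, lam (x l) ^ (p - 1)
  have h2 : s ^ 2 * w⁻¹ + w * t ^ 2 - 2 * (s * t) = (s - w * t) ^ 2 / w := by
    field_simp
    ring
  have h3 : 0 ≤ (s - w * t) ^ 2 / w := by positivity
  have h4 : 0 ≤ s * t := mul_nonneg (Real.sqrt_nonneg _) (norm_nonneg _)
  linarith

omit hpos hsum in
theorem conj_pairingTerm_mul (Φ Ψ : SymPow H k) (x y : Fin k → ι) (α : ι → ℂ) :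
    starRingEnd ℂ (pairingTerm u Φ x α) * pairingTerm u Ψ y α =
      ((∏ l, α (x l)) * ∏ l, starRingEnd ℂ (α (y l))) *
        (starRingEnd ℂ (coord u Φ x) * coord u Ψ y) := by
  rw [pairingTerm, pairingTerm, map_mul, map_prod]
  simp only [Complex.conj_conj]
  ring

omit hsum in
theorem integrable_conj_pairingTerm_mul (Φ Ψ : SymPow H k) (z : (Fin k → ι) × (Fin k → ι)) :
    Integrable (fun α => starRingEnd ℂ (pairingTerm u Φ z.1 α) * pairingTerm u Ψ z.2 α)
      (mu0 lam) := by
  simp_rw [conj_pairingTerm_mul]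
  exact (integrable_prod_mul_prod_conj hpos z.1 z.2).mul_const _

theorem summable_integral_norm_pairingTerm {Φ Ψ : SymPow H k}
    (hΦ : Φ ∈ symSobolevSpace lam u k (p - 1)) (hΨ : Ψ ∈ symSobolevSpace lam u k (p - 1)) :
    Summable fun z : (Fin k → ι) × (Fin k → ι) =>
      ∫ α, ‖starRingEnd ℂ (pairingTerm u Φ z.1 α) * pairingTerm u Ψ z.2 α‖ ∂mu0 lam := by
  have h1 := (Summable.mul_of_nonneg (summable_sqrt_mul_coord hpos hsum hΦ)
    (summable_sqrt_mul_coord hpos hsum hΨ) (fun _ => by positivity)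
    fun _ => by positivity).mul_left (k.factorial : ℝ)
  refine Summable.of_nonneg_of_le (fun _ => integral_nonneg fun _ => norm_nonneg _) (fun z => ?_) h1
  simp_rw [conj_pairingTerm_mul, norm_mul, norm_prod, RCLike.norm_conj]
  rw [integral_mul_const]
  refine (mul_le_mul_of_nonneg_right (integral_norm_prod_mul_le hpos z.1 z.2)
    (by positivity)).trans (le_of_eq ?_)
  ring

theorem conj_tensorPairing_mul_ae {Φ Ψ : SymPow H k}
    (hΦ : Φ ∈ symSobolevSpace lam u k (p - 1)) (hΨ : Ψ ∈ symSobolevSpace lam u k (p - 1)) :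
    (fun α => ∑' z : (Fin k → ι) × (Fin k → ι),
      starRingEnd ℂ (pairingTerm u Φ z.1 α) * pairingTerm u Ψ z.2 α) =ᵐ[mu0 lam]
      fun α => starRingEnd ℂ (tensorPairing u α Φ) * tensorPairing u α Ψ := by
  filter_upwards [ae_mem_sobolevSpace hpos hsum] with α hα
  have h1 := summable_norm_pairingTerm hpos hΦ hα
  have h1' : Summable fun x => ‖starRingEnd ℂ (pairingTerm u Φ x α)‖ := by
    simpa only [RCLike.norm_conj] using h1
  rw [← tsum_mul_tsum_of_summable_norm h1' (summable_norm_pairingTerm hpos hΨ hα)]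
  congr 1
  exact (Complex.conj_tsum _).symm

theorem integrable_conj_tensorPairing_mul {Φ Ψ : SymPow H k}
    (hΦ : Φ ∈ symSobolevSpace lam u k (p - 1)) (hΨ : Ψ ∈ symSobolevSpace lam u k (p - 1)) :
    Integrable (fun α => starRingEnd ℂ (tensorPairing u α Φ) * tensorPairing u α Ψ)
      (mu0 lam) := by
  have := countable_of_summable_rpow hpos hsum
  refine (integrable_tsum_of_summable (fun z => ?_) (integrable_conj_pairingTerm_mul hpos Φ Ψ)
    (summable_integral_norm_pairingTerm hpos hsum hΦ hΨ)).congr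
    (conj_tensorPairing_mul_ae hpos hsum hΦ hΨ)
  have h1 := measurable_pairingTerm (u := u) Φ z.1
  have h2 := measurable_pairingTerm (u := u) Ψ z.2
  fun_prop

/-- By Wick's formula only the pairs with `y = x ∘ σ` survive. Coordinates of a symmetric tensor do
not see `σ`, so the `k!` permutations contribute equally and leave the diagonal expansion of
`B^{⊗k}`. -/
theorem integral_conj_tensorPairing_mul {B : H →L[ℂ] H}
    (hB : ∀ i, B (u i) = (((lam i)⁻¹ : ℝ) : ℂ) • u i) {Φ Ψ : SymPow H k}
    (hΦ : Φ ∈ symSobolevSpace lam u k (p - 1)) (hΨ : Ψ ∈ symSobolevSpace lam u k (p - 1)) :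
    ∫ α, starRingEnd ℂ (tensorPairing u α Φ) * tensorPairing u α Ψ ∂mu0 lam =
      k.factorial * ⟪Φ, opTensorPow B k Ψ⟫_ℂ := by
  classical
  have := countable_of_summable_rpow hpos hsum
  rw [← integral_congr_ae (conj_tensorPairing_mul_ae hpos hsum hΦ hΨ)]
  have h1 := hasSum_integral_of_summable_integral_norm (integrable_conj_pairingTerm_mul hpos Φ Ψ)
    (summable_integral_norm_pairingTerm hpos hsum hΦ hΨ)
  have h2 : ∀ z : (Fin k → ι) × (Fin k → ι),
      ∫ α, starRingEnd ℂ (pairingTerm u Φ z.1 α) * pairingTerm u Ψ z.2 α ∂mu0 lam =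
      ∑ σ : Equiv.Perm (Fin k), if z.2 = z.1 ∘ σ then ((∏ l, (lam (z.1 l))⁻¹ : ℝ) : ℂ) *
        (starRingEnd ℂ (coord u Φ z.1) * coord u Ψ z.1) else 0 := fun z => by
    simp_rw [conj_pairingTerm_mul]
    rw [integral_mul_const, integral_prod_mul_prod_conj hpos, Finset.sum_mul]
    refine Finset.sum_congr rfl fun σ _ => ?_
    split_ifs with h
    · rw [h, coord_comp_perm]
    · rw [zero_mul]
  have h3 : ∀ x : Fin k → ι, HasSum (fun y : Fin k → ι =>
      ∑ σ : Equiv.Perm (Fin k), if y = x ∘ σ then ((∏ l, (lam (x l))⁻¹ : ℝ) : ℂ) *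
        (starRingEnd ℂ (coord u Φ x) * coord u Ψ x) else 0)
      (k.factorial * (((∏ l, (lam (x l))⁻¹ : ℝ) : ℂ) *
        (starRingEnd ℂ (coord u Φ x) * coord u Ψ x))) := fun x => by
    have h4 := hasSum_sum (s := Finset.univ) fun (σ : Equiv.Perm (Fin k)) _ =>
      hasSum_ite_eq (x ∘ σ) (((∏ l, (lam (x l))⁻¹ : ℝ) : ℂ) *
        (starRingEnd ℂ (coord u Φ x) * coord u Ψ x))
    rw [Finset.sum_const, Finset.card_univ, Fintype.card_perm, Fintype.card_fin, nsmul_eq_mul] at h4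
    exact h4
  exact ((h1.congr_fun fun z => (h2 z).symm).prod_fiberwise h3).unique
    ((hasSum_inner_opTensorPow hB Φ Ψ).mul_left _)

theorem isGaussianDensityMatrix {B : H →L[ℂ] H}
    (hB : ∀ i, B (u i) = (((lam i)⁻¹ : ℝ) : ℂ) • u i) (k : ℕ) :
    IsGaussianDensityMatrix lam u p k ((k.factorial : ℂ) • opTensorPow B k) where
  measure_eq_one := by
    have := isProbabilityMeasure_mu0 hpos
    exact (measure_congr (Filter.eventuallyEq_univ.2 (ae_mem_sobolevSpace hpos hsum))).trans
      measure_univ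
  integrable_norm := (integrable_sobolevNormSq_pow hpos hsum k).integrableOn
  integrable_form Φ hΦ Ψ hΨ := (integrable_conj_tensorPairing_mul hpos hsum hΦ hΨ).integrableOn
  integral_form Φ hΦ Ψ hΨ := by
    rw [Measure.restrict_eq_self_of_ae_mem (ae_mem_sobolevSpace hpos hsum),
      integral_conj_tensorPairing_mul hpos hsum hB hΦ hΨ]
    exact (inner_smul_right (𝕜 := ℂ) Φ (opTensorPow B k Ψ) (k.factorial : ℂ)).symm

end Gaussian

/-! ### Convergence of the Gibbs states -/

section Convergence

variable {H : Type v} [NormedAddCommGroup H] [InnerProductSpace ℂ H] [CompleteSpace H]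
  {J : Type*} {u : HilbertBasis J ℂ H} {lam : J → ℝ} {h : H →ₗ.[ℂ] H}

theorem exists_isThermal_exp (hpos : ∀ j, 0 < lam j) {M p T : ℝ} (hM : 0 < M)
    (hlam : ∀ j, M ≤ lam j) (hp : 0 < p) (hT : 0 < T) (hsum : Summable fun j => lam j ^ (-p)) :
    ∃ q s r, IsThermal u (fun j => Real.exp (-lam j / T)) q s r :=
  exists_isThermal (fun _ => Real.exp_pos _) (exists_exp_neg_div_le hM hT hlam)
    (summable_exp_neg_div hpos hp hT hsum)

theorem opFun_bose_eq (hsymm : ∀ x y : h.domain, ⟪h x, (y : H)⟫_ℂ = ⟪(x : H), h y⟫_ℂ)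
    (hu : ∀ j, IsEigen h (lam j) (u j)) {T : ℝ} {q s r : H →L[ℂ] H}
    (hth : IsThermal u (fun j => Real.exp (-lam j / T)) q s r) :
    opFun h (fun a => 1 / (Real.exp (a / T) - 1)) = r :=
  opFun_eq (isFunctionOf_of_eigenbasis hsymm hu fun j => by rw [hth.apply_r, bose_eq])

theorem summable_eigenvalue_rpow {B : H →L[ℂ] H} (hB : IsBoundedInverse h B) (hB0 : 0 ≤ B)
    (hnonneg : ∀ x : h.domain, 0 ≤ (⟪(x : H), h x⟫_ℂ).re) (hu : ∀ j, IsEigen h (lam j) (u j))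
    {p : ℝ} (hp : 0 ≤ p) (htr : opTrace (B ^ p) < ∞) : Summable fun j => lam j ^ (-p) := by
  have hpos := eigenvalue_pos hB hnonneg hu
  rw [opTrace_inverse_rpow hB hB0 hu hpos hp] at htr
  exact (tsum_ofReal_ne_top_iff fun i => Real.rpow_nonneg (hpos i).le _).1 htr.ne

theorem IsBoundedInverse.apply_hilbertBasis {B : H →L[ℂ] H} (hB : IsBoundedInverse h B)
    (hu : ∀ j, IsEigen h (lam j) (u j)) (j : J) : B (u j) = (((lam j)⁻¹ : ℝ) : ℂ) • u j :=
  (hB.apply_eigenvector (hu j) (u.orthonormal.ne_zero j)).2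

end Convergence

end FreeGibbs

end

open FreeGibbs in
theorem lemma3p4 {H : Type*} [NormedAddCommGroup H] [InnerProductSpace ℂ H] [CompleteSpace H]
    [TopologicalSpace.SeparableSpace H]
    (h : H →ₗ.[ℂ] H) (hsa : IsSelfAdjoint h)
    (hnonneg : ∀ x : h.domain, 0 ≤ (⟪(x : H), h x⟫_ℂ).re)
    (p : ℝ) (hp : 1 ≤ p) (htr : traceInvPow h p < ∞) :
    (∀ k : ℕ, 1 ≤ k →
      -- the density matrices of the Gibbs states exist, are explicit, and belong to `𝔖^p`
      (∀ T : ℝ, 0 < T →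
        IsDensityMatrix (gibbs h T) k (densityMatrix (gibbs h T) k) ∧
        densityMatrix (gibbs h T) k =
          opTensorPow (opFun h fun a => 1 / (Real.exp (a / T) - 1)) k ∧
        schattenNorm p (densityMatrix (gibbs h T) k) < ∞) ∧
      -- the density matrix of the Gaussian measure is `k! (h⁻¹)^{⊗k}`, and belongs to `𝔖^p`
      (∀ (ι : Type*) (u : HilbertBasis ι ℂ H) (lam : ι → ℝ), (∀ i, IsEigen h (lam i) (u i)) →
        IsGaussianDensityMatrix lam u p k
          ((k.factorial : ℂ) • opTensorPow (opFun h fun a => a⁻¹) k)) ∧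
      schattenNorm p ((k.factorial : ℂ) • opTensorPow (opFun h fun a => a⁻¹) k) < ∞ ∧
      -- convergence in `𝔖^p`
      Filter.Tendsto
        (fun T : ℝ => schattenNorm p
          (((k.factorial / T ^ k : ℝ) : ℂ) • densityMatrix (gibbs h T) k -
            (k.factorial : ℂ) • opTensorPow (opFun h fun a => a⁻¹) k))
        Filter.atTop (nhds 0)) ∧
    Filter.Tendsto (fun T : ℝ => numberExpectation (gibbs h T) / ENNReal.ofReal T)
      Filter.atTop (nhds (traceInvPow h 1)) := by
  have hp0 : 0 < p := zero_lt_one.trans_le hp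
  obtain ⟨B, hB, hBtr⟩ := exists_isBoundedInverse htr
  have hB0 := hB.nonneg hsa hnonneg
  have hsymm := inner_symm_of_isSelfAdjoint hsa
  obtain ⟨J, u, lam, hu⟩ := exists_eigenbasis hp hB hB0 hBtr
  have hpos := eigenvalue_pos hB hnonneg hu
  obtain ⟨M, hM, hlam⟩ := hB.exists_le_eigenvalue hu hpos
  have hsum := summable_eigenvalue_rpow hB hB0 hnonneg hu hp0.le hBtr
  have hBu := hB.apply_hilbertBasis hu
  have hBfun : opFun h (fun a => a⁻¹) = B :=
    opFun_eq (isFunctionOf_of_eigenbasis hsymm hu hBu)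
  have hρ : ∀ T j, 0 < T → opFun h (fun a => 1 / (Real.exp (a / T) - 1)) (u j) =
      ((1 / (Real.exp (lam j / T) - 1) : ℝ) : ℂ) • u j := fun T j hT => by
    obtain ⟨q, s, r, hth⟩ := exists_isThermal_exp (u := u) hpos hM hlam hp0 hT hsum
    rw [opFun_bose_eq hsymm hu hth, hth.apply_r, bose_eq]
  have hdens : ∀ T, 0 < T → ∀ k, IsDensityMatrix (gibbs h T) k
      (opTensorPow (opFun h fun a => 1 / (Real.exp (a / T) - 1)) k) := fun T hT k => by
    obtain ⟨q, s, r, hth⟩ := exists_isThermal_exp (u := u) hpos hM hlam hp0 hT hsum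
    rw [opFun_bose_eq hsymm hu hth]
    exact isDensityMatrix_gibbs hsymm hu hpos hT hth k
  have hsum' : Summable fun j => (lam j)⁻¹ ^ p :=
    hsum.congr fun j => by rw [Real.inv_rpow (hpos j).le, Real.rpow_neg (hpos j).le]
  have habs : Summable fun j => |(lam j)⁻¹| ^ p :=
    hsum'.congr fun j => by rw [abs_of_pos (inv_pos.2 (hpos j))]
  rw [hBfun]
  refine ⟨fun k _ => ⟨fun T hT => ?_, fun ι v μ hv => ?_, ?_, ?_⟩, ?_⟩
  · rw [densityMatrix_eq (hdens T hT k)]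
    refine ⟨hdens T hT k, rfl, schattenNorm_opTensorPow_lt_top (fun j => hρ T j hT) hp0.le ?_⟩
    refine Summable.of_nonneg_of_le (fun j => by positivity) (fun j => ?_)
      (hsum'.mul_left (T ^ p))
    rw [← Real.mul_rpow hT.le (inv_pos.2 (hpos j)).le, abs_of_nonneg (bose_nonneg (hpos j) hT)]
    refine Real.rpow_le_rpow (bose_nonneg (hpos j) hT) ?_ hp0.le
    -- The Bose factor is at most `T / lam j`, so the `𝔖^p` bound for the density matrix reduces to
    -- that for `h⁻¹`.
    rw [mul_comm, ← div_le_iff₀ hT]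
    exact bose_div_le (hpos j) hT
  -- The eigenbasis `v` is arbitrary here and unrelated to `u`; positivity and summability of its
  -- eigenvalues are derived again from the basis-free trace of `B ^ p`.
  · exact isGaussianDensityMatrix (eigenvalue_pos hB hnonneg hv)
      (summable_eigenvalue_rpow hB hB0 hnonneg hv hp0.le hBtr) (hB.apply_hilbertBasis hv) k
  · have h1 := schattenNorm_smul_opTensorPow_lt_top (k := k) hBu hp0.le habs (k.factorial : ℝ)
    rwa [Complex.ofReal_natCast] at h1
  · refine (tendsto_schattenNorm_sub (k := k) hρ hBu (fun T j hT => bose_nonneg (hpos j) hT)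
      (fun T j hT => bose_div_le (hpos j) hT) (fun j => tendsto_bose_div (hpos j)) hp
      hsum').congr' ((Filter.eventually_gt_atTop 0).mono fun T hT => ?_)
    simp only [densityMatrix_eq (hdens T hT k)]
  · rw [traceInvPow_eq hB, opTrace_inverse_rpow hB hB0 hu hpos zero_le_one]
    simp only [Real.rpow_neg_one]
    refine (tendsto_tsum_ofReal_div (b := fun T j => 1 / (Real.exp (lam j / T) - 1))
      (a := fun j => (lam j)⁻¹) (fun T j hT => bose_div_le (hpos j) hT)
      fun j => tendsto_bose_div (hpos j)).congr'
      ((Filter.eventually_gt_atTop 0).mono fun T hT => ?_)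
    obtain ⟨q, s, r, hth⟩ := exists_isThermal_exp (u := u) hpos hM hlam hp0 hT hsum
    simp only [numberExpectation_gibbs hsymm hu hpos hT hth]
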